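/- Let $n\ge 1$, let $(M,g)$ be a smooth Riemannian manifold of dimension $n+1$, and let $i:\Sigma_0\to M$ be a smooth immersion of a compact smooth $n$-manifold with (possibly empty) boundary. Let $N_0$ be a smooth unit normal field along $i$ (the outward one when $\Sigma_0$ is convex), $g_0=i^*g$ the induced metric, and $A_0(v,w)=g(\nabla_vN_0,di(w))$ the second fundamental form. Let $W\subseteq\Sigma_0\times\mathbb R$ be an open neighbourhood of $\Sigma_0\times\{0\}$ whose fibres $\{t:(x,t)\in W\}$ are intervals, and suppose that the normal exponential map $\mathcal E(x,t)=\mathrm{Exp}(-tN_0(x))$ is defined on $W$ and gives coordinates there, i.e. it is a smooth immersion $W\to M$. For a function $f:\Sigma_0\to\mathbb R$ with $(x,f(x))\in W$ for all $x$, the graph of $f$ is the hypersurface $x\mapsto\mathcal E(x,f(x))$. Then there exist functions $\psi(x,t,p)\in\mathbb R$ and bilinear forms $\Psi(x,t,p)$, $\Psi_0(x,t,p)$ on $T_x\Sigma_0$, depending smoothly on $(x,t)\in W$, $p\in T_x\Sigma_0$ and not depending on $f$, such that: (i) $\psi>0$, and for every $R>0$ there is $\epsilon>0$ such that, for all $(x,t)\in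 W$ with $|t|<\epsilon$, the function $p\mapsto\psi(x,t,p)$ is convex on $\{p\in T_x\Sigma_0:\|p\|_{g_0}\le R\}$; (ii) $\Psi$ is symmetric and, for all $(x,t)\in W$ and $p,v,w\in T_x\Sigma_0$, $$\Psi(x,t,p)(v,w)=A_0(v,w)+g_0(p,v)A_0(p,w)+g_0(p,w)A_0(p,v)+t\,\Psi_0(x,t,p)(v,w);$$ in particular, in index notation (with respect to $g_0$), $\Psi(x,f,\nabla f)_{ij}=A_{0,ij}+f_{;i}f_{;k}A_0{}^k{}_j+f_{;j}f_{;k}A_0{}^k{}_i+f\,\Psi_0(x,f,\nabla f)_{ij}$; (iii) for every smooth $f:\Sigma_0\to\mathbb R$ whose graph lies in $W$ (in particular for every such $f\le 0$), the graph of $f$ is a smooth immersed hypersurface with a smooth unit normal field $\nu$ pointing downwards (that is, $g(\nu,\partial_t\mathcal E)<0$). Let $A_f$ denote its second fundamental form, $A_f(v,w)=g(\nabla_v\nu,d\varphi(w))$ with $\varphi(x)=\mathcal E(x,f(x))$, and let the (normalised) Gaussian curvature be $K=\det(\text{shape operator})^{1/n}$. With $\nabla f$ and $\mathrm{Hess}(f)$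 taken with respect to $g_0$, and $\det$ of a bilinear form on $T_x\Sigma_0$ taken with respect to $g_0$, $$K^n=\psi(x,f,\nabla f)^{-n}\det\bigl(\mathrm{Hess}(f)+\Psi(x,f,\nabla f)\bigr),\qquad K=\psi(x,f,\nabla f)^{-1}\det\bigl(\mathrm{Hess}(f)+\Psi(x,f,\nabla f)\bigr)^{1/n},$$ where $K^n$ in the first identity denotes the determinant of the shape operator; (iv) for every such $f$ and every point $x$, $A_f$ is positive definite at $x$ if and only if $\mathrm{Hess}(f)+\Psi(x,f,\nabla f)$ is positive definite at $x$; in particular the graph of $f$ is (locally strictly) convex, i.e. $A_f$ is everywhere positive definite, if and only if $\mathrm{Hess}(f)+\Psi(x,f,\nabla f)$ is everywhere positive definite. -/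

import Mathlib

open Set Bundle
open scoped Manifold ContDiff

set_option maxSynthPendingDepth 3

noncomputable section

namespace GaussGraph

/-! ### Levi-Civita calculus in charts

A tangent vector at `x` is identified with its coordinates in the preferred chart `extChartAt I x`
(in Mathlib `TangentSpace I x` is by definition the model space `E`, read in that chart), so that
all the coordinate expressions below are evaluated at the centre of the chart. -/

section Calculus

variable {E : Type*} [NormedAddCommGroup E] [NormedSpace ℝ E]
  {H : Type*} [TopologicalSpace H] (I : ModelWithCorners ℝ E H)
  {X : Type*} [TopologicalSpace X] [ChartedSpace H X]
  {E' : Type*} [NormedAddCommGroup E'] [NormedSpace ℝ E']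
  {H' : Type*} [TopologicalSpace H'] (J : ModelWithCorners ℝ E' H')
  {Y : Type*} [TopologicalSpace Y] [ChartedSpace H' Y]

/-- A field of bilinear forms on the tangent spaces of `X` (for instance a Riemannian metric). -/
abbrev FormField : Type _ :=
  (x : X) → TangentSpace I x →L[ℝ] TangentSpace I x →L[ℝ] ℝ

/-- The pull-back `(v, w) ↦ B (L v, L w)` of a bilinear form by a linear map. -/
def pullForm {V W : Type*} [AddCommGroup V] [Module ℝ V] [TopologicalSpace V]
    [AddCommGroup W] [Module ℝ W] [TopologicalSpace W]
    (B : W →L[ℝ] W →L[ℝ] ℝ) (L : V →L[ℝ] W) : V →L[ℝ] V →L[ℝ] ℝ :=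
  (L.precomp ℝ) ∘L B ∘L L

/-- The form field `h` in the chart centred at `x₀`: at `z` in the range of the chart it is the
bilinear form on `E` with coefficients `h_ij = h(∂_i, ∂_j)` at the point with coordinates `z`. -/
def coordForm (h : FormField I (X := X)) (x₀ : X) (z : E) : E →L[ℝ] E →L[ℝ] ℝ :=
  pullForm (h ((extChartAt I x₀).symm z))
    (mfderivWithin 𝓘(ℝ, E) I (extChartAt I x₀).symm (range I) z)

/-- The derivative at `x₀` of the coefficients of `h` in the chart centred at `x₀`:
`dCoord I h x₀ u v w = u^k v^i w^j ∂_k h_ij`. -/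
def dCoord (h : FormField I (X := X)) (x₀ : X) : E →L[ℝ] E →L[ℝ] E →L[ℝ] ℝ :=
  (fderivWithin ℝ (coordForm I h x₀) (range I) (extChartAt I x₀ x₀) :)

/-- Christoffel symbols of the first kind of the metric `h` at `x₀`:
`Γ(u, v; w) = (∂_u h(v, w) + ∂_v h(u, w) - ∂_w h(u, v)) / 2`. -/
def christoffelFirst (h : FormField I (X := X)) (x₀ : X) : E →L[ℝ] E →L[ℝ] E →L[ℝ] ℝ :=
  let D : E →L[ℝ] E →L[ℝ] E →L[ℝ] ℝ := dCoord I h x₀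
  let D' : E →L[ℝ] E →L[ℝ] E →L[ℝ] ℝ :=
    ((ContinuousLinearMap.flipₗᵢ ℝ E E ℝ).toContinuousLinearEquiv :
        (E →L[ℝ] E →L[ℝ] ℝ) →L[ℝ] (E →L[ℝ] E →L[ℝ] ℝ)) ∘L D.flip
  ((2⁻¹ : ℝ) • (D + D.flip - D') :)

theorem christoffelFirst_apply (h : FormField I (X := X)) (x₀ : X) (u v w : E) :
    christoffelFirst I h x₀ u v w =
      (dCoord I h x₀ u v w + dCoord I h x₀ v u w - dCoord I h x₀ w u v) / 2 := by
  change 2⁻¹ * (dCoord I h x₀ u v w + dCoord I h x₀ v u w - dCoord I h x₀ w u v) = _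
  ring

/-- Raising an index with the metric `h`: the linear form `ℓ` on `T_x X` is sent to the vector `p`
with `h(p, ·) = ℓ`. -/
def raise (h : FormField I (X := X)) (x : X) :
    (TangentSpace I x →L[ℝ] ℝ) →L[ℝ] TangentSpace I x :=
  (h x).inverse

/-- Christoffel symbols of the second kind: the Levi-Civita connection of `h` is
`D + Γ` in the chart centred at `x₀`. -/
def christoffel (h : FormField I (X := X)) (x₀ : X) : E →L[ℝ] E →L[ℝ] E :=
  (ContinuousLinearMap.postcomp E (raise I h x₀ : (E →L[ℝ] ℝ) →L[ℝ] E)) ∘L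
    christoffelFirst I h x₀

/-- The gradient of `f` with respect to the metric `h`. -/
def gradient (h : FormField I (X := X)) (f : X → ℝ) (x : X) : TangentSpace I x :=
  raise I h x (mfderiv I 𝓘(ℝ, ℝ) f x)

/-- The Hessian of `f` for the Levi-Civita connection of the metric `h`:
`(Hess f)(v, w) = D²f(v, w) - df(Γ(v, w))`. -/
def hessian (h : FormField I (X := X)) (f : X → ℝ) (x : X) :
    TangentSpace I x →L[ℝ] TangentSpace I x →L[ℝ] ℝ :=
  let D2f : E →L[ℝ] E →L[ℝ] ℝ :=
    (fderivWithin ℝ (fderivWithin ℝ (f ∘ (extChartAt I x).symm) (range I)) (range I)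
      (extChartAt I x x) :)
  let df : E →L[ℝ] ℝ := mfderiv I 𝓘(ℝ, ℝ) f x
  let dfΓ : E →L[ℝ] E →L[ℝ] ℝ := ContinuousLinearMap.postcomp E df ∘L christoffel I h x
  show E →L[ℝ] E →L[ℝ] ℝ from D2f - dfΓ

/-- The covariant derivative `v ↦ ∇_v V` at `x` of a vector field `V` along the map `φ : X → Y`,
for the Levi-Civita connection of the metric `g` of `Y`: in the chart of `Y` centred at `φ x`,
`∇_v V = D_v V + Γ(dφ(v), V)`. -/
def covDerivAlong (g : FormField J (X := Y)) (φ : X → Y)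
    (V : (x : X) → TangentSpace J (φ x)) (x : X) :
    TangentSpace I x →L[ℝ] TangentSpace J (φ x) :=
  let Vc : X → E' := fun y => mfderiv J 𝓘(ℝ, E') (extChartAt J (φ x)) (φ y) (V y)
  let DV : E →L[ℝ] E' := mfderiv I 𝓘(ℝ, E') Vc x
  let dφ : E →L[ℝ] E' := mfderiv I J φ x
  show E →L[ℝ] E' from DV + ((christoffel J g (φ x)).flip (V x)) ∘L dφ

/-- The first fundamental form (induced metric) of the map `φ : X → Y`. -/
def firstForm (g : FormField J (X := Y)) (φ : X → Y) : FormField I (X := X) :=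
  fun x => pullForm (g (φ x)) (mfderiv I J φ x)

/-- The second fundamental form of `φ` with respect to the normal field `ν`:
`A(v, w) = g(∇_v ν, dφ(w))`. -/
def secondForm (g : FormField J (X := Y)) (φ : X → Y)
    (ν : (x : X) → TangentSpace J (φ x)) : FormField I (X := X) :=
  fun x => ((mfderiv I J φ x).precomp ℝ) ∘L g (φ x) ∘L covDerivAlong I J g φ ν x

/-- The endomorphism of `T_x X` that corresponds to the bilinear form `B` under the metric `h`:
`h(L v, w) = B(v, w)`, i.e. `L^k_i = h^{kj} B_ij`. -/
def toEndo (h : FormField I (X := X)) (x : X)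
    (B : TangentSpace I x →L[ℝ] TangentSpace I x →L[ℝ] ℝ) :
    TangentSpace I x →L[ℝ] TangentSpace I x :=
  raise I h x ∘L B

/-- The shape operator of `φ` with respect to the normal field `ν`. -/
def shapeOperator (g : FormField J (X := Y)) (φ : X → Y)
    (ν : (x : X) → TangentSpace J (φ x)) (x : X) :
    TangentSpace I x →L[ℝ] TangentSpace I x :=
  toEndo I (firstForm I J g φ) x (secondForm I J g φ ν x)

/-- Smooth immersions: smooth maps with everywhere injective derivative. -/
structure IsSmoothImmersion (φ : X → Y) : Prop where
  smooth : ContMDiff I J ∞ φ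
  injective : ∀ x, Function.Injective (mfderiv I J φ x)

/-- `ν` is a smooth unit normal vector field along `φ`. -/
structure IsUnitNormal [IsManifold J ∞ Y] (g : FormField J (X := Y)) (φ : X → Y)
    (ν : (x : X) → TangentSpace J (φ x)) : Prop where
  smooth : ContMDiff I J.tangent ∞ (fun x => (⟨φ x, ν x⟩ : TangentBundle J Y))
  unit : ∀ x, g (φ x) (ν x) (ν x) = 1
  normal : ∀ x (v : TangentSpace I x), g (φ x) (ν x) (mfderiv I J φ x v) = 0

/-- The velocity of a curve. -/
def velocity (γ : ℝ → Y) (t : ℝ) : TangentSpace J (γ t) :=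
  mfderiv 𝓘(ℝ, ℝ) J γ t (1 : ℝ)

/-- The normal exponential map `𝓔(x, t) = Exp(-t N(x))` of the hypersurface `φ` with unit normal
field `N` furnishes coordinates on `W ⊆ X × ℝ`. Here `W` is an open neighbourhood of `X × {0}` whose
vertical fibres are intervals; `t ↦ 𝓔(x, t)` is the geodesic that leaves `φ x` with velocity
`-N x`, which determines `𝓔` on `W`; and `𝓔` is a smooth immersion of `W`. -/
structure IsNormalExp (g : FormField J (X := Y)) (φ : X → Y)
    (N : (x : X) → TangentSpace J (φ x)) (W : Set (X × ℝ)) (𝓔 : X × ℝ → Y) : Prop where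
  isOpen : IsOpen W
  zero_mem : ∀ x, (x, (0 : ℝ)) ∈ W
  ordConnected : ∀ x, OrdConnected {t : ℝ | (x, t) ∈ W}
  smooth : ContMDiffOn (I.prod 𝓘(ℝ, ℝ)) J ∞ 𝓔 W
  initial : ∀ x, (⟨𝓔 (x, 0), velocity J (fun t => 𝓔 (x, t)) 0⟩ : TangentBundle J Y) = ⟨φ x, -N x⟩
  geodesic : ∀ x t, (x, t) ∈ W →
    covDerivAlong 𝓘(ℝ, ℝ) J g (fun s => 𝓔 (x, s)) (velocity J (fun s => 𝓔 (x, s))) t (1 : ℝ) = 0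
  immersive : ∀ q ∈ W, Function.Injective (mfderiv (I.prod 𝓘(ℝ, ℝ)) J 𝓔 q)

/-- The graph of `f`, parametrised by `x ↦ 𝓔(x, f(x))`. -/
def graph (𝓔 : X × ℝ → Y) (f : X → ℝ) (x : X) : Y := 𝓔 (x, f x)

/-- `ν` is the smooth unit normal field of the graph of `f` that points downwards, i.e. to the side
of decreasing `t` (for `f = 0` it is `N`). -/
structure IsDownwardNormal [IsManifold J ∞ Y] (g : FormField J (X := Y)) (𝓔 : X × ℝ → Y) (f : X → ℝ)
    (ν : (x : X) → TangentSpace J (graph 𝓔 f x)) : Prop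
    extends IsUnitNormal I J g (graph 𝓔 f) ν where
  downward : ∀ x, g (graph 𝓔 f x) (ν x) (velocity J (fun t => 𝓔 (x, t)) (f x)) < 0

end Calculus

/-- Positive definite bilinear forms. -/
def PosDefForm {V : Type*} [AddCommGroup V] [Module ℝ V] [TopologicalSpace V]
    (B : V →L[ℝ] V →L[ℝ] ℝ) : Prop :=
  (∀ v w, B v w = B w v) ∧ ∀ v, v ≠ 0 → 0 < B v v

/-- The normalised Gaussian curvature `K = Det(A)^{1/n}`, for `A` the shape operator of a
hypersurface of dimension `n`. -/
def gaussCurvature {n m : ℕ} {H : Type*} [TopologicalSpace H]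
    (I : ModelWithCorners ℝ (EuclideanSpace ℝ (Fin n)) H)
    {X : Type*} [TopologicalSpace X] [ChartedSpace H X]
    {H' : Type*} [TopologicalSpace H']
    (J : ModelWithCorners ℝ (EuclideanSpace ℝ (Fin m)) H')
    {Y : Type*} [TopologicalSpace Y] [ChartedSpace H' Y]
    (g : FormField J (X := Y)) (φ : X → Y) (ν : (x : X) → TangentSpace J (φ x)) (x : X) : ℝ :=
  (shapeOperator I J g φ ν x).det ^ ((1 : ℝ) / n)

/-- A hypersurface with unit normal `ν` is (locally strictly) convex if its second fundamental form
with respect to `ν` is positive definite at every point. -/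
def IsConvexHypersurface {E : Type*} [NormedAddCommGroup E] [NormedSpace ℝ E]
    {H : Type*} [TopologicalSpace H] (I : ModelWithCorners ℝ E H)
    {X : Type*} [TopologicalSpace X] [ChartedSpace H X]
    {E' : Type*} [NormedAddCommGroup E'] [NormedSpace ℝ E']
    {H' : Type*} [TopologicalSpace H'] (J : ModelWithCorners ℝ E' H')
    {Y : Type*} [TopologicalSpace Y] [ChartedSpace H' Y]
    (g : FormField J (X := Y)) (φ : X → Y) (ν : (x : X) → TangentSpace J (φ x)) : Prop :=
  ∀ x, PosDefForm (secondForm I J g φ ν x)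

/-- A smooth family of bilinear forms `Ψ(x, t, p)` on `T_x X`, with `p ∈ T_x X` and `(x, t) ∈ W`. -/
def SmoothFormFamily {E : Type*} [NormedAddCommGroup E] [NormedSpace ℝ E]
    {H : Type*} [TopologicalSpace H] (I : ModelWithCorners ℝ E H)
    {X : Type*} [TopologicalSpace X] [ChartedSpace H X] [IsManifold I ∞ X] (W : Set (X × ℝ))
    (Ψ : (x : X) → ℝ → TangentSpace I x →
      (TangentSpace I x →L[ℝ] TangentSpace I x →L[ℝ] ℝ)) : Prop :=
  haveI : IsManifold I 1 X := .of_le (n := ∞) (by simp)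
  ContMDiffOn (I.tangent.prod 𝓘(ℝ, ℝ)) (I.prod 𝓘(ℝ, E →L[ℝ] E →L[ℝ] ℝ)) ∞
    (fun q : TangentBundle I X × ℝ =>
      TotalSpace.mk' (E →L[ℝ] E →L[ℝ] ℝ)
        (E := fun x : X => TangentSpace I x →L[ℝ] TangentSpace I x →L[ℝ] ℝ)
        q.1.proj (Ψ q.1.proj q.2 q.1.2))
    {q | (q.1.proj, q.2) ∈ W}

/-- A smooth family of functions `ψ(x, t, p)`, with `p ∈ T_x X` and `(x, t) ∈ W`. -/
def SmoothFunFamily {E : Type*} [NormedAddCommGroup E] [NormedSpace ℝ E]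
    {H : Type*} [TopologicalSpace H] (I : ModelWithCorners ℝ E H)
    {X : Type*} [TopologicalSpace X] [ChartedSpace H X] [IsManifold I ∞ X] (W : Set (X × ℝ))
    (ψ : (x : X) → ℝ → TangentSpace I x → ℝ) : Prop :=
  haveI : IsManifold I 1 X := .of_le (n := ∞) (by simp)
  ContMDiffOn (I.tangent.prod 𝓘(ℝ, ℝ)) 𝓘(ℝ, ℝ) ∞
    (fun q : TangentBundle I X × ℝ => ψ q.1.proj q.2 q.1.2)
    {q | (q.1.proj, q.2) ∈ W}

end GaussGraph

end

noncomputable section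

namespace GaussGraph

/-! ### Bilinear forms on finite-dimensional spaces -/

section Forms

variable {V : Type*} [NormedAddCommGroup V] [NormedSpace ℝ V]

/-! The Gauss lemma puts the ambient metric into the form `𝓔^* g = dt² + g_t`, with `g_t` the metric
that the slice `x ↦ 𝓔(x, t)` induces (`gauss_lemma`). Along every geodesic the Koszul symbols
`Γ(∂_t, ∂_t; ·)` vanish, so the products of `∂_t` with `∂_t` and with horizontal vectors keep their
initial values 1 and 0.

In these Fermi coordinates the graph of `f` has tangent vectors `(v, df v)`, first form `g_t + df ⊗
df` and downward unit normal `(q, -1)/√(1 + df(q))`, where `g_t(q, ·) = df`. Differentiating the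
orthogonality of the normal gives (`secondForm_fermi`) `A_f(v, w) = (1 + df(q))^{-1/2} (D²f(v, w) -
Γ_t(v, w; q) - (∂_t g_t(v, w) + df(v) ∂_t g_t(w, q) + df(w) ∂_t g_t(v, q))/2)`. With `p = ∇f` one
has `D²f = Hess f + Γ_0(·, ·; p)`, so the bracket is `Hess f + Ψ(x, f, p)`, where `Ψ` (`graphForm`)
depends only on `(x, t, p)`. It is a tensor although each Christoffel symbol is not: a change of
chart adds `g_0(S, p)` to one and `g_t(S, q)` to the other, and these agree because `g_t(q, ·) =
g_0(p, ·)` (`graphForm_pull`).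

At `t = 0` one has `q = p`, the Christoffel terms cancel, and only `∂_t g_t` remains. The same
formula for the zero function shows that it equals `-2 A_0`, which is the stated leading part of `Ψ`
(`graphTensorAt_zero`). The remainder `Ψ_0` is the difference quotient of `Ψ` in `t`, smooth across
`t = 0` by Hadamard's integral formula (`contDiffOn_coordQuotient`).

Relative to `g_0`, the first form has determinant `det(g_0⁻¹ g_t)(1 + df(q))`, and the normalisation
of the normal contributes `(1 + df(q))^{-n/2}`. Hence `ψ = det(g_0⁻¹ g_t)^{1/n} (1 +
df(q))^{(n+2)/(2n)}` (`graphFactor`, `det_shape`). Since `df(q)` is a nonnegative quadratic form in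
`p` and the exponent is at least `1/2`, `ψ` is convex in `p` on the whole tangent space. Positive
definiteness is transferred because `A_f` is a positive multiple of `Hess f + Ψ`.

Points of the boundary are handled by derivatives within the range of the model, a convex set with
unique derivatives contained in the closure of its interior. -/

theorem pullForm_apply {V W : Type*} [AddCommGroup V] [Module ℝ V] [TopologicalSpace V]
    [AddCommGroup W] [Module ℝ W] [TopologicalSpace W]
    (B : W →L[ℝ] W →L[ℝ] ℝ) (L : V →L[ℝ] W) (v w : V) :
    pullForm B L v w = B (L v) (L w) := rfl

theorem PosDefForm.pullForm {V W : Type*} [AddCommGroup V] [Module ℝ V] [TopologicalSpace V]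
    [AddCommGroup W] [Module ℝ W] [TopologicalSpace W]
    {B : W →L[ℝ] W →L[ℝ] ℝ} (hB : PosDefForm B) {L : V →L[ℝ] W}
    (hL : Function.Injective L) : PosDefForm (pullForm B L) := by
  refine ⟨fun v w => hB.1 _ _, fun v hv => hB.2 _ fun h => hv (hL (h.trans (map_zero L).symm))⟩

theorem PosDefForm.nonneg {V : Type*} [AddCommGroup V] [Module ℝ V] [TopologicalSpace V]
    {B : V →L[ℝ] V →L[ℝ] ℝ} (hB : PosDefForm B) (v : V) :
    0 ≤ B v v := by
  rcases eq_or_ne v 0 with rfl | hv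
  · simp
  · exact (hB.2 v hv).le

theorem posDefForm_smul_iff {V : Type*} [AddCommGroup V] [Module ℝ V] [TopologicalSpace V]
    {B : V →L[ℝ] V →L[ℝ] ℝ} {C : V →L[ℝ] V →L[ℝ] ℝ} {c : ℝ} (hc : 0 < c)
    (h : ∀ v w, C v w = c * B v w) : PosDefForm C ↔ PosDefForm B := by
  simp only [PosDefForm, h]
  refine and_congr ?_ ?_
  · exact forall₂_congr fun v w => ⟨fun h => mul_left_cancel₀ hc.ne' h, fun h => by rw [h]⟩
  · exact forall₂_congr fun v w => ⟨fun h => pos_of_mul_pos_right h hc.le, fun h => mul_pos hc h⟩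

theorem PosDefForm.isInvertible [FiniteDimensional ℝ V] {B : V →L[ℝ] V →L[ℝ] ℝ}
    (hB : PosDefForm B) : B.IsInvertible := by
  have hinj : Function.Injective (B : V →ₗ[ℝ] V →L[ℝ] ℝ) := by
    rw [← LinearMap.ker_eq_bot, LinearMap.ker_eq_bot']
    intro v hv
    by_contra hne
    have h := hB.2 v hne
    have h0 : B v = 0 := hv
    rw [h0] at h
    simp at h
  have hdim : Module.finrank ℝ V = Module.finrank ℝ (V →L[ℝ] ℝ) := by
    rw [← LinearEquiv.finrank_eq (LinearMap.toContinuousLinearMap (𝕜 := ℝ) (E := V) (F' := ℝ)),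
      Module.finrank_linearMap, Module.finrank_self, mul_one]
  have : FiniteDimensional ℝ (V →L[ℝ] ℝ) :=
    (LinearMap.toContinuousLinearMap (𝕜 := ℝ) (E := V) (F' := ℝ)).finiteDimensional
  let e := LinearEquiv.ofInjectiveOfFinrankEq (B : V →ₗ[ℝ] V →L[ℝ] ℝ) hinj hdim
  refine ⟨e.toContinuousLinearEquiv, ?_⟩
  ext v
  rfl

theorem PosDefForm.apply_inverse [FiniteDimensional ℝ V] {B : V →L[ℝ] V →L[ℝ] ℝ}
    (hB : PosDefForm B) (ℓ : V →L[ℝ] ℝ) : B (B.inverse ℓ) = ℓ := by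
  have := hB.isInvertible.self_comp_inverse
  exact DFunLike.congr_fun this ℓ

theorem PosDefForm.inverse_apply [FiniteDimensional ℝ V] {B : V →L[ℝ] V →L[ℝ] ℝ}
    (hB : PosDefForm B) (v : V) : B.inverse (B v) = v := by
  have := hB.isInvertible.inverse_comp_self
  exact DFunLike.congr_fun this v

theorem PosDefForm.eq_inverse [FiniteDimensional ℝ V] {B : V →L[ℝ] V →L[ℝ] ℝ}
    (hB : PosDefForm B) {ℓ : V →L[ℝ] ℝ} {v : V} (h : ∀ w, B v w = ℓ w) : v = B.inverse ℓ := by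
  rw [← hB.inverse_apply v]
  congr 1
  ext w
  exact h w

/-- Raising an index with a symmetric form is self-adjoint. -/
theorem PosDefForm.inverse_symm [FiniteDimensional ℝ V] {B : V →L[ℝ] V →L[ℝ] ℝ}
    (hB : PosDefForm B) (ℓ m : V →L[ℝ] ℝ) : ℓ (B.inverse m) = m (B.inverse ℓ) := by
  conv_lhs => rw [← hB.apply_inverse ℓ]
  rw [hB.1, hB.apply_inverse]

theorem PosDefForm.matrix_posDef {ι : Type*} [Fintype ι] [DecidableEq ι]
    {B : V →L[ℝ] V →L[ℝ] ℝ} (hB : PosDefForm B) (b : Module.Basis ι ℝ V) :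
    (Matrix.of fun i j => B (b i) (b j)).PosDef := by
  rw [Matrix.posDef_iff_dotProduct_mulVec]
  refine ⟨?_, fun x hx => ?_⟩
  · ext i j
    simp [Matrix.conjTranspose_apply, hB.1 (b j) (b i)]
  · have hne : ∑ i, x i • b i ≠ 0 := by
      intro h
      exact hx (funext fun i => Fintype.linearIndependent_iff.1 b.linearIndependent x h i)
    have h := hB.2 _ hne
    suffices hsum : star x ⬝ᵥ (Matrix.of fun i j => B (b i) (b j)).mulVec x
        = B (∑ i, x i • b i) (∑ i, x i • b i) from hsum ▸ h
    simp only [dotProduct, Matrix.mulVec, map_sum, map_smul, star_trivial, Pi.star_apply,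
      sum_apply, smul_apply, Matrix.of_apply, smul_eq_mul, Finset.mul_sum]
    rw [Finset.sum_comm]
    refine Finset.sum_congr rfl fun i _ => Finset.sum_congr rfl fun j _ => ?_
    rw [hB.1]
    ring

/-- In a basis the Gram matrix of `C` is the transpose of the matrix of `B⁻¹C` times the Gram matrix
of `B`, and both Gram determinants are positive. -/
theorem det_inverse_comp_pos [FiniteDimensional ℝ V] {B C : V →L[ℝ] V →L[ℝ] ℝ}
    (hB : PosDefForm B) (hC : PosDefForm C) : 0 < (B.inverse ∘L C).det := by
  classical
  let b := Module.finBasis ℝ V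
  set X : V →ₗ[ℝ] V := ((B.inverse ∘L C : V →L[ℝ] V) : V →ₗ[ℝ] V) with hX
  have hBX : ∀ v w, B (X v) w = C v w := fun v w => by
    change B (B.inverse (C v)) w = _
    rw [hB.apply_inverse]
  have hmul : (Matrix.of fun i j => C (b i) (b j))
      = (LinearMap.toMatrix b b X).transpose * (Matrix.of fun i j => B (b i) (b j)) := by
    ext i j
    rw [Matrix.mul_apply]
    simp only [Matrix.transpose_apply, Matrix.of_apply, LinearMap.toMatrix_apply]
    rw [← hBX]
    conv_lhs => rw [← b.sum_repr (X (b i))]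
    simp only [map_sum, map_smul, sum_apply, smul_apply, smul_eq_mul]
  have h1 := (hC.matrix_posDef b).det_pos
  have h2 := (hB.matrix_posDef b).det_pos
  rw [hmul, Matrix.det_mul, Matrix.det_transpose, LinearMap.det_toMatrix] at h1
  exact pos_of_mul_pos_left h1 h2.le

theorem PosDefForm.add_smulRight {V : Type*} [NormedAddCommGroup V] [NormedSpace ℝ V]
    {B : V →L[ℝ] V →L[ℝ] ℝ} (hB : PosDefForm B)
    (ℓ : V →L[ℝ] ℝ) : PosDefForm (B + ℓ.smulRight ℓ) := by
  refine ⟨fun v w => ?_, fun v hv => ?_⟩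
  · simp only [add_apply, ContinuousLinearMap.smulRight_apply,
      smul_apply, smul_eq_mul]
    rw [hB.1 v w, mul_comm]
  · simp only [add_apply, ContinuousLinearMap.smulRight_apply,
      smul_apply, smul_eq_mul]
    have := hB.2 v hv
    nlinarith [mul_self_nonneg (ℓ v)]

/-- The determinant of `C` with respect to the rank one perturbation `B + ℓ ⊗ ℓ`, compared with its
determinant with respect to `A`. -/
theorem det_inverse_add_smulRight_comp [FiniteDimensional ℝ V] {A B : V →L[ℝ] V →L[ℝ] ℝ}
    (hB : PosDefForm B) (ℓ : V →L[ℝ] ℝ) (C : V →L[ℝ] V →L[ℝ] ℝ) :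
    ((B + ℓ.smulRight ℓ).inverse ∘L C).det * ((A.inverse ∘L B).det * (1 + ℓ (B.inverse ℓ)))
      = (A.inverse ∘L C).det := by
  have hG := hB.add_smulRight ℓ
  set G := B + ℓ.smulRight ℓ with hGdef
  -- The factorisation is `A⁻¹C = (A⁻¹B)(B⁻¹G)(G⁻¹C)`. Its middle factor is the transvection `v ↦ v
  -- + ℓ(v) B⁻¹ℓ`, whose determinant is `1 + ℓ(B⁻¹ℓ)`.
  have h1 : (A.inverse ∘L C) = (A.inverse ∘L G) ∘L (G.inverse ∘L C) := by
    ext v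
    simp [hG.apply_inverse]
  have h2 : (A.inverse ∘L G) = (A.inverse ∘L B) ∘L (B.inverse ∘L G) := by
    ext v
    simp [hB.apply_inverse]
  have h3 : (B.inverse ∘L G).det = 1 + ℓ (B.inverse ℓ) := by
    have : ((B.inverse ∘L G : V →L[ℝ] V) : V →ₗ[ℝ] V)
        = LinearMap.transvection (ℓ : V →ₗ[ℝ] ℝ) (B.inverse ℓ) := by
      ext v
      simp [LinearMap.transvection, hGdef, hB.inverse_apply]
    rw [ContinuousLinearMap.det, this, LinearMap.transvection.det]
    rfl
  have hmul : ∀ X Y : V →L[ℝ] V, (X ∘L Y).det = X.det * Y.det := fun X Y => by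
    simp [ContinuousLinearMap.det]
  rw [h1, hmul, h2, hmul, h3]
  ring

theorem det_inverse_comp_smul [FiniteDimensional ℝ V] (A C : V →L[ℝ] V →L[ℝ] ℝ) (c : ℝ) :
    (A.inverse ∘L (c • C)).det = c ^ Module.finrank ℝ V * (A.inverse ∘L C).det := by
  have : ((A.inverse ∘L (c • C) : V →L[ℝ] V) : V →ₗ[ℝ] V)
      = c • ((A.inverse ∘L C : V →L[ℝ] V) : V →ₗ[ℝ] V) := by
    ext v
    simp
  rw [ContinuousLinearMap.det, this, LinearMap.det_smul, ContinuousLinearMap.det]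

/-- Powers `(1 + q)^α`, `α ≥ 1/2`, of positive semidefinite quadratic forms are convex. -/
theorem convexOn_one_add_rpow {B : V →L[ℝ] V →L[ℝ] ℝ} (hs : ∀ v w, B v w = B w v)
    (hn : ∀ v, 0 ≤ B v v) {α : ℝ} (hα : 1 / 2 ≤ α) :
    ConvexOn ℝ univ (fun p => (1 + B p p) ^ α) := by
  -- The function `√(1 + B p p)` is the seminorm of `(1, p)` for the form `1 ⊕ B`, hence convex. The
  -- power `s ↦ s^(2α)` is convex and increasing on `[0, ∞)` because `2α ≥ 1`, so the composition is
  -- convex.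
  have h1 : ConvexOn ℝ univ (fun p => √(1 + B p p)) := by
    refine ⟨convex_univ, fun x _ y _ a b ha hb hab => ?_⟩
    simp only [smul_eq_mul]
    have hx := hn x
    have hy := hn y
    -- Cauchy–Schwarz for `1 ⊕ B` on `(1, x)` and `(1, y)`. After expansion it is the sum of `B(x,
    -- y)² ≤ B(x, x) B(y, y)`, from the discriminant, and `2 B(x, y) ≤ B(x, x) + B(y, y)`, from the
    -- value at `x - y`.
    have hcs : (1 + B x y) ^ 2 ≤ (1 + B x x) * (1 + B y y) := by
      have hq : ∀ s : ℝ, 0 ≤ B x x * (s * s) + (2 * B x y) * s + B y y := fun s => by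
        have := hn (s • x + y)
        simp only [map_add, map_smul, add_apply,
          smul_apply, smul_eq_mul, hs y x] at this
        linarith
      have hd := discrim_le_zero hq
      rw [discrim] at hd
      have := hn (x - y)
      simp only [map_sub, sub_apply, hs y x] at this
      nlinarith
    have hcs' : 1 + B x y ≤ √(1 + B x x) * √(1 + B y y) := by
      rw [← Real.sqrt_mul (by linarith)]
      exact Real.le_sqrt_of_sq_le hcs
    apply Real.sqrt_le_iff.2 ⟨by positivity, ?_⟩
    simp only [map_add, map_smul, add_apply,
          smul_apply, smul_eq_mul, hs y x]
    have e1 := Real.sq_sqrt (show 0 ≤ 1 + B x x by linarith)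
    have e2 := Real.sq_sqrt (show 0 ≤ 1 + B y y by linarith)
    have h3 := mul_le_mul_of_nonneg_left hcs' (mul_nonneg ha hb)
    have hexp : (a * √(1 + B x x) + b * √(1 + B y y)) ^ 2
        = a ^ 2 * (1 + B x x) + b ^ 2 * (1 + B y y)
          + 2 * (a * b * (√(1 + B x x) * √(1 + B y y))) := by
      rw [← e1, ← e2]
      simp only [Real.sqrt_sq (Real.sqrt_nonneg _)]
      ring
    rw [hexp]
    have : (a + b) ^ 2 = 1 := by rw [hab]; norm_num
    nlinarith
  have h2 : ConvexOn ℝ (Ici (0 : ℝ)) (fun s : ℝ => s ^ (2 * α)) :=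
    convexOn_rpow (by linarith)
  have h3 : ConvexOn ℝ univ ((fun s : ℝ => s ^ (2 * α)) ∘ fun p => √(1 + B p p)) := by
    refine ⟨convex_univ, fun x _ y _ a b ha hb hab => ?_⟩
    refine le_trans ?_ (h2.2 (Real.sqrt_nonneg _) (Real.sqrt_nonneg _) ha hb hab)
    exact Real.rpow_le_rpow (Real.sqrt_nonneg _) (h1.2 (mem_univ x) (mem_univ y) ha hb hab)
      (by linarith)
  convert h3 using 2 with p
  rw [Function.comp_apply, Real.sqrt_eq_rpow, ← Real.rpow_mul (by have := hn p; linarith)]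
  congr 1
  ring

/-- Needed because the determinant of `Hess f + Ψ` may be negative for a graph that is not convex. A
negative base contributes an exponential times a cosine of the exponent alone, so a positive factor
still splits off. -/
theorem mul_rpow_of_pos {c : ℝ} (hc : 0 < c) (y r : ℝ) : (c * y) ^ r = c ^ r * y ^ r := by
  rcases lt_trichotomy y 0 with hy | rfl | hy
  · rw [Real.rpow_def_of_neg (mul_neg_of_pos_of_neg hc hy), Real.rpow_def_of_neg hy,
      Real.rpow_def_of_pos hc, Real.log_mul hc.ne' hy.ne, add_mul, Real.exp_add]
    ring
  · rcases eq_or_ne r 0 with rfl | hr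
    · simp
    · simp [Real.zero_rpow hr]
  · exact Real.mul_rpow hc.le hy.le

end Forms

/-! ### Parametric integrals and division by a coordinate, up to the boundary -/

section Parametric

open MeasureTheory Topology

/-- Compactness of `[0, 1]` makes `K' q' σ` close to `K' q σ` uniformly in `σ` for `q'` near `q`.
The mean value inequality on the convex set `ball ∩ s` then bounds the Taylor remainder of the
integrand by `ε ‖q' - q‖` for every `σ`. Convexity of `s` takes the place of openness, so boundary
points are admitted. -/
theorem hasFDerivWithinAt_parametric_integral {P V : Type*}
    [NormedAddCommGroup P] [NormedSpace ℝ P] [NormedAddCommGroup V] [NormedSpace ℝ V]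
    {s : Set P} (hs : Convex ℝ s) {K : P → ℝ → V} {K' : P → ℝ → P →L[ℝ] V}
    (hK : ContinuousOn K.uncurry (s ×ˢ Icc (0 : ℝ) 1))
    (hK' : ContinuousOn K'.uncurry (s ×ˢ Icc (0 : ℝ) 1))
    (hd : ∀ q ∈ s, ∀ σ ∈ Icc (0 : ℝ) 1, HasFDerivWithinAt (fun q => K q σ) (K' q σ) s q)
    {q : P} (hq : q ∈ s) :
    HasFDerivWithinAt (fun q => ∫ σ in (0 : ℝ)..1, K q σ) (∫ σ in (0 : ℝ)..1, K' q σ) s q := by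
  have hslice : ∀ {U : Type _} [NormedAddCommGroup U] {k : P → ℝ → U},
      ContinuousOn k.uncurry (s ×ˢ Icc (0 : ℝ) 1) → ∀ q ∈ s,
      IntervalIntegrable (k q) volume 0 1 := by
    intro U _ k hk q hq
    apply ContinuousOn.intervalIntegrable
    rw [uIcc_of_le zero_le_one]
    exact hk.comp (f := fun σ => (q, σ)) (by fun_prop) fun σ hσ => ⟨hq, hσ⟩
  have hI' : IntervalIntegrable (K' q) volume 0 1 := by
    apply ContinuousOn.intervalIntegrable
    rw [uIcc_of_le zero_le_one]
    exact hK'.comp (f := fun σ => (q, σ)) (by fun_prop) fun σ hσ => ⟨hq, hσ⟩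
  rw [hasFDerivWithinAt_iff_isLittleO, Asymptotics.isLittleO_iff]
  intro ε hε
  obtain ⟨v, hv, hvK⟩ := isCompact_Icc.mem_uniformity_of_prod hK' hq (Metric.dist_mem_uniformity hε)
  obtain ⟨δ, hδ, hδv⟩ := Metric.mem_nhdsWithin_iff.1 hv
  have hball : Metric.ball q δ ∩ s ∈ 𝓝[s] q :=
    Filter.inter_mem (mem_nhdsWithin_of_mem_nhds (Metric.ball_mem_nhds q hδ)) self_mem_nhdsWithin
  filter_upwards [hball] with q' hq'
  have hbound : ∀ σ ∈ Icc (0 : ℝ) 1, ‖K q' σ - K q σ - K' q σ (q' - q)‖ ≤ ε * ‖q' - q‖ := by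
    intro σ hσ
    refine Convex.norm_image_sub_le_of_norm_hasFDerivWithin_le' (s := Metric.ball q δ ∩ s)
      (f' := fun q => K' q σ) (fun p hp => (hd p hp.2 σ hσ).mono inter_subset_right)
      (fun p hp => ?_) ((convex_ball q δ).inter hs) ⟨Metric.mem_ball_self hδ, hq⟩ hq'
    have := hvK p (hδv hp) σ hσ
    rw [← dist_eq_norm]
    exact (le_of_lt this)
  have happ : (∫ σ in (0 : ℝ)..1, K' q σ) (q' - q) = ∫ σ in (0 : ℝ)..1, K' q σ (q' - q) :=
    ContinuousLinearMap.intervalIntegral_apply hI' _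
  have hI'' : IntervalIntegrable (fun σ => K' q σ (q' - q)) volume 0 1 := by
    apply ContinuousOn.intervalIntegrable
    rw [uIcc_of_le zero_le_one]
    exact (hK'.comp (f := fun σ => (q, σ)) (by fun_prop) fun σ hσ => ⟨hq, hσ⟩).clm_apply
      continuousOn_const
  rw [happ, ← intervalIntegral.integral_sub (hslice hK q' hq'.2) (hslice hK q hq),
    ← intervalIntegral.integral_sub ((hslice hK q' hq'.2).sub (hslice hK q hq)) hI'']
  have := intervalIntegral.norm_integral_le_of_norm_le_const (a := 0) (b := 1)
    (f := fun σ => K q' σ - K q σ - K' q σ (q' - q)) (C := ε * ‖q' - q‖)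
    (fun σ hσ => hbound σ (by
      rw [uIoc_of_le zero_le_one] at hσ
      exact Ioc_subset_Icc_self hσ))
  simpa using this

/-- Integrals of smooth functions depend smoothly on parameters in a convex set. -/
theorem contDiffOn_parametric_integral {P : Type} [NormedAddCommGroup P] [NormedSpace ℝ P]
    {s : Set P} (hs : Convex ℝ s) (hu : UniqueDiffOn ℝ s) (m : ℕ) :
    ∀ {V : Type} [NormedAddCommGroup V] [NormedSpace ℝ V] {K : P × ℝ → V},
      ContDiffOn ℝ ∞ K (s ×ˢ Icc (0 : ℝ) 1) →
      ContDiffOn ℝ m (fun q => ∫ σ in (0 : ℝ)..1, K (q, σ)) s := by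
  have hu' : UniqueDiffOn ℝ (s ×ˢ Icc (0 : ℝ) 1) := hu.prod (uniqueDiffOn_Icc zero_lt_one)
  have key : ∀ {V : Type} [NormedAddCommGroup V] [NormedSpace ℝ V] {K : P × ℝ → V},
      ContDiffOn ℝ ∞ K (s ×ˢ Icc (0 : ℝ) 1) → ∃ K' : P × ℝ → P →L[ℝ] V,
        ContDiffOn ℝ ∞ K' (s ×ˢ Icc (0 : ℝ) 1) ∧ ∀ q ∈ s,
        HasFDerivWithinAt (fun q => ∫ σ in (0 : ℝ)..1, K (q, σ))
          (∫ σ in (0 : ℝ)..1, K' (q, σ)) s q := by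
    intro V _ _ K hK
    let DK := fderivWithin ℝ K (s ×ˢ Icc (0 : ℝ) 1)
    have hDK : ContDiffOn ℝ ∞ DK (s ×ˢ Icc (0 : ℝ) 1) := hK.fderivWithin hu' (by simp)
    have hK' : ContDiffOn ℝ ∞ (fun r => DK r ∘L ContinuousLinearMap.inl ℝ P ℝ)
      (s ×ˢ Icc (0 : ℝ) 1) := hDK.clm_comp contDiffOn_const
    refine ⟨fun r => DK r ∘L ContinuousLinearMap.inl ℝ P ℝ, hK', fun q hq => ?_⟩
    refine hasFDerivWithinAt_parametric_integral hs (K := fun q σ => K (q, σ))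
      (K' := fun q σ => DK (q, σ) ∘L ContinuousLinearMap.inl ℝ P ℝ)
      hK.continuousOn hK'.continuousOn (fun p hp σ hσ => ?_) hq
    have h1 := ((hK.differentiableOn (by simp)) (p, σ) ⟨hp, hσ⟩).hasFDerivWithinAt
    have hm : MapsTo (fun p => (p, σ)) s (s ×ˢ Icc (0 : ℝ) 1) := fun p' hp' => ⟨hp', hσ⟩
    exact h1.comp p (hasFDerivAt_prodMk_left p σ).hasFDerivWithinAt hm
  -- The derivative of the integral is an integral of the same kind, with values in `P →L[ℝ] V`. The
  -- induction therefore runs over all codomains at once, and a common universe for `P` and `V`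
  -- keeps this space among them.
  induction m with
  | zero =>
    intro V _ _ K hK
    obtain ⟨K', -, h⟩ := key hK
    rw [Nat.cast_zero, contDiffOn_zero]
    exact fun q hq => (h q hq).continuousWithinAt
  | succ m ih =>
    intro V _ _ K hK
    obtain ⟨K', hK', h⟩ := key hK
    rw [Nat.cast_succ, contDiffOn_succ_iff_hasFDerivWithinAt_of_uniqueDiffOn hu]
    exact ⟨fun h => by simp at h, _, ih hK', h⟩

/-- Division by the last coordinate of a smooth function. -/
def coordQuotient {P V : Type*} [NormedAddCommGroup V] [NormedSpace ℝ V] (F : P × ℝ → V)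
    (r : P × ℝ) : V :=
  if r.2 = 0 then deriv (fun t => F (r.1, t)) 0 else r.2⁻¹ • (F r - F (r.1, 0))

/-- Hadamard's formula: `F(p, t) - F(p, 0) = t ∫₀¹ ∂_t F(p, σt) dσ`. The integral is smooth in `(p,
t)`, and at `t = 0` its integrand is constant in `σ`, equal to the derivative prescribed in
`coordQuotient`. -/
theorem contDiffOn_coordQuotient {P V : Type} [NormedAddCommGroup P] [NormedSpace ℝ P]
    [NormedAddCommGroup V] [NormedSpace ℝ V] [CompleteSpace V] {s : Set P} (hs : Convex ℝ s)
    (hu : UniqueDiffOn ℝ s) {δ : ℝ} {F : P × ℝ → V}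
    (hF : ContDiffOn ℝ ∞ F (s ×ˢ Ioo (-δ) δ)) :
    ContDiffOn ℝ ∞ (coordQuotient F) (s ×ˢ Ioo (-δ) δ) := by
  have hu' : UniqueDiffOn ℝ (s ×ˢ Ioo (-δ) δ) := hu.prod isOpen_Ioo.uniqueDiffOn
  let DF : P × ℝ → V := fun r => fderivWithin ℝ F (s ×ˢ Ioo (-δ) δ) r (0, 1)
  have hDF : ContDiffOn ℝ ∞ DF (s ×ˢ Ioo (-δ) δ) :=
    (hF.fderivWithin hu' (by simp)).clm_apply contDiffOn_const
  have hder : ∀ p ∈ s, ∀ t ∈ Ioo (-δ) δ, HasDerivAt (fun t => F (p, t)) (DF (p, t)) t := by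
    intro p hp t ht
    have h1 := ((hF.differentiableOn (by simp)) (p, t) ⟨hp, ht⟩).hasFDerivWithinAt
    have h2 := h1.comp t ((hasFDerivAt_prodMk_right p t).hasFDerivWithinAt (s := Ioo (-δ) δ))
      fun t' ht' => ⟨hp, ht'⟩
    have h3 := (h2.hasFDerivAt (isOpen_Ioo.mem_nhds ht)).hasDerivAt
    simpa using! h3
  have hmem : ∀ t ∈ Ioo (-δ) δ, ∀ σ ∈ Icc (0 : ℝ) 1, σ * t ∈ Ioo (-δ) δ := by
    intro t ht σ hσ
    rw [mem_Ioo, ← abs_lt] at ht ⊢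
    rw [abs_mul, abs_of_nonneg hσ.1]
    nlinarith [abs_nonneg t, hσ.2]
  have hint : ContDiffOn ℝ ∞ (fun r : P × ℝ => ∫ σ in (0 : ℝ)..1, DF (r.1, σ * r.2))
      (s ×ˢ Ioo (-δ) δ) := by
    rw [contDiffOn_infty]
    intro m
    refine contDiffOn_parametric_integral (hs.prod (convex_Ioo _ _)) hu' m
      (K := fun r : (P × ℝ) × ℝ => DF (r.1.1, r.2 * r.1.2)) ?_
    exact hDF.comp (f := fun r : (P × ℝ) × ℝ => (r.1.1, r.2 * r.1.2)) (by fun_prop)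
      fun r hr => ⟨hr.1.1, hmem _ hr.1.2 _ hr.2⟩
  refine hint.congr fun r hr => ?_
  obtain ⟨p, t⟩ := r
  have hp : p ∈ s := hr.1
  have ht : t ∈ Ioo (-δ) δ := hr.2
  by_cases h0 : t = 0
  · subst h0
    simp only [coordQuotient, if_true, mul_zero, intervalIntegral.integral_const, sub_zero,
      one_smul]
    exact (hder p hp 0 ht).deriv
  · simp only [coordQuotient, h0, if_false]
    have hFTC : ∫ σ in (0 : ℝ)..1, t • DF (p, σ * t) = F (p, 1 * t) - F (p, 0 * t) := by
      refine intervalIntegral.integral_eq_sub_of_hasDerivAt (f := fun σ => F (p, σ * t))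
        (fun σ hσ => ?_) ?_
      · rw [uIcc_of_le zero_le_one] at hσ
        have h1 : HasDerivAt (fun σ : ℝ => σ * t) t σ := by
          simpa using (hasDerivAt_id σ).mul_const t
        exact (hder p hp _ (hmem t ht σ hσ)).scomp σ h1
      · apply ContinuousOn.intervalIntegrable
        rw [uIcc_of_le zero_le_one]
        refine ContinuousOn.const_smul ?_ t
        exact hDF.continuousOn.comp (f := fun σ : ℝ => (p, σ * t)) (by fun_prop)
          fun σ hσ => ⟨hp, hmem t ht σ hσ⟩
    rw [intervalIntegral.integral_smul, one_mul, zero_mul] at hFTC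
    rw [← hFTC, smul_smul, inv_mul_cancel₀ h0, one_smul]

end Parametric

/-! ### Pull-backs of metrics in coordinates -/

section Pullback

open Topology

variable {Z V W : Type*} [NormedAddCommGroup Z] [NormedSpace ℝ Z]
  [NormedAddCommGroup V] [NormedSpace ℝ V] [NormedAddCommGroup W] [NormedSpace ℝ W]

theorem pullForm_eq_compL (B : W →L[ℝ] W →L[ℝ] ℝ) (L : V →L[ℝ] W) :
    pullForm B L = ((ContinuousLinearMap.compL ℝ V W ℝ).flip L) ∘L (B ∘L L) := rfl

theorem _root_.ContDiffWithinAt.pullForm {n : ℕ∞ω} {B : Z → W →L[ℝ] W →L[ℝ] ℝ}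
    {L : Z → V →L[ℝ] W} {s : Set Z} {a : Z} (hB : ContDiffWithinAt ℝ n B s a)
    (hL : ContDiffWithinAt ℝ n L s a) :
    ContDiffWithinAt ℝ n (fun z => pullForm (B z) (L z)) s a := by
  simp only [pullForm_eq_compL]
  exact (contDiffWithinAt_const.clm_apply hL).clm_comp (hB.clm_comp hL)

theorem differentiableWithinAt_pullForm {B : Z → W →L[ℝ] W →L[ℝ] ℝ}
    {L : Z → V →L[ℝ] W} {s : Set Z} {a : Z} (hB : DifferentiableWithinAt ℝ B s a)
    (hL : DifferentiableWithinAt ℝ L s a) :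
    DifferentiableWithinAt ℝ (fun z => pullForm (B z) (L z)) s a := by
  simp only [pullForm_eq_compL]
  exact ((differentiableWithinAt_const _).clm_apply hL).clm_comp (hB.clm_comp hL)

theorem fderivWithin_apply₂ {B : Z → W →L[ℝ] W →L[ℝ] ℝ} {s : Set Z} {a : Z}
    (hu : UniqueDiffWithinAt ℝ s a) (hB : DifferentiableWithinAt ℝ B s a) (u : Z) (v w : W) :
    fderivWithin ℝ (fun z => B z v w) s a u = fderivWithin ℝ B s a u v w := by
  have h := ((hB.hasFDerivWithinAt.clm_apply (hasFDerivWithinAt_const v a s)).clm_apply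
    (hasFDerivWithinAt_const w a s)).fderivWithin hu
  rw [h]
  simp

theorem fderivWithin_pullForm {B : Z → W →L[ℝ] W →L[ℝ] ℝ}
    {L : Z → V →L[ℝ] W} {s : Set Z} {a : Z} (hu : UniqueDiffWithinAt ℝ s a)
    {B' : Z →L[ℝ] W →L[ℝ] W →L[ℝ] ℝ} {L' : Z →L[ℝ] V →L[ℝ] W}
    (hB : HasFDerivWithinAt B B' s a) (hL : HasFDerivWithinAt L L' s a) (u : Z) (v w : V) :
    fderivWithin ℝ (fun z => pullForm (B z) (L z)) s a u v w
      = B' u (L a v) (L a w) + B a (L' u v) (L a w) + B a (L a v) (L' u w) := by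
  rw [← fderivWithin_apply₂ hu
    (differentiableWithinAt_pullForm hB.differentiableWithinAt hL.differentiableWithinAt)]
  have hv := hL.clm_apply (hasFDerivWithinAt_const v a s)
  have hw := hL.clm_apply (hasFDerivWithinAt_const w a s)
  have h := ((hB.clm_apply hv).clm_apply hw).fderivWithin hu
  simp only [pullForm_apply]
  rw [h]
  simp
  ring

/-- The Christoffel combination of a trilinear form. -/
def koszul (D : V →L[ℝ] V →L[ℝ] V →L[ℝ] ℝ) (u v w : V) : ℝ :=
  (D u v w + D v u w - D w u v) / 2

/-- The transformation law of Christoffel symbols of the first kind. Of the six terms with `S`,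
symmetry of `S` and `B` cancels four and leaves `B (S u v) (L w)` twice. It serves both for induced
metrics, with `S` the second derivative of the map, and for changes of chart, with `S` the second
derivative of the transition map. -/
theorem koszul_pull {D : V →L[ℝ] V →L[ℝ] V →L[ℝ] ℝ} {D₀ : W →L[ℝ] W →L[ℝ] W →L[ℝ] ℝ}
    {B : W →L[ℝ] W →L[ℝ] ℝ} (hB : ∀ v w, B v w = B w v) {L : V →L[ℝ] W}
    {S : V →L[ℝ] V →L[ℝ] W} (hS : ∀ v w, S v w = S w v)
    (hD : ∀ u v w, D u v w
      = D₀ (L u) (L v) (L w) + B (S u v) (L w) + B (L v) (S u w)) (u v w : V) :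
    koszul D u v w = koszul D₀ (L u) (L v) (L w) + B (S u v) (L w) := by
  simp only [koszul, hD]
  rw [hS v u, hS w u, hS w v, hB (L v) (S u w), hB (L u) (S v w)]
  ring

/-- Compatibility of the Christoffel symbols with the metric. -/
theorem koszul_add_koszul {D : V →L[ℝ] V →L[ℝ] V →L[ℝ] ℝ} (hD : ∀ u v w, D u v w = D u w v)
    (u v w : V) : koszul D u v w + koszul D u w v = D u v w := by
  simp only [koszul]
  rw [hD v u w, hD w u v, hD u w v]
  ring

end Pullback

/-! ### Second derivatives and Christoffel symbols of induced metrics -/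

section LocalGeometry

open Topology

variable {E E' : Type*} [NormedAddCommGroup E] [NormedSpace ℝ E]
  [NormedAddCommGroup E'] [NormedSpace ℝ E']

theorem uniqueDiffOn_prod_univ {D : Set E} (hD : UniqueDiffOn ℝ D) :
    UniqueDiffOn ℝ (D ×ˢ (univ : Set ℝ)) := hD.prod uniqueDiffOn_univ

/-- Supplies the density of interior points under which second derivatives are symmetric at boundary
points. -/
theorem prod_univ_subset_closure_interior {E : Type*} [TopologicalSpace E]
    {D : Set E} (hD : D ⊆ closure (interior D)) :
    D ×ˢ (univ : Set ℝ) ⊆ closure (interior (D ×ˢ (univ : Set ℝ))) := by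
  rw [interior_prod_eq, closure_prod_eq]
  exact prod_mono hD (by simp)

variable {Z : Type*} [NormedAddCommGroup Z] [NormedSpace ℝ Z]
  {s : Set Z} {c : Z} {F : Z → E'} {G : E' → E' →L[ℝ] E' →L[ℝ] ℝ}

theorem fderiv_symm {G : E' → E' →L[ℝ] E' →L[ℝ] ℝ} {y : E'} (hG : DifferentiableAt ℝ G y)
    (hGs : ∀ᶠ y' in 𝓝 y, ∀ v w, G y' v w = G y' w v) (u v w : E') :
    fderiv ℝ G y u v w = fderiv ℝ G y u w v := by
  rw [← fderivWithin_univ,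
    ← fderivWithin_apply₂ uniqueDiffWithinAt_univ hG.differentiableWithinAt,
    ← fderivWithin_apply₂ uniqueDiffWithinAt_univ hG.differentiableWithinAt]
  simp only [fderivWithin_univ]
  have : (fun z => G z v w) =ᶠ[𝓝 y] fun z => G z w v := hGs.mono fun z hz => hz v w
  rw [this.fderiv_eq]

/-- The Christoffel symbols of an induced metric are `g(D²F(u, v) + Γ(F'u, F'v), F'w)`. -/
theorem koszul_induced (hs : UniqueDiffOn ℝ s) (hs' : s ⊆ closure (interior s)) (hc : c ∈ s)
    (hF : ContDiffWithinAt ℝ ∞ F s c) (hG : DifferentiableAt ℝ G (F c))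
    (hGs : ∀ v w, G (F c) v w = G (F c) w v)
    {Γ : E' →L[ℝ] E' →L[ℝ] E'}
    (hΓ : ∀ u v w, G (F c) (Γ u v) w = koszul (fderiv ℝ G (F c)) u v w) (u v w : Z) :
    koszul (fderivWithin ℝ (fun z => pullForm (G (F z)) (fderivWithin ℝ F s z)) s c) u v w
      = G (F c) (fderivWithin ℝ (fderivWithin ℝ F s) s c u v
          + Γ (fderivWithin ℝ F s c u) (fderivWithin ℝ F s c v)) (fderivWithin ℝ F s c w) := by
  have hF1 := (hF.differentiableWithinAt (by simp)).hasFDerivWithinAt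
  have hF2 := ((hF.fderivWithin_right hs (m := 1) (by norm_cast) hc).differentiableWithinAt
    (by simp)).hasFDerivWithinAt
  have hGF : HasFDerivWithinAt (fun z => G (F z))
      (fderiv ℝ G (F c) ∘L fderivWithin ℝ F s c) s c :=
    hG.hasFDerivAt.comp_hasFDerivWithinAt c hF1
  have hsym : IsSymmSndFDerivWithinAt ℝ F s c :=
    hF.isSymmSndFDerivWithinAt (by simp; norm_cast) hs (hs' hc) hc
  rw [koszul_pull (D₀ := fderiv ℝ G (F c)) (B := G (F c)) hGs
    (L := fderivWithin ℝ F s c) (S := fderivWithin ℝ (fderivWithin ℝ F s) s c)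
    (fun v w => hsym v w)
    (fun u v w => fderivWithin_pullForm (hs c hc) hGF hF2 u v w), map_add, add_apply, hΓ]
  ring

/-- The second derivative of a graph. -/
theorem fderivWithin_fderivWithin_graph {D : Set E} (hD : UniqueDiffOn ℝ D) {a : E} (ha : a ∈ D)
    {F : E × ℝ → E'} {f : E → ℝ} (hf : ContDiffWithinAt ℝ ∞ f D a)
    (hF : ContDiffWithinAt ℝ ∞ F (D ×ˢ (univ : Set ℝ)) (a, f a)) :
    (∀ v, fderivWithin ℝ (fun z => F (z, f z)) D a v
      = fderivWithin ℝ F (D ×ˢ univ) (a, f a) (v, fderivWithin ℝ f D a v)) ∧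
    ∀ v w, fderivWithin ℝ (fderivWithin ℝ (fun z => F (z, f z)) D) D a v w
      = fderivWithin ℝ (fderivWithin ℝ F (D ×ˢ univ)) (D ×ˢ univ) (a, f a)
          (v, fderivWithin ℝ f D a v) (w, fderivWithin ℝ f D a w)
        + fderivWithin ℝ F (D ×ˢ univ) (a, f a)
          (0, fderivWithin ℝ (fderivWithin ℝ f D) D a v w) := by
  have hs := uniqueDiffOn_prod_univ hD
  have hmem : (a, f a) ∈ D ×ˢ (univ : Set ℝ) := ⟨ha, mem_univ _⟩
  have hmaps : MapsTo (fun z => (z, f z)) D (D ×ˢ (univ : Set ℝ)) := fun z hz => ⟨hz, mem_univ _⟩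
  have hgr : ∀ z ∈ D, DifferentiableWithinAt ℝ f D z →
      HasFDerivWithinAt (fun z => (z, f z))
        ((ContinuousLinearMap.id ℝ E).prod (fderivWithin ℝ f D z)) D z :=
    fun z hz h => (hasFDerivWithinAt_id z D).prodMk h.hasFDerivWithinAt
  have first : ∀ z ∈ D, DifferentiableWithinAt ℝ f D z →
      DifferentiableWithinAt ℝ F (D ×ˢ (univ : Set ℝ)) (z, f z) →
      fderivWithin ℝ (fun z => F (z, f z)) D z
        = fderivWithin ℝ F (D ×ˢ univ) (z, f z)
          ∘L ((ContinuousLinearMap.id ℝ E).prod (fderivWithin ℝ f D z)) :=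
    fun z hz h1 h2 => (h2.hasFDerivWithinAt.comp z (hgr z hz h1) hmaps).fderivWithin (hD z hz)
  have hfd := hf.differentiableWithinAt (by simp)
  have hFd := hF.differentiableWithinAt (by simp)
  refine ⟨fun v => by rw [first a ha hfd hFd]; rfl, fun v w => ?_⟩
  have hcont : ContinuousWithinAt (fun z => (z, f z)) D a :=
    continuousWithinAt_id.prodMk hf.continuousWithinAt
  have ev : ∀ᶠ z in 𝓝[D] a, fderivWithin ℝ (fun z => F (z, f z)) D z
        = fderivWithin ℝ F (D ×ˢ univ) (z, f z)
          ∘L ((ContinuousLinearMap.id ℝ E).prod (fderivWithin ℝ f D z)) := by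
    -- Differentiating the chain rule a second time requires it near `a` and not only at `a`;
    -- smoothness at a point gives differentiability nearby within the same set.
    have e1 : ∀ᶠ z in 𝓝[D] a, DifferentiableWithinAt ℝ f D z := by
      have := (hf.of_le (m := 1) (by norm_cast)).eventually (by simp)
      rw [insert_eq_of_mem ha] at this
      exact this.mono fun z hz => hz.differentiableWithinAt (by simp)
    have e2 : ∀ᶠ q in 𝓝[D ×ˢ (univ : Set ℝ)] (a, f a),
        DifferentiableWithinAt ℝ F (D ×ˢ (univ : Set ℝ)) q := by
      have := (hF.of_le (m := 1) (by norm_cast)).eventually (by simp)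
      rw [insert_eq_of_mem hmem] at this
      exact this.mono fun z hz => hz.differentiableWithinAt (by simp)
    have e3 := (hcont.tendsto_nhdsWithin hmaps).eventually e2
    filter_upwards [e1, e3, self_mem_nhdsWithin] with z h1 h2 hz using first z hz h1 h2
  rw [Filter.EventuallyEq.fderivWithin_eq ev (ev.self_of_nhdsWithin ha)]
  have hf2 := ((hf.fderivWithin_right hD (m := 1) (by norm_cast) ha).differentiableWithinAt
    (by simp)).hasFDerivWithinAt
  have hF2 := ((hF.fderivWithin_right hs (m := 1) (by norm_cast) hmem).differentiableWithinAt
    (by simp)).hasFDerivWithinAt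
  have h1 := hF2.comp a (hgr a ha hfd) hmaps
  have h2 : HasFDerivWithinAt
      (fun z => (ContinuousLinearMap.id ℝ E).prod (fderivWithin ℝ f D z))
      ((ContinuousLinearMap.compL ℝ E ℝ (E × ℝ) (ContinuousLinearMap.inr ℝ E ℝ))
        ∘L fderivWithin ℝ (fderivWithin ℝ f D) D a) D a := by
    have h3 := ((ContinuousLinearMap.compL ℝ E ℝ (E × ℝ)
      (ContinuousLinearMap.inr ℝ E ℝ)).hasFDerivAt.comp_hasFDerivWithinAt a hf2).const_add
        (ContinuousLinearMap.inl ℝ E ℝ)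
    refine h3.congr_of_eventuallyEq (Filter.Eventually.of_forall fun z => ?_) ?_ <;>
    · ext v <;> simp
  have h := (h1.clm_comp h2).fderivWithin (hD a ha)
  simp only [Function.comp_def] at h
  rw [h]
  simp [add_comm]

end LocalGeometry

/-! ### Algebra of the tensor `Ψ` and the factor `ψ` at a point -/

section GraphForm

variable {E : Type*} [NormedAddCommGroup E] [NormedSpace ℝ E]

/-- The bilinear form `(v, w) ↦ koszul D v w p`. -/
def koszulForm (D : E →L[ℝ] E →L[ℝ] E →L[ℝ] ℝ) (p : E) : E →L[ℝ] E →L[ℝ] ℝ :=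
  let T : E →L[ℝ] E →L[ℝ] ℝ :=
    (ContinuousLinearMap.compL ℝ E (E →L[ℝ] ℝ) ℝ (ContinuousLinearMap.apply ℝ ℝ p)) ∘L D
  (2⁻¹ : ℝ) • (T + T.flip - D p)

theorem koszulForm_apply (D : E →L[ℝ] E →L[ℝ] E →L[ℝ] ℝ) (p v w : E) :
    koszulForm D p v w = koszul D v w p := by
  simp [koszulForm, koszul]
  ring

/-- Raising with `B` the index that has been lowered with `B₀`. -/
def shift (B₀ B : E →L[ℝ] E →L[ℝ] ℝ) (p : E) : E := B.inverse (B₀ p)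

/-- The zeroth order term of the second fundamental form of a graph in Fermi coordinates
`dt² + g_t`, in terms of the coefficients `B₀`, `B` of `g_0` and `g_t`, their space derivatives
`D₀`, `D` and the time derivative `B'` of `g_t`. -/
def graphForm (B₀ B : E →L[ℝ] E →L[ℝ] ℝ) (D₀ D : E →L[ℝ] E →L[ℝ] E →L[ℝ] ℝ)
    (B' : E →L[ℝ] E →L[ℝ] ℝ) (p : E) : E →L[ℝ] E →L[ℝ] ℝ :=
  koszulForm D₀ p - koszulForm D (shift B₀ B p)
    - (2⁻¹ : ℝ) • (B' + (B'.flip (shift B₀ B p)).smulRight (B₀ p)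
      + (B₀ p).smulRight (B'.flip (shift B₀ B p)))

theorem graphForm_apply (B₀ B : E →L[ℝ] E →L[ℝ] ℝ) (D₀ D : E →L[ℝ] E →L[ℝ] E →L[ℝ] ℝ)
    (B' : E →L[ℝ] E →L[ℝ] ℝ) (p v w : E) :
    graphForm B₀ B D₀ D B' p v w = koszul D₀ v w p - koszul D v w (shift B₀ B p)
      - (B' v w + B' v (shift B₀ B p) * B₀ p w + B₀ p v * B' w (shift B₀ B p)) / 2 := by
  simp [graphForm, koszulForm_apply]
  ring

/-- The factor between the Gaussian curvature of a graph and the determinant of its Hessian. -/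
def graphFactor (B₀ B : E →L[ℝ] E →L[ℝ] ℝ) (p : E) : ℝ :=
  (B₀.inverse ∘L B).det ^ (1 / (Module.finrank ℝ E : ℝ)) *
    (1 + B₀ p (shift B₀ B p)) ^ ((Module.finrank ℝ E + 2) / (2 * Module.finrank ℝ E) : ℝ)

variable [FiniteDimensional ℝ E]

theorem apply_shift {B₀ B : E →L[ℝ] E →L[ℝ] ℝ} (hB : PosDefForm B) (p : E) :
    B (shift B₀ B p) = B₀ p := hB.apply_inverse _

theorem shift_self {B : E →L[ℝ] E →L[ℝ] ℝ} (hB : PosDefForm B) (p : E) : shift B B p = p :=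
  hB.inverse_apply p

theorem apply_shift_nonneg {B₀ B : E →L[ℝ] E →L[ℝ] ℝ} (hB : PosDefForm B) (p : E) :
    0 ≤ B₀ p (shift B₀ B p) := by
  rw [← apply_shift hB p]
  exact hB.nonneg _

theorem graphFactor_pos {B₀ B : E →L[ℝ] E →L[ℝ] ℝ} (hB₀ : PosDefForm B₀) (hB : PosDefForm B)
    (p : E) : 0 < graphFactor B₀ B p := by
  have h1 := det_inverse_comp_pos hB₀ hB
  have h2 := apply_shift_nonneg (B₀ := B₀) hB p
  unfold graphFactor
  positivity

/-- The function `p ↦ B₀(p, shift p)` is the nonnegative quadratic form `B₀ B⁻¹ B₀`, and the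
exponent `(n+2)/(2n) = 1/2 + 1/n` is at least `1/2`. The determinant is a positive constant in `p`.
-/
theorem convexOn_graphFactor [Nontrivial E] {B₀ B : E →L[ℝ] E →L[ℝ] ℝ} (hB₀ : PosDefForm B₀)
    (hB : PosDefForm B) : ConvexOn ℝ univ (graphFactor B₀ B) := by
  have h1 := det_inverse_comp_pos hB₀ hB
  have hn : (0 : ℝ) < Module.finrank ℝ E := by exact_mod_cast Module.finrank_pos
  have hq : ∃ q : E →L[ℝ] E →L[ℝ] ℝ, ∀ v w, q v w = B₀ v (shift B₀ B w) :=
    ⟨((ContinuousLinearMap.compL ℝ E E ℝ).flip (B.inverse ∘L B₀)) ∘L B₀, fun v w => rfl⟩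
  obtain ⟨q, hq⟩ := hq
  have hconv := convexOn_one_add_rpow (B := q) (fun v w => by
      rw [hq, hq, ← apply_shift hB v, ← apply_shift hB w, hB.1]) (fun v => by
      rw [hq]; exact apply_shift_nonneg hB v)
    (α := (Module.finrank ℝ E + 2) / (2 * Module.finrank ℝ E)) (by
      rw [div_le_div_iff₀ (by norm_num) (by positivity)]
      linarith)
  simp only [hq] at hconv
  exact hconv.smul (c := (B₀.inverse ∘L B).det ^ (1 / (Module.finrank ℝ E : ℝ))) (by positivity)

variable {V : Type*} [NormedAddCommGroup V] [NormedSpace ℝ V] [FiniteDimensional ℝ V]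

theorem map_shift {B₀ B : E →L[ℝ] E →L[ℝ] ℝ} (hB : PosDefForm B) {L : V →L[ℝ] E}
    (hL : Function.Bijective L) (p : V) :
    L (shift (pullForm B₀ L) (pullForm B L) p) = shift B₀ B (L p) := by
  refine hB.eq_inverse fun w => ?_
  obtain ⟨w, rfl⟩ := hL.2 w
  rw [← pullForm_apply B L, apply_shift (hB.pullForm hL.1), pullForm_apply]

/-- The form `graphForm` is a tensor. -/
theorem graphForm_pull {B₀ B : E →L[ℝ] E →L[ℝ] ℝ} {D₀ D : E →L[ℝ] E →L[ℝ] E →L[ℝ] ℝ}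
    {B' : E →L[ℝ] E →L[ℝ] ℝ} (hB₀ : PosDefForm B₀) (hB : PosDefForm B)
    {L : V →L[ℝ] E} (hL : Function.Bijective L)
    {S : V →L[ℝ] V →L[ℝ] E} (hS : ∀ v w, S v w = S w v) {C₀ C : V →L[ℝ] V →L[ℝ] V →L[ℝ] ℝ}
    (hC₀ : ∀ u v w, C₀ u v w
      = D₀ (L u) (L v) (L w) + B₀ (S u v) (L w) + B₀ (L v) (S u w))
    (hC : ∀ u v w, C u v w
      = D (L u) (L v) (L w) + B (S u v) (L w) + B (L v) (S u w)) (p : V) :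
    graphForm (pullForm B₀ L) (pullForm B L) C₀ C (pullForm B' L) p
      = pullForm (graphForm B₀ B D₀ D B' (L p)) L := by
  ext v w
  rw [pullForm_apply, graphForm_apply, graphForm_apply, koszul_pull hB₀.1 hS hC₀,
    koszul_pull hB.1 hS hC]
  simp only [pullForm_apply, map_shift hB hL]
  -- This is the cancellation that makes the difference of Christoffel symbols tensorial: the two
  -- inhomogeneous terms are `B₀(S v w, L p)` and `B(S v w, shift (L p))`, and `B (shift ·) = B₀ ·`.
  rw [hB.1 (S v w) (shift B₀ B (L p)), apply_shift hB, hB₀.1 (S v w)]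
  ring

/-- The endomorphism `B₀⁻¹B` is replaced by its conjugate `L⁻¹(B₀⁻¹B)L`, which has the same
determinant, and raising indices commutes with `L`. -/
theorem graphFactor_pull {B₀ B : E →L[ℝ] E →L[ℝ] ℝ} (hB₀ : PosDefForm B₀) (hB : PosDefForm B)
    {L : V →L[ℝ] E} (hL : Function.Bijective L) (p : V) :
    graphFactor (pullForm B₀ L) (pullForm B L) p = graphFactor B₀ B (L p) := by
  let e : V ≃ₗ[ℝ] E := LinearEquiv.ofBijective (L : V →ₗ[ℝ] E) hL
  have hdim : Module.finrank ℝ V = Module.finrank ℝ E := e.finrank_eq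
  have hdet : ((pullForm B₀ L).inverse ∘L pullForm B L).det = (B₀.inverse ∘L B).det := by
    rw [ContinuousLinearMap.det, ContinuousLinearMap.det,
      ← LinearMap.det_conj ((B₀.inverse ∘L B : E →L[ℝ] E) : E →ₗ[ℝ] E) e.symm]
    congr 1
    ext v
    apply hL.1
    have h1 : L (e.symm (B₀.inverse (B (e.symm.symm v)))) = B₀.inverse (B (L v)) :=
      e.apply_symm_apply _
    refine Eq.trans ?_ h1.symm
    refine hB₀.eq_inverse fun w => ?_
    obtain ⟨w, rfl⟩ := hL.2 w
    change pullForm B₀ L ((pullForm B₀ L).inverse (pullForm B L v)) w = _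
    rw [(hB₀.pullForm hL.1).apply_inverse, pullForm_apply]
  simp only [graphFactor, hdet, hdim, pullForm_apply, map_shift hB hL]

/-- When the two metrics coincide, raising undoes lowering and the Christoffel terms cancel, so no
space derivative survives. -/
theorem graphForm_zero {B : E →L[ℝ] E →L[ℝ] ℝ} (hB : PosDefForm B)
    (D : E →L[ℝ] E →L[ℝ] E →L[ℝ] ℝ) (B' : E →L[ℝ] E →L[ℝ] ℝ) (p v w : E) :
    graphForm B B D D B' p v w = -(B' v w + B' v p * B p w + B p v * B' w p) / 2 := by
  rw [graphForm_apply, shift_self hB]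
  ring

end GraphForm

/-! ### Fermi coordinates -/

section Fermi

open Topology

variable {E E' : Type*} [NormedAddCommGroup E] [NormedSpace ℝ E]
  [NormedAddCommGroup E'] [NormedSpace ℝ E'] {D : Set E}

/-- The metric in Fermi coordinates has the derivatives of its horizontal part. -/
theorem fderivWithin_fermi (hD : UniqueDiffOn ℝ D) {c : E × ℝ} (hc : c ∈ D ×ˢ (univ : Set ℝ))
    {H : E × ℝ → (E × ℝ) →L[ℝ] (E × ℝ) →L[ℝ] ℝ} {Q : E × ℝ → E →L[ℝ] E →L[ℝ] ℝ}
    (hQ : DifferentiableWithinAt ℝ Q (D ×ˢ univ) c)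
    (hH : DifferentiableWithinAt ℝ H (D ×ˢ univ) c)
    (h : ∀ᶠ q in 𝓝[D ×ˢ univ] c, ∀ V W, H q V W = Q q V.1 W.1 + V.2 * W.2) (U V W : E × ℝ) :
    fderivWithin ℝ H (D ×ˢ univ) c U V W = fderivWithin ℝ Q (D ×ˢ univ) c U V.1 W.1 := by
  have hu := uniqueDiffOn_prod_univ hD c hc
  rw [← fderivWithin_apply₂ hu hH, ← fderivWithin_apply₂ hu hQ]
  have ev : (fun q => H q V W) =ᶠ[𝓝[D ×ˢ univ] c] fun q => Q q V.1 W.1 + V.2 * W.2 :=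
    h.mono fun q hq => hq V W
  rw [ev.fderivWithin_eq (ev.self_of_nhdsWithin hc), fderivWithin_add_const]

/-- Only the horizontal block of `dt² + g_t` varies. Splitting each direction of differentiation
into its space part and a multiple of `(0, 1)` separates the Christoffel symbols of `g_t` from the
terms in `∂_t g_t`. -/
theorem koszul_fermi {T : (E × ℝ) →L[ℝ] (E × ℝ) →L[ℝ] (E × ℝ) →L[ℝ] ℝ}
    {DQ : (E × ℝ) →L[ℝ] E →L[ℝ] E →L[ℝ] ℝ} (h : ∀ U V W, T U V W = DQ U V.1 W.1)
    (v w p : E) (β γ α : ℝ) :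
    koszul T (v, β) (w, γ) (p, α)
      = koszul (DQ ∘L ContinuousLinearMap.inl ℝ E ℝ) v w p
        + (β * DQ (0, 1) w p + γ * DQ (0, 1) v p - α * DQ (0, 1) v w) / 2 := by
  have hs : ∀ (u : E) (r : ℝ), DQ (u, r) = DQ (u, 0) + r • DQ (0, 1) := fun u r => by
    rw [← map_smul, ← map_add]
    simp
  simp only [koszul, h, hs v β, hs w γ, hs p α, add_apply, smul_apply, smul_eq_mul,
    ContinuousLinearMap.comp_apply, ContinuousLinearMap.inl_apply]
  ring

/-- The second fundamental form of a graph in Fermi coordinates. -/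
theorem secondForm_fermi (hD : UniqueDiffOn ℝ D) (hD' : D ⊆ closure (interior D)) {a : E}
    (ha : a ∈ D) {F : E × ℝ → E'} {f : E → ℝ} {G : E' → E' →L[ℝ] E' →L[ℝ] ℝ}
    {Q : E × ℝ → E →L[ℝ] E →L[ℝ] ℝ}
    (hf : ContDiffWithinAt ℝ ∞ f D a)
    (hF : ContDiffWithinAt ℝ ∞ F (D ×ˢ (univ : Set ℝ)) (a, f a))
    (hG : ContDiffAt ℝ ∞ G (F (a, f a)))
    (hGs : ∀ᶠ y in 𝓝 (F (a, f a)), ∀ v w, G y v w = G y w v)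
    {Γ : E' →L[ℝ] E' →L[ℝ] E'}
    (hΓ : ∀ u v w, G (F (a, f a)) (Γ u v) w = koszul (fderiv ℝ G (F (a, f a))) u v w)
    (hQ : DifferentiableWithinAt ℝ Q (D ×ˢ univ) (a, f a))
    (hfermi : ∀ᶠ q in 𝓝[D ×ˢ univ] (a, f a), ∀ V W : E × ℝ,
      G (F q) (fderivWithin ℝ F (D ×ˢ univ) q V) (fderivWithin ℝ F (D ×ˢ univ) q W)
        = Q q V.1 W.1 + V.2 * W.2)
    {N : E → E'} (hN : DifferentiableWithinAt ℝ N D a)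
    (hNormal : ∀ᶠ z in 𝓝[D] a, ∀ w,
      G (F (z, f z)) (N z) (fderivWithin ℝ (fun z => F (z, f z)) D z w) = 0)
    {p : E} {α : ℝ} (hNa : N a = fderivWithin ℝ F (D ×ˢ univ) (a, f a) (α • (p, -1))) (v w : E) :
    G (F (a, f a)) (fderivWithin ℝ N D a v
        + Γ (fderivWithin ℝ (fun z => F (z, f z)) D a v) (N a))
        (fderivWithin ℝ (fun z => F (z, f z)) D a w)
      = α * (fderivWithin ℝ (fderivWithin ℝ f D) D a v w
        - koszul (fderivWithin ℝ Q (D ×ˢ univ) (a, f a) ∘L ContinuousLinearMap.inl ℝ E ℝ) v w p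
        - (fderivWithin ℝ Q (D ×ˢ univ) (a, f a) (0, 1) v w
          + fderivWithin ℝ f D a v * fderivWithin ℝ Q (D ×ˢ univ) (a, f a) (0, 1) w p
          + fderivWithin ℝ f D a w * fderivWithin ℝ Q (D ×ˢ univ) (a, f a) (0, 1) v p) / 2) := by
  set s : Set (E × ℝ) := D ×ˢ univ with hs_def
  set c : E × ℝ := (a, f a) with hc_def
  have hc : c ∈ s := ⟨ha, mem_univ _⟩
  have hs : UniqueDiffOn ℝ s := uniqueDiffOn_prod_univ hD
  have hs' : s ⊆ closure (interior s) := prod_univ_subset_closure_interior hD'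
  have hGd : DifferentiableAt ℝ G (F c) := hG.differentiableAt (by simp)
  have hGsc := hGs.self_of_nhds
  obtain ⟨hφ1, hφ2⟩ := fderivWithin_fderivWithin_graph hD ha hf hF
  have hφ : ContDiffWithinAt ℝ ∞ (fun z => F (z, f z)) D a :=
    have hm : MapsTo (fun z => (z, f z)) D s := fun z hz => ⟨hz, mem_univ _⟩
    hF.comp a (contDiffWithinAt_id.prodMk hf) hm
  have hφd := (hφ.differentiableWithinAt (by simp)).hasFDerivWithinAt
  have hφd2 := ((hφ.fderivWithin_right hD (m := 1) (by norm_cast) ha).differentiableWithinAt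
    (by simp)).hasFDerivWithinAt
  -- differentiate the orthogonality relation
  have hweingarten : fderiv ℝ G (F c) (fderivWithin ℝ (fun z => F (z, f z)) D a v) (N a)
        (fderivWithin ℝ (fun z => F (z, f z)) D a w)
      + G (F c) (fderivWithin ℝ N D a v) (fderivWithin ℝ (fun z => F (z, f z)) D a w)
      + G (F c) (N a) (fderivWithin ℝ (fderivWithin ℝ (fun z => F (z, f z)) D) D a v w) = 0 := by
    have hGF : HasFDerivWithinAt (fun z => G (F (z, f z)))
        (fderiv ℝ G (F c) ∘L fderivWithin ℝ (fun z => F (z, f z)) D a) D a :=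
      HasFDerivAt.comp_hasFDerivWithinAt (f := fun z => F (z, f z)) (g := G) a
        hGd.hasFDerivAt hφd
    have h1 := ((hGF.clm_apply hN.hasFDerivWithinAt).clm_apply
      (hφd2.clm_apply (hasFDerivWithinAt_const w a D))).fderivWithin (hD a ha)
    have h2 : (fun z => G (F (z, f z)) (N z) (fderivWithin ℝ (fun z => F (z, f z)) D z w))
        =ᶠ[𝓝[D] a] fun _ => 0 := hNormal.mono fun z hz => hz w
    rw [h2.fderivWithin_eq (h2.self_of_nhdsWithin ha)] at h1
    have h3 := congrArg (fun T : E →L[ℝ] ℝ => T v) h1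
    simp at h3
    linarith
  -- Metric compatibility trades the derivative of `G` in `hweingarten` for Christoffel terms.
  -- Together they give the Weingarten relation `G(∇_v N, dφ w) = -G(N, D²φ(v, w) + Γ(dφ v, dφ w))`.
  have hcompat := koszul_add_koszul (fderiv_symm hGd hGs)
    (fderivWithin ℝ (fun z => F (z, f z)) D a v) (N a)
    (fderivWithin ℝ (fun z => F (z, f z)) D a w)
  rw [← hΓ, ← hΓ] at hcompat
  -- As `N` is a multiple of `dF(p, -1)`, the Christoffel part of the right-hand side is a Koszul
  -- expression of `F^*G` on `(v, df v)`, `(w, df w)` and `(p, -1)`, which `koszul_fermi` evaluates.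
  have hkos := koszul_induced hs hs' hc hF hGd hGsc hΓ
    (v, fderivWithin ℝ f D a v) (w, fderivWithin ℝ f D a w) (p, -1)
  have hHd : DifferentiableWithinAt ℝ
      (fun z => pullForm (G (F z)) (fderivWithin ℝ F s z)) s c :=
    differentiableWithinAt_pullForm
      (hGd.comp_differentiableWithinAt c (hF.differentiableWithinAt (by simp)))
      ((hF.fderivWithin_right hs (m := 1) (by norm_cast) hc).differentiableWithinAt (by simp))
  rw [koszul_fermi (fderivWithin_fermi hD hc hQ hHd hfermi)] at hkos
  -- The vertical part of `D²φ` is `dF(0, D²f(v, w))`. Its product with `dF(p, -1)` is `-D²f(v, w)`,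
  -- and the sign of the Weingarten relation turns this into the coefficient `+D²f`.
  have h0 := hfermi.self_of_nhdsWithin hc
    (0, fderivWithin ℝ (fderivWithin ℝ f D) D a v w) (p, -1)
  simp only [map_zero, zero_apply, zero_add] at h0
  have hval : G (F c) (N a) (fderivWithin ℝ (fderivWithin ℝ (fun z => F (z, f z)) D) D a v w)
      + G (F c) (N a) (Γ (fderivWithin ℝ (fun z => F (z, f z)) D a v)
        (fderivWithin ℝ (fun z => F (z, f z)) D a w))
      = α * (G (F c) (fderivWithin ℝ (fderivWithin ℝ F s) s c (v, fderivWithin ℝ f D a v)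
          (w, fderivWithin ℝ f D a w)
          + Γ (fderivWithin ℝ F s c (v, fderivWithin ℝ f D a v))
            (fderivWithin ℝ F s c (w, fderivWithin ℝ f D a w)))
          (fderivWithin ℝ F s c (p, -1))
        + G (F c) (fderivWithin ℝ F s c (0, fderivWithin ℝ (fderivWithin ℝ f D) D a v w))
          (fderivWithin ℝ F s c (p, -1))) := by
    rw [hφ2, hφ1, hφ1, hNa, map_smul, map_smul, smul_apply, smul_apply, smul_eq_mul,
      smul_eq_mul, hGsc (fderivWithin ℝ F s c (p, -1)), hGsc (fderivWithin ℝ F s c (p, -1))]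
    simp only [map_add, add_apply]
    ring
  rw [← hkos, h0] at hval
  rw [hGsc (Γ _ (fderivWithin ℝ (fun z => F (z, f z)) D a w)) (N a)] at hcompat
  rw [map_add, add_apply]
  linear_combination hweingarten + hcompat - hval

end Fermi

/-! ### Forms and maps in charts -/

section Charts

open Topology

variable {E : Type*} [NormedAddCommGroup E] [NormedSpace ℝ E]
  {H : Type*} [TopologicalSpace H] (I : ModelWithCorners ℝ E H)
  {X : Type*} [TopologicalSpace X] [ChartedSpace H X]
  {E' : Type*} [NormedAddCommGroup E'] [NormedSpace ℝ E']
  {H' : Type*} [TopologicalSpace H'] (J : ModelWithCorners ℝ E' H')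
  {Y : Type*} [TopologicalSpace Y] [ChartedSpace H' Y]

/-- The derivative of a map, with the tangent spaces identified with the model spaces. -/
def modelDeriv (φ : X → Y) (x : X) : E →L[ℝ] E' := mfderiv I J φ x

/-- The coordinates in the chart centred at `x₀` of tangent vectors at `x`. -/
def chartDeriv (x₀ x : X) : E →L[ℝ] E := mfderiv I 𝓘(ℝ, E) (extChartAt I x₀) x

/-- The tangent vectors at the point with coordinates `z` in the chart centred at `x₀`. -/
def chartDerivSymm (x₀ : X) (z : E) : E →L[ℝ] E :=
  mfderivWithin 𝓘(ℝ, E) I (extChartAt I x₀).symm (range I) z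

/-- A form field, with the tangent spaces identified with the model space. -/
def FormField.model (h : FormField I (X := X)) (x : X) : E →L[ℝ] E →L[ℝ] ℝ := h x

theorem coordForm_eq (h : FormField I (X := X)) (x₀ : X) (z : E) :
    coordForm I h x₀ z
      = pullForm (FormField.model I h ((extChartAt I x₀).symm z)) (chartDerivSymm I x₀ z) := rfl

theorem modelDeriv_id (x : X) : modelDeriv I I (id : X → X) x = ContinuousLinearMap.id ℝ E :=
  mfderiv_id

variable [IsManifold I 1 X] [IsManifold J 1 Y]

theorem chartDeriv_chartDerivSymm {x₀ : X} {z : E} (hz : z ∈ (extChartAt I x₀).target) (v : E) :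
    chartDeriv I x₀ ((extChartAt I x₀).symm z) (chartDerivSymm I x₀ z v) = v :=
  DFunLike.congr_fun (mfderiv_extChartAt_comp_mfderivWithin_extChartAt_symm hz) v

theorem chartDerivSymm_chartDeriv {x₀ x : X} (hx : x ∈ (extChartAt I x₀).source) (v : E) :
    chartDerivSymm I x₀ (extChartAt I x₀ x) (chartDeriv I x₀ x v) = v :=
  DFunLike.congr_fun (mfderivWithin_extChartAt_symm_comp_mfderiv_extChartAt' hx) v

theorem chartDeriv_chartDerivSymm' {x₀ x : X} (hx : x ∈ (extChartAt I x₀).source) (v : E) :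
    chartDeriv I x₀ x (chartDerivSymm I x₀ (extChartAt I x₀ x) v) = v := by
  have := chartDeriv_chartDerivSymm I ((extChartAt I x₀).map_source hx) v
  rwa [(extChartAt I x₀).left_inv hx] at this

theorem chartDeriv_bijective {x₀ x : X} (hx : x ∈ (extChartAt I x₀).source) :
    Function.Bijective (chartDeriv I x₀ x) :=
  ⟨(show Function.LeftInverse (chartDerivSymm I x₀ (extChartAt I x₀ x)) _ from
      chartDerivSymm_chartDeriv I hx).injective,
    (show Function.RightInverse (chartDerivSymm I x₀ (extChartAt I x₀ x)) _ from
      chartDeriv_chartDerivSymm' I hx).surjective⟩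

/-- Tangent vectors are by convention read in the preferred chart. Expressions in charts centred at
the point and at its image therefore agree with the intrinsic ones without any change of basis. -/
theorem chartDeriv_self (x : X) : chartDeriv I x x = ContinuousLinearMap.id ℝ E :=
  mfderiv_extChartAt_self

theorem form_eq_coordForm (h : FormField I (X := X)) {x₀ x : X}
    (hx : x ∈ (extChartAt I x₀).source) :
    FormField.model I h x
      = pullForm (coordForm I h x₀ (extChartAt I x₀ x)) (chartDeriv I x₀ x) := by
  ext v w
  rw [pullForm_apply, coordForm_eq, pullForm_apply, chartDerivSymm_chartDeriv I hx,
    chartDerivSymm_chartDeriv I hx, (extChartAt I x₀).left_inv hx]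

theorem coordForm_chartDeriv (h : FormField I (X := X)) {x₀ x : X}
    (hx : x ∈ (extChartAt I x₀).source) (v w : E) :
    coordForm I h x₀ (extChartAt I x₀ x) (chartDeriv I x₀ x v) (chartDeriv I x₀ x w)
      = FormField.model I h x v w := by
  rw [form_eq_coordForm I h hx, pullForm_apply]

theorem coordForm_self (h : FormField I (X := X)) (x : X) :
    coordForm I h x (extChartAt I x x) = FormField.model I h x := by
  rw [form_eq_coordForm I h (mem_extChartAt_source x), chartDeriv_self]
  rfl

/-- The derivative of a vector-valued map in a chart. -/
theorem fderivWithin_comp_chart {A : X → E'} {x₀ x : X} (hx : x ∈ (extChartAt I x₀).source)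
    (hA : MDifferentiableAt I 𝓘(ℝ, E') A x) :
    DifferentiableWithinAt ℝ (A ∘ (extChartAt I x₀).symm) (range I) (extChartAt I x₀ x) ∧
    ∀ v : E, fderivWithin ℝ (A ∘ (extChartAt I x₀).symm) (range I) (extChartAt I x₀ x) v
      = modelDeriv I 𝓘(ℝ, E') A x (chartDerivSymm I x₀ (extChartAt I x₀ x) v) := by
  have hz : extChartAt I x₀ x ∈ (extChartAt I x₀).target := (extChartAt I x₀).map_source hx
  have hmem : extChartAt I x₀ x ∈ range I := extChartAt_target_subset_range x₀ hz
  have hsymm := mdifferentiableWithinAt_extChartAt_symm hz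
  have hinv := (extChartAt I x₀).left_inv hx
  have hd : MDifferentiableWithinAt 𝓘(ℝ, E) 𝓘(ℝ, E') (A ∘ (extChartAt I x₀).symm) (range I)
      (extChartAt I x₀ x) :=
    MDifferentiableAt.comp_mdifferentiableWithinAt (I' := I) _ (by rwa [hinv]) hsymm
  refine ⟨hd.differentiableWithinAt, fun v => ?_⟩
  have h := mfderiv_comp_mfderivWithin_of_eq (I' := I) (g := A) (y := x) hA hsymm
    (I.uniqueMDiffOn _ hmem) hinv
  rw [← mfderivWithin_eq_fderivWithin]
  exact DFunLike.congr_fun h v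

/-- The derivative of a map in charts. -/
theorem fderivWithin_inCharts {φ : X → Y} {x₀ x : X} {y₀ : Y}
    (hx : x ∈ (extChartAt I x₀).source) (hy : φ x ∈ (extChartAt J y₀).source)
    (hφ : MDifferentiableAt I J φ x) (v : E) :
    fderivWithin ℝ (extChartAt J y₀ ∘ φ ∘ (extChartAt I x₀).symm) (range I) (extChartAt I x₀ x) v
      = chartDeriv J y₀ (φ x) (modelDeriv I J φ x
          (chartDerivSymm I x₀ (extChartAt I x₀ x) v)) := by
  have hy' : MDifferentiableAt J 𝓘(ℝ, E') (extChartAt J y₀) (φ x) :=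
    mdifferentiableAt_extChartAt (by rwa [← extChartAt_source (I := J)])
  have h1 := (fderivWithin_comp_chart I (A := extChartAt J y₀ ∘ φ) hx (hy'.comp x hφ)).2 v
  exact h1.trans (DFunLike.congr_fun (mfderiv_comp x hy' hφ) _)

theorem fderivWithin_inCharts_chartDeriv {φ : X → Y} {x₀ x : X} {y₀ : Y}
    (hx : x ∈ (extChartAt I x₀).source) (hy : φ x ∈ (extChartAt J y₀).source)
    (hφ : MDifferentiableAt I J φ x) (v : E) :
    fderivWithin ℝ (extChartAt J y₀ ∘ φ ∘ (extChartAt I x₀).symm) (range I) (extChartAt I x₀ x)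
        (chartDeriv I x₀ x v)
      = chartDeriv J y₀ (φ x) (modelDeriv I J φ x v) := by
  rw [fderivWithin_inCharts I J hx hy hφ, chartDerivSymm_chartDeriv I hx]

/-- The first fundamental form in charts. -/
theorem coordForm_firstForm (g : FormField J (X := Y)) {φ : X → Y} {x₀ : X} {y₀ : Y} {z : E}
    (hz : z ∈ (extChartAt I x₀).target)
    (hy : φ ((extChartAt I x₀).symm z) ∈ (extChartAt J y₀).source)
    (hφ : MDifferentiableAt I J φ ((extChartAt I x₀).symm z)) :
    coordForm I (firstForm I J g φ) x₀ z
      = pullForm (coordForm J g y₀ (extChartAt J y₀ (φ ((extChartAt I x₀).symm z))))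
        (fderivWithin ℝ (extChartAt J y₀ ∘ φ ∘ (extChartAt I x₀).symm) (range I) z) := by
  have hx := (extChartAt I x₀).map_target hz
  ext v w
  have h := fun v => fderivWithin_inCharts I J hx hy hφ v
  rw [(extChartAt I x₀).right_inv hz] at h
  rw [pullForm_apply, h, h, coordForm_chartDeriv J g hy]
  rfl

/-- The coefficients of a form field in two charts. -/
theorem coordForm_change (h : FormField I (X := X)) {x₀ x₁ : X} {z : E}
    (hz : z ∈ (extChartAt I x₁).target)
    (hx : (extChartAt I x₁).symm z ∈ (extChartAt I x₀).source) :
    coordForm I h x₁ z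
      = pullForm (coordForm I h x₀ (extChartAt I x₀ ((extChartAt I x₁).symm z)))
        (fderivWithin ℝ (extChartAt I x₀ ∘ (extChartAt I x₁).symm) (range I) z) := by
  have hx₁ := (extChartAt I x₁).map_target hz
  ext v w
  have h' := fun v => fderivWithin_inCharts I I (φ := id) hx₁ hx mdifferentiableAt_id v
  rw [(extChartAt I x₁).right_inv hz] at h'
  have h'' : ∀ v, fderivWithin ℝ (extChartAt I x₀ ∘ (extChartAt I x₁).symm) (range I) z v
      = chartDeriv I x₀ ((extChartAt I x₁).symm z) (chartDerivSymm I x₁ z v) := fun v =>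
    (h' v).trans (by rw [modelDeriv_id]; rfl)
  rw [pullForm_apply, h'', h'', coordForm_chartDeriv I h hx]
  rfl

theorem fderivWithin_chart_change {x₀ x₁ : X} (hx : x₁ ∈ (extChartAt I x₀).source) :
    fderivWithin ℝ (extChartAt I x₀ ∘ (extChartAt I x₁).symm) (range I) (extChartAt I x₁ x₁)
      = chartDeriv I x₀ x₁ := by
  ext v
  have h' := fderivWithin_inCharts_chartDeriv I I (φ := id) (mem_extChartAt_source x₁) hx
    mdifferentiableAt_id v
  rw [chartDeriv_self, modelDeriv_id] at h'
  exact h'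

end Charts

/-! ### Smoothness of tensors and families via charts and trivialisations -/

section Smoothness

open Topology

variable {E : Type*} [NormedAddCommGroup E] [NormedSpace ℝ E]
  {H : Type*} [TopologicalSpace H] (I : ModelWithCorners ℝ E H)
  {X : Type*} [TopologicalSpace X] [ChartedSpace H X]
  {E' : Type*} [NormedAddCommGroup E'] [NormedSpace ℝ E']
  {H' : Type*} [TopologicalSpace H'] (J : ModelWithCorners ℝ E' H')
  {Y : Type*} [TopologicalSpace Y] [ChartedSpace H' Y]

/-- The trivialisation of the tangent bundle that is given by a chart. -/
theorem trivializationAt_tangent [IsManifold I 1 X] {x₀ x : X}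
    (hx : x ∈ (extChartAt I x₀).source) (v : TangentSpace I x) :
    (trivializationAt E (TangentSpace I) x₀ (TotalSpace.mk' E x v)).2 = chartDeriv I x₀ x v := by
  have hx' : x ∈ (chartAt H x₀).source := by rwa [← extChartAt_source (I := I)]
  have h := DFunLike.congr_fun
    (TangentBundle.continuousLinearMapAt_trivializationAt (𝕜 := ℝ) (I := I) hx') v
  rw [Trivialization.continuousLinearMapAt_apply, Trivialization.coe_linearMapAt_of_mem _
    (show x ∈ (trivializationAt E (TangentSpace I) x₀).baseSet from hx')] at h
  exact h

/-- The trivialisation of the bundle of bilinear forms that is given by a chart. -/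
theorem trivializationAt_form [IsManifold I 1 X] {x₀ x : X} (hx : x ∈ (extChartAt I x₀).source)
    (B : TangentSpace I x →L[ℝ] TangentSpace I x →L[ℝ] ℝ) :
    (trivializationAt (E →L[ℝ] E →L[ℝ] ℝ)
      (fun x : X => TangentSpace I x →L[ℝ] TangentSpace I x →L[ℝ] ℝ) x₀
      (TotalSpace.mk' (E →L[ℝ] E →L[ℝ] ℝ) x B)).2
      = pullForm (show E →L[ℝ] E →L[ℝ] ℝ from B)
          (chartDerivSymm I x₀ (extChartAt I x₀ x)) := by
  have hx' : x ∈ (chartAt H x₀).source := by rwa [← extChartAt_source (I := I)]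
  have hb : x ∈ (trivializationAt E (TangentSpace I) x₀).baseSet := hx'
  ext v w
  rw [hom_trivializationAt_apply]
  dsimp only
  have h := inCoordinates_apply_eq₂ (𝕜 := ℝ) (F₁ := E) (F₂ := E) (F₃ := ℝ)
    (E₁ := (TangentSpace I : X → Type _)) (E₂ := (TangentSpace I : X → Type _))
    (E₃ := Bundle.Trivial X ℝ) (x₀ := x₀) (x := x) (ϕ := B) (v := v) (w := w) hb hb (mem_univ _)
  refine h.trans ?_
  have hs : ∀ v : E, (trivializationAt E (TangentSpace I) x₀).symm x v
      = chartDerivSymm I x₀ (extChartAt I x₀ x) v := fun v =>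
    ((trivializationAt E (TangentSpace I) x₀).symmL_apply (R := ℝ) hb v).symm.trans
      (DFunLike.congr_fun (TangentBundle.symmL_trivializationAt (𝕜 := ℝ) (I := I) hx') v)
  rw [hs, hs]
  simp
  rfl

/-- Smooth fields of bilinear forms. -/
abbrev IsSmoothForm [IsManifold J ∞ Y] (g : FormField J (X := Y)) : Prop :=
  ContMDiff J (J.prod 𝓘(ℝ, E' →L[ℝ] E' →L[ℝ] ℝ)) ∞
    (fun y => TotalSpace.mk' (E' →L[ℝ] E' →L[ℝ] ℝ)
      (E := fun y : Y => TangentSpace J y →L[ℝ] TangentSpace J y →L[ℝ] ℝ) y (g y))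

/-- The coefficients of a smooth metric in a chart are smooth. -/
theorem contDiffOn_coordForm [IsManifold J ∞ Y] {g : FormField J (X := Y)}
    (hg : IsSmoothForm J g) (y₀ : Y) :
    ContDiffOn ℝ ∞ (coordForm J g y₀) (extChartAt J y₀).target := by
  have h1 : ContMDiffOn J 𝓘(ℝ, E' →L[ℝ] E' →L[ℝ] ℝ) ∞
      (fun y => pullForm (FormField.model J g y) (chartDerivSymm J y₀ (extChartAt J y₀ y)))
      (extChartAt J y₀).source := by
    intro y hy
    have hb : TotalSpace.mk' (E' →L[ℝ] E' →L[ℝ] ℝ)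
        (E := fun y : Y => TangentSpace J y →L[ℝ] TangentSpace J y →L[ℝ] ℝ) y (g y) ∈
        (trivializationAt (E' →L[ℝ] E' →L[ℝ] ℝ)
          (fun y : Y => TangentSpace J y →L[ℝ] TangentSpace J y →L[ℝ] ℝ) y₀).source := by
      rw [Trivialization.mem_source, hom_trivializationAt_baseSet, hom_trivializationAt_baseSet]
      have hy' : y ∈ (chartAt H' y₀).source := by rwa [← extChartAt_source (I := J)]
      exact ⟨hy', hy', mem_univ _⟩
    have h2 := (((trivializationAt (E' →L[ℝ] E' →L[ℝ] ℝ)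
          (fun y : Y => TangentSpace J y →L[ℝ] TangentSpace J y →L[ℝ] ℝ) y₀).contMDiffAt_iff
          (n := ∞) (IB := J) (IM := J) (f := fun y => TotalSpace.mk' (E' →L[ℝ] E' →L[ℝ] ℝ)
        (E := fun y : Y => TangentSpace J y →L[ℝ] TangentSpace J y →L[ℝ] ℝ) y (g y)) hb).1 (hg y)).2
    refine h2.contMDiffWithinAt.congr (fun y' hy' => ?_) ?_
    · exact (trivializationAt_form J hy' _).symm
    · exact (trivializationAt_form J hy _).symm
  have h2 : ContMDiffOn 𝓘(ℝ, E') 𝓘(ℝ, E' →L[ℝ] E' →L[ℝ] ℝ) ∞ (coordForm J g y₀)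
      (extChartAt J y₀).target := by
    refine (h1.comp (contMDiffOn_extChartAt_symm y₀) fun z hz =>
      (extChartAt J y₀).map_target hz).congr fun z hz => ?_
    rw [Function.comp_apply, coordForm_eq, (extChartAt J y₀).right_inv hz]
  exact contMDiffOn_iff_contDiffOn.1 h2

/-- The coordinates of `(x, t, p)`, `p ∈ T_x X`, in the chart centred at `x₀`. -/
def familyChart (x₀ : X) (q : TangentBundle I X × ℝ) : E × ℝ × E :=
  (extChartAt I x₀ q.1.proj, q.2, chartDeriv I x₀ q.1.proj q.1.2)

theorem contMDiffAt_familyChart [IsManifold I ∞ X] (q₀ : TangentBundle I X × ℝ) :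
    ContMDiffAt (I.tangent.prod 𝓘(ℝ, ℝ)) 𝓘(ℝ, E × ℝ × E) ∞ (familyChart I q₀.1.proj) q₀ := by
  have hproj : ContMDiff (I.tangent.prod 𝓘(ℝ, ℝ)) I ∞
      (fun q : TangentBundle I X × ℝ => q.1.proj) :=
    (contMDiff_proj (TangentSpace I : X → Type _)).comp contMDiff_fst
  have h1 : ContMDiffAt (I.tangent.prod 𝓘(ℝ, ℝ)) 𝓘(ℝ, E) ∞
      (fun q : TangentBundle I X × ℝ => extChartAt I q₀.1.proj q.1.proj) q₀ :=
    ContMDiffAt.comp q₀ (I' := I) (g := extChartAt I q₀.1.proj) contMDiffAt_extChartAt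
      hproj.contMDiffAt
  have h2 : ContMDiffAt (I.tangent.prod 𝓘(ℝ, ℝ)) 𝓘(ℝ, ℝ) ∞
      (fun q : TangentBundle I X × ℝ => q.2) q₀ := contMDiffAt_snd
  have h3 : ContMDiffAt (I.tangent.prod 𝓘(ℝ, ℝ)) 𝓘(ℝ, E) ∞
      (fun q : TangentBundle I X × ℝ => chartDeriv I q₀.1.proj q.1.proj q.1.2) q₀ := by
    have h4 := (contMDiffAt_totalSpace.1 (contMDiffAt_fst (n := ∞) (I := I.tangent)
      (J := 𝓘(ℝ, ℝ)) (M := TangentBundle I X) (N := ℝ) (p := q₀))).2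
    refine h4.congr_of_eventuallyEq ?_
    have hev : ∀ᶠ q in 𝓝 q₀, q.1.proj ∈ (extChartAt I q₀.1.proj).source :=
      hproj.continuous.continuousAt.eventually
        ((isOpen_extChartAt_source q₀.1.proj).mem_nhds (mem_extChartAt_source q₀.1.proj))
    filter_upwards [hev] with q hq
    exact (trivializationAt_tangent I hq q.1.2).symm
  exact h1.prodMk_space (h2.prodMk_space h3)

/-- The domain, in a chart, of the functions of `(x, t, p)` with `(x, t) ∈ W`. -/
def familyDomain (W : Set (X × ℝ)) (x₀ : X) : Set (E × ℝ × E) :=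
  {r | r.1 ∈ (extChartAt I x₀).target ∧ ((extChartAt I x₀).symm r.1, r.2.1) ∈ W}

theorem contMDiffWithinAt_comp_familyChart [IsManifold I ∞ X] {W : Set (X × ℝ)}
    {V : Type*} [NormedAddCommGroup V] [NormedSpace ℝ V] {Φ : E × ℝ × E → V}
    {q₀ : TangentBundle I X × ℝ}
    (hΦ : ContDiffWithinAt ℝ ∞ Φ (familyDomain I W q₀.1.proj) (familyChart I q₀.1.proj q₀)) :
    ContMDiffWithinAt (I.tangent.prod 𝓘(ℝ, ℝ)) 𝓘(ℝ, V) ∞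
      (fun q => Φ (familyChart I q₀.1.proj q)) {q | (q.1.proj, q.2) ∈ W} q₀ := by
  have hproj : ContMDiff (I.tangent.prod 𝓘(ℝ, ℝ)) I ∞
      (fun q : TangentBundle I X × ℝ => q.1.proj) :=
    (contMDiff_proj (TangentSpace I : X → Type _)).comp contMDiff_fst
  have hev : ∀ᶠ q in 𝓝 q₀, q.1.proj ∈ (extChartAt I q₀.1.proj).source :=
    hproj.continuous.continuousAt.eventually
      ((isOpen_extChartAt_source q₀.1.proj).mem_nhds (mem_extChartAt_source q₀.1.proj))
  have h1 : ContMDiffWithinAt (I.tangent.prod 𝓘(ℝ, ℝ)) 𝓘(ℝ, V) ∞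
      (fun q => Φ (familyChart I q₀.1.proj q))
      ({q | (q.1.proj, q.2) ∈ W} ∩ {q | q.1.proj ∈ (extChartAt I q₀.1.proj).source}) q₀ := by
    refine hΦ.contMDiffWithinAt.comp q₀
      (contMDiffAt_familyChart I q₀).contMDiffWithinAt fun q hq => ?_
    refine ⟨(extChartAt I q₀.1.proj).map_source hq.2, ?_⟩
    change ((extChartAt I q₀.1.proj).symm (extChartAt I q₀.1.proj q.1.proj), q.2) ∈ W
    rw [(extChartAt I q₀.1.proj).left_inv hq.2]
    exact hq.1
  exact (contMDiffWithinAt_inter hev).1 h1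

/-- A smooth family of forms, from its expressions in charts. -/
theorem smoothFormFamily_of_local [IsManifold I ∞ X] {W : Set (X × ℝ)}
    {Ψ : (x : X) → ℝ → E → E →L[ℝ] E →L[ℝ] ℝ}
    {Ψ' : (x₀ : X) → E × ℝ × E → E →L[ℝ] E →L[ℝ] ℝ}
    (h : ∀ x₀ x t p, (x, t) ∈ W → x ∈ (extChartAt I x₀).source →
      Ψ x t p = pullForm
        (Ψ' x₀ (extChartAt I x₀ x, t, chartDeriv I x₀ x p)) (chartDeriv I x₀ x))
    (hs : ∀ x₀, ContDiffOn ℝ ∞ (Ψ' x₀) (familyDomain I W x₀)) :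
    SmoothFormFamily I W Ψ := by
  intro q₀ hq₀
  rw [contMDiffWithinAt_totalSpace]
  have hproj : ContMDiff (I.tangent.prod 𝓘(ℝ, ℝ)) I ∞
      (fun q : TangentBundle I X × ℝ => q.1.proj) :=
    (contMDiff_proj (TangentSpace I : X → Type _)).comp contMDiff_fst
  have hx₀ := mem_extChartAt_source (I := I) q₀.1.proj
  have hev : ∀ᶠ q in 𝓝 q₀, q.1.proj ∈ (extChartAt I q₀.1.proj).source :=
    hproj.continuous.continuousAt.eventually
      ((isOpen_extChartAt_source q₀.1.proj).mem_nhds hx₀)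
  refine ⟨hproj.contMDiffAt.contMDiffWithinAt, ?_⟩
  have hcomp := contMDiffWithinAt_comp_familyChart I (W := W) (Φ := Ψ' q₀.1.proj) (q₀ := q₀)
    (hs _ _ ⟨(extChartAt I q₀.1.proj).map_source hx₀, by
      change ((extChartAt I q₀.1.proj).symm (extChartAt I q₀.1.proj q₀.1.proj), q₀.2) ∈ W
      rw [(extChartAt I q₀.1.proj).left_inv hx₀]
      exact hq₀⟩)
  -- The trivialisation pulls a form back by the inverse of `chartDeriv`, which undoes the pull-back
  -- in the hypothesis `h` and leaves the local expression.
  have heq : ∀ q : TangentBundle I X × ℝ, (q.1.proj, q.2) ∈ W →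
      q.1.proj ∈ (extChartAt I q₀.1.proj).source →
      pullForm (Ψ q.1.proj q.2 q.1.2)
          (chartDerivSymm I q₀.1.proj (extChartAt I q₀.1.proj q.1.proj))
        = Ψ' q₀.1.proj (familyChart I q₀.1.proj q) := by
    intro q hq hq'
    ext v w
    rw [pullForm_apply, h q₀.1.proj q.1.proj q.2 q.1.2 hq hq', pullForm_apply,
      chartDeriv_chartDerivSymm' I hq', chartDeriv_chartDerivSymm' I hq']
    rfl
  refine hcomp.congr_of_eventuallyEq ?_ ?_
  · filter_upwards [mem_nhdsWithin_of_mem_nhds hev, self_mem_nhdsWithin] with q hq hqW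
    exact (trivializationAt_form I hq _).trans (heq q hqW hq)
  · exact (trivializationAt_form I hx₀ _).trans (heq q₀ hq₀ hx₀)

/-- A smooth family of functions, from its expressions in charts. -/
theorem smoothFunFamily_of_local [IsManifold I ∞ X] {W : Set (X × ℝ)}
    {ψ : (x : X) → ℝ → E → ℝ} {ψ' : (x₀ : X) → E × ℝ × E → ℝ}
    (h : ∀ x₀ x t p, (x, t) ∈ W → x ∈ (extChartAt I x₀).source →
      ψ x t p = ψ' x₀ (extChartAt I x₀ x, t, chartDeriv I x₀ x p))
    (hs : ∀ x₀, ContDiffOn ℝ ∞ (ψ' x₀) (familyDomain I W x₀)) :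
    SmoothFunFamily I W ψ := by
  intro q₀ hq₀
  have hproj : ContMDiff (I.tangent.prod 𝓘(ℝ, ℝ)) I ∞
      (fun q : TangentBundle I X × ℝ => q.1.proj) :=
    (contMDiff_proj (TangentSpace I : X → Type _)).comp contMDiff_fst
  have hx₀ := mem_extChartAt_source (I := I) q₀.1.proj
  have hev : ∀ᶠ q in 𝓝 q₀, q.1.proj ∈ (extChartAt I q₀.1.proj).source :=
    hproj.continuous.continuousAt.eventually
      ((isOpen_extChartAt_source q₀.1.proj).mem_nhds hx₀)
  have hcomp := contMDiffWithinAt_comp_familyChart I (W := W) (Φ := ψ' q₀.1.proj) (q₀ := q₀)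
    (hs _ _ ⟨(extChartAt I q₀.1.proj).map_source hx₀, by
      change ((extChartAt I q₀.1.proj).symm (extChartAt I q₀.1.proj q₀.1.proj), q₀.2) ∈ W
      rw [(extChartAt I q₀.1.proj).left_inv hx₀]
      exact hq₀⟩)
  refine hcomp.congr_of_eventuallyEq ?_ (h _ _ _ _ hq₀ hx₀)
  filter_upwards [mem_nhdsWithin_of_mem_nhds hev, self_mem_nhdsWithin] with q hq hqW
  exact h _ _ _ _ hqW hq

end Smoothness

/-! ### A family of hypersurfaces in charts -/

section Flow

open Topology

variable {E : Type*} [NormedAddCommGroup E] [NormedSpace ℝ E]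
  {H : Type*} [TopologicalSpace H] (I : ModelWithCorners ℝ E H)
  {X : Type*} [TopologicalSpace X] [ChartedSpace H X]
  {E' : Type*} [NormedAddCommGroup E'] [NormedSpace ℝ E']
  {H' : Type*} [TopologicalSpace H'] (J : ModelWithCorners ℝ E' H')
  {Y : Type*} [TopologicalSpace Y] [ChartedSpace H' Y]

/-- A family of maps `𝓔(·, t)` in charts. -/
def flowRep (𝓔 : X × ℝ → Y) (x₀ : X) (y₀ : Y) (q : E × ℝ) : E' :=
  extChartAt J y₀ (𝓔 ((extChartAt I x₀).symm q.1, q.2))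

/-- The metric induced by the map `𝓔(·, t)`. -/
def sliceMetric (g : FormField J (X := Y)) (𝓔 : X × ℝ → Y) (t : ℝ) : FormField I (X := X) :=
  firstForm I J g (fun x => 𝓔 (x, t))

/-- The coefficients in the chart centred at `x₀` of the metrics induced by the maps `𝓔(·, t)`. -/
def sliceCoeff (g : FormField J (X := Y)) (𝓔 : X × ℝ → Y) (x₀ : X) (q : E × ℝ) :
    E →L[ℝ] E →L[ℝ] ℝ :=
  coordForm I (sliceMetric I J g 𝓔 q.2) x₀ q.1

/-- The domain of `flowRep` and `sliceCoeff`. -/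
def sliceDomain (W : Set (X × ℝ)) (x₀ : X) : Set (E × ℝ) :=
  {q | q.1 ∈ (extChartAt I x₀).target ∧ ((extChartAt I x₀).symm q.1, q.2) ∈ W}

variable {I J} {W : Set (X × ℝ)} {𝓔 : X × ℝ → Y}

theorem mem_sliceDomain {x₀ x : X} {t : ℝ} (hx : x ∈ (extChartAt I x₀).source)
    (hxt : (x, t) ∈ W) : (extChartAt I x₀ x, t) ∈ sliceDomain I W x₀ := by
  refine ⟨(extChartAt I x₀).map_source hx, ?_⟩
  change ((extChartAt I x₀).symm (extChartAt I x₀ x), t) ∈ W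
  rwa [(extChartAt I x₀).left_inv hx]

theorem sliceDomain_subset (W : Set (X × ℝ)) (x₀ : X) :
    sliceDomain I W x₀ ⊆ range I ×ˢ (univ : Set ℝ) :=
  fun _ hq => ⟨extChartAt_target_subset_range x₀ hq.1, mem_univ _⟩

theorem continuousWithinAt_chartSymm_prod {x₀ : X} {q : E × ℝ}
    (hq : q.1 ∈ (extChartAt I x₀).target) :
    ContinuousWithinAt (fun q : E × ℝ => ((extChartAt I x₀).symm q.1, q.2))
      (range I ×ˢ (univ : Set ℝ)) q := by
  refine ContinuousWithinAt.prodMk ?_ continuousWithinAt_snd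
  exact (continuousAt_extChartAt_symm'' hq).continuousWithinAt.comp continuousWithinAt_fst
    (mapsTo_univ _ _)

theorem eventually_target {x₀ : X} {q : E × ℝ} (hq : q.1 ∈ (extChartAt I x₀).target) :
    ∀ᶠ q' in 𝓝[range I ×ˢ (univ : Set ℝ)] q, q'.1 ∈ (extChartAt I x₀).target := by
  have h := continuousWithinAt_fst (s := range I ×ˢ (univ : Set ℝ)) (p := q)
  exact (h.tendsto_nhdsWithin fun q' hq' => hq'.1).eventually
    (extChartAt_target_mem_nhdsWithin_of_mem hq)

theorem eventually_sliceDomain (hW : IsOpen W) {x₀ : X} {q : E × ℝ}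
    (hq : q ∈ sliceDomain I W x₀) :
    ∀ᶠ q' in 𝓝[range I ×ˢ (univ : Set ℝ)] q, q' ∈ sliceDomain I W x₀ := by
  filter_upwards [eventually_target hq.1,
    (continuousWithinAt_chartSymm_prod hq.1).eventually (hW.mem_nhds hq.2)] with q' h1 h2
    using ⟨h1, h2⟩

theorem eventually_flow_mem (hW : IsOpen W) (h𝓔 : ContinuousOn 𝓔 W) {x₀ : X} {y₀ : Y} {q : E × ℝ}
    (hq : q ∈ sliceDomain I W x₀)
    (hy : 𝓔 ((extChartAt I x₀).symm q.1, q.2) ∈ (extChartAt J y₀).source) :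
    ∀ᶠ q' in 𝓝[range I ×ˢ (univ : Set ℝ)] q,
      𝓔 ((extChartAt I x₀).symm q'.1, q'.2) ∈ (extChartAt J y₀).source := by
  have h1 : ContinuousAt 𝓔 ((extChartAt I x₀).symm q.1, q.2) := h𝓔.continuousAt (hW.mem_nhds hq.2)
  have h2 := ContinuousAt.comp_continuousWithinAt (g := 𝓔)
    (f := fun q : E × ℝ => ((extChartAt I x₀).symm q.1, q.2)) h1
    (continuousWithinAt_chartSymm_prod hq.1)
  exact h2.eventually ((isOpen_extChartAt_source y₀).mem_nhds hy)

theorem contDiffWithinAt_flowRep [IsManifold I ∞ X] [IsManifold J ∞ Y] (hW : IsOpen W)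
    (h𝓔 : ContMDiffOn (I.prod 𝓘(ℝ, ℝ)) J ∞ 𝓔 W) {x₀ : X} {y₀ : Y} {q : E × ℝ}
    (hq : q ∈ sliceDomain I W x₀)
    (hy : 𝓔 ((extChartAt I x₀).symm q.1, q.2) ∈ (extChartAt J y₀).source) :
    ContDiffWithinAt ℝ ∞ (flowRep I J 𝓔 x₀ y₀) (range I ×ˢ (univ : Set ℝ)) q := by
  have h1 : ContMDiffWithinAt 𝓘(ℝ, E × ℝ) I ∞ (fun q : E × ℝ => (extChartAt I x₀).symm q.1)
      (range I ×ˢ (univ : Set ℝ)) q := by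
    refine ContMDiffWithinAt.comp (I' := 𝓘(ℝ, E)) (t := range I) q
      (g := (extChartAt I x₀).symm) (f := Prod.fst)
      (contMDiffWithinAt_extChartAt_symm_range x₀ hq.1)
      contDiff_fst.contMDiff.contMDiffAt.contMDiffWithinAt fun q' hq' => hq'.1
  have h2 : ContMDiffWithinAt 𝓘(ℝ, E × ℝ) 𝓘(ℝ, ℝ) ∞ (fun q : E × ℝ => q.2)
      (range I ×ˢ (univ : Set ℝ)) q := contDiff_snd.contMDiff.contMDiffAt.contMDiffWithinAt
  have h3 : ContMDiffAt (I.prod 𝓘(ℝ, ℝ)) J ∞ 𝓔 ((extChartAt I x₀).symm q.1, q.2) :=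
    h𝓔.contMDiffAt (hW.mem_nhds hq.2)
  have h4 : ContMDiffAt J 𝓘(ℝ, E') ∞ (extChartAt J y₀)
      (𝓔 ((extChartAt I x₀).symm q.1, q.2)) :=
    contMDiffAt_extChartAt' (by rwa [← extChartAt_source (I := J)])
  exact (h4.comp_contMDiffWithinAt q (h3.comp_contMDiffWithinAt q
    (h1.prodMk h2))).contDiffWithinAt

theorem mdifferentiableAt_slice (hW : IsOpen W) (h𝓔 : ContMDiffOn (I.prod 𝓘(ℝ, ℝ)) J ∞ 𝓔 W)
    {x : X} {t : ℝ} (hxt : (x, t) ∈ W) : MDifferentiableAt I J (fun x => 𝓔 (x, t)) x := by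
  have h3 : MDifferentiableAt (I.prod 𝓘(ℝ, ℝ)) J 𝓔 (x, t) :=
    (h𝓔.contMDiffAt (hW.mem_nhds hxt)).mdifferentiableAt (by simp)
  exact h3.comp x (mdifferentiableAt_id.prodMk mdifferentiableAt_const)

theorem mdifferentiableAt_curve (hW : IsOpen W) (h𝓔 : ContMDiffOn (I.prod 𝓘(ℝ, ℝ)) J ∞ 𝓔 W)
    {x : X} {t : ℝ} (hxt : (x, t) ∈ W) : MDifferentiableAt 𝓘(ℝ, ℝ) J (fun t => 𝓔 (x, t)) t := by
  have h3 : MDifferentiableAt (I.prod 𝓘(ℝ, ℝ)) J 𝓔 (x, t) :=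
    (h𝓔.contMDiffAt (hW.mem_nhds hxt)).mdifferentiableAt (by simp)
  exact h3.comp t (mdifferentiableAt_const.prodMk mdifferentiableAt_id)

/-- The derivative of `𝓔(·, t)` in charts. -/
theorem fderivWithin_flowRep_inl [IsManifold I ∞ X] [IsManifold J ∞ Y] (hW : IsOpen W)
    (h𝓔 : ContMDiffOn (I.prod 𝓘(ℝ, ℝ)) J ∞ 𝓔 W) {x₀ : X} {y₀ : Y} {q : E × ℝ}
    (hq : q ∈ sliceDomain I W x₀)
    (hy : 𝓔 ((extChartAt I x₀).symm q.1, q.2) ∈ (extChartAt J y₀).source) :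
    fderivWithin ℝ (extChartAt J y₀ ∘ (fun x => 𝓔 (x, q.2)) ∘ (extChartAt I x₀).symm) (range I) q.1
      = fderivWithin ℝ (flowRep I J 𝓔 x₀ y₀) (range I ×ˢ (univ : Set ℝ)) q
        ∘L ContinuousLinearMap.inl ℝ E ℝ := by
  have hF := ((contDiffWithinAt_flowRep hW h𝓔 hq hy).differentiableWithinAt
    (by simp)).hasFDerivWithinAt
  have hm : MapsTo (fun z : E => (z, q.2)) (range I) (range I ×ˢ (univ : Set ℝ)) :=
    fun z hz => ⟨hz, mem_univ _⟩
  have hF' : HasFDerivWithinAt (flowRep I J 𝓔 x₀ y₀)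
    (fderivWithin ℝ (flowRep I J 𝓔 x₀ y₀) (range I ×ˢ (univ : Set ℝ)) q)
    (range I ×ˢ (univ : Set ℝ)) (q.1, q.2) := hF
  have h := hF'.comp q.1 (hasFDerivAt_prodMk_left q.1 q.2).hasFDerivWithinAt hm
  exact h.fderivWithin (I.uniqueDiffOn _ (extChartAt_target_subset_range x₀ hq.1))

/-- The velocity of `𝓔(x, ·)` in charts. -/
theorem chartDeriv_velocity [IsManifold I ∞ X] [IsManifold J ∞ Y] (hW : IsOpen W)
    (h𝓔 : ContMDiffOn (I.prod 𝓘(ℝ, ℝ)) J ∞ 𝓔 W) {x₀ x : X} {y₀ : Y} {t : ℝ} (hxt : (x, t) ∈ W)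
    (hx : x ∈ (extChartAt I x₀).source) (hy : 𝓔 (x, t) ∈ (extChartAt J y₀).source) :
    chartDeriv J y₀ (𝓔 (x, t)) (velocity J (fun s => 𝓔 (x, s)) t)
      = fderivWithin ℝ (flowRep I J 𝓔 x₀ y₀) (range I ×ˢ (univ : Set ℝ)) (extChartAt I x₀ x, t)
        (0, 1) := by
  have hinv := (extChartAt I x₀).left_inv hx
  have hy' : 𝓔 ((extChartAt I x₀).symm (extChartAt I x₀ x, t).1, t) ∈ (extChartAt J y₀).source := by
    simpa only [hinv] using hy
  have hF := ((contDiffWithinAt_flowRep hW h𝓔 (mem_sliceDomain hx hxt) hy').differentiableWithinAt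
    (by simp)).hasFDerivWithinAt
  have hm : MapsTo (fun s : ℝ => (extChartAt I x₀ x, s)) univ (range I ×ˢ (univ : Set ℝ)) :=
    fun z hz => ⟨extChartAt_target_subset_range x₀ ((extChartAt I x₀).map_source hx), mem_univ _⟩
  have h := (hF.comp t (hasFDerivAt_prodMk_right _ t).hasFDerivWithinAt hm).fderivWithin
    uniqueDiffWithinAt_univ
  have h2 := fderivWithin_inCharts_chartDeriv 𝓘(ℝ, ℝ) J (φ := fun s => 𝓔 (x, s)) (x₀ := t) (x := t)
    (y₀ := y₀) (mem_extChartAt_source t) hy (mdifferentiableAt_curve hW h𝓔 hxt) (1 : ℝ)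
  rw [chartDeriv_self] at h2
  refine h2.symm.trans ?_
  have h3 := DFunLike.congr_fun h (1 : ℝ)
  simp only [flowRep, Function.comp_def, hinv] at h3
  simpa [flowRep, Function.comp_def, chartAt_self_eq] using h3

/-- The derivative of `𝓔(·, t)` in charts, applied to tangent vectors. -/
theorem chartDeriv_slice [IsManifold I ∞ X] [IsManifold J ∞ Y] (hW : IsOpen W)
    (h𝓔 : ContMDiffOn (I.prod 𝓘(ℝ, ℝ)) J ∞ 𝓔 W) {x₀ x : X} {y₀ : Y} {t : ℝ} (hxt : (x, t) ∈ W)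
    (hx : x ∈ (extChartAt I x₀).source) (hy : 𝓔 (x, t) ∈ (extChartAt J y₀).source) (v : E) :
    chartDeriv J y₀ (𝓔 (x, t)) (modelDeriv I J (fun x => 𝓔 (x, t)) x v)
      = fderivWithin ℝ (flowRep I J 𝓔 x₀ y₀) (range I ×ˢ (univ : Set ℝ)) (extChartAt I x₀ x, t)
        (chartDeriv I x₀ x v, 0) := by
  have hinv := (extChartAt I x₀).left_inv hx
  have hy' : 𝓔 ((extChartAt I x₀).symm (extChartAt I x₀ x, t).1, t) ∈ (extChartAt J y₀).source := by
    simpa only [hinv] using hy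
  have h := fderivWithin_flowRep_inl hW h𝓔 (mem_sliceDomain hx hxt) hy'
  rw [← fderivWithin_inCharts_chartDeriv I J (φ := fun x => 𝓔 (x, t)) hx hy
    (mdifferentiableAt_slice hW h𝓔 hxt)]
  exact DFunLike.congr_fun h _

theorem sliceCoeff_eq [IsManifold I ∞ X] [IsManifold J ∞ Y] (g : FormField J (X := Y))
    (hW : IsOpen W) (h𝓔 : ContMDiffOn (I.prod 𝓘(ℝ, ℝ)) J ∞ 𝓔 W) {x₀ : X} {y₀ : Y} {q : E × ℝ}
    (hq : q ∈ sliceDomain I W x₀)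
    (hy : 𝓔 ((extChartAt I x₀).symm q.1, q.2) ∈ (extChartAt J y₀).source) :
    sliceCoeff I J g 𝓔 x₀ q = pullForm (coordForm J g y₀ (flowRep I J 𝓔 x₀ y₀ q))
      (fderivWithin ℝ (flowRep I J 𝓔 x₀ y₀) (range I ×ˢ (univ : Set ℝ)) q
        ∘L ContinuousLinearMap.inl ℝ E ℝ) := by
  rw [← fderivWithin_flowRep_inl hW h𝓔 hq hy]
  exact coordForm_firstForm I J g hq.1 hy (mdifferentiableAt_slice hW h𝓔 hq.2)

/-- The coefficients involve no chart of `Y`, so near each point they may be computed in the chart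
centred at its image, where they are the pull-back of smooth coefficients by the horizontal
derivative of `𝓔`. -/
theorem contDiffWithinAt_sliceCoeff [IsManifold I ∞ X] [IsManifold J ∞ Y] [J.Boundaryless]
    {g : FormField J (X := Y)}
    (hg : IsSmoothForm J g)
    (hW : IsOpen W) (h𝓔 : ContMDiffOn (I.prod 𝓘(ℝ, ℝ)) J ∞ 𝓔 W) {x₀ : X} {q : E × ℝ}
    (hq : q ∈ sliceDomain I W x₀) :
    ContDiffWithinAt ℝ ∞ (sliceCoeff I J g 𝓔 x₀) (range I ×ˢ (univ : Set ℝ)) q := by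
  set y₀ := 𝓔 ((extChartAt I x₀).symm q.1, q.2) with hy₀
  have hy := mem_extChartAt_source (I := J) y₀
  have hF := contDiffWithinAt_flowRep hW h𝓔 (y₀ := y₀) hq hy
  have hqs := sliceDomain_subset W x₀ hq
  have hs : UniqueDiffOn ℝ (range I ×ˢ (univ : Set ℝ)) := uniqueDiffOn_prod_univ I.uniqueDiffOn
  have hF' := hF.fderivWithin_right hs (m := ∞) (by simp) hqs
  have hG : ContDiffAt ℝ ∞ (coordForm J g y₀) (flowRep I J 𝓔 x₀ y₀ q) :=
    (contDiffOn_coordForm J hg y₀).contDiffAt (extChartAt_target_mem_nhds y₀)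
  refine ((hG.comp_contDiffWithinAt q hF).pullForm
    (hF'.clm_comp contDiffWithinAt_const)).congr_of_eventuallyEq ?_
    (sliceCoeff_eq g hW h𝓔 hq hy)
  filter_upwards [eventually_sliceDomain hW hq,
    eventually_flow_mem hW h𝓔.continuousOn (y₀ := y₀) hq hy] with q' h1 h2
  exact sliceCoeff_eq g hW h𝓔 h1 h2

end Flow

/-! ### The Gauss lemma -/

section Gauss

open Topology

variable {E : Type*} [NormedAddCommGroup E] [NormedSpace ℝ E]
  {H : Type*} [TopologicalSpace H] {I : ModelWithCorners ℝ E H}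
  {X : Type*} [TopologicalSpace X] [ChartedSpace H X]
  {E' : Type*} [NormedAddCommGroup E'] [NormedSpace ℝ E']
  {H' : Type*} [TopologicalSpace H'] {J : ModelWithCorners ℝ E' H'}
  {Y : Type*} [TopologicalSpace Y] [ChartedSpace H' Y]
  {W : Set (X × ℝ)} {𝓔 : X × ℝ → Y} {g : FormField J (X := Y)}

/-- The Christoffel symbols at the centre of a chart. -/
theorem coordForm_christoffel [FiniteDimensional ℝ E'] [IsManifold J 1 Y] [J.Boundaryless] {y : Y}
    (hg : PosDefForm (FormField.model J g y)) (u v w : E') :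
    coordForm J g y (extChartAt J y y) (christoffel J g y u v) w
      = koszul (fderiv ℝ (coordForm J g y) (extChartAt J y y)) u v w := by
  rw [coordForm_self]
  have h1 : christoffel J g y u v
      = (FormField.model J g y).inverse (christoffelFirst J g y u v) := rfl
  rw [h1, hg.apply_inverse, christoffelFirst_apply, koszul, dCoord, J.range_eq_univ,
    fderivWithin_univ]

variable (I J) in
/-- The velocity of `𝓔(x, ·)`, as a vector of the model space. -/
def modelVelocity (𝓔 : X × ℝ → Y) (x : X) (t : ℝ) : E' := velocity J (fun s => 𝓔 (x, s)) t

variable (I J) in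
/-- The derivative of `𝓔`, as a map between model spaces. -/
def flowDeriv (𝓔 : X × ℝ → Y) (x : X) (t : ℝ) (V : E × ℝ) : E' :=
  modelDeriv I J (fun x => 𝓔 (x, t)) x V.1 + V.2 • modelVelocity J 𝓔 x t

variable (I J) in
/-- The coefficients of the metric induced by `𝓔`. -/
def flowCoeff (g : FormField J (X := Y)) (𝓔 : X × ℝ → Y) (x₀ : X) (y₀ : Y) (q : E × ℝ) :
    (E × ℝ) →L[ℝ] (E × ℝ) →L[ℝ] ℝ :=
  pullForm (coordForm J g y₀ (flowRep I J 𝓔 x₀ y₀ q))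
    (fderivWithin ℝ (flowRep I J 𝓔 x₀ y₀) (range I ×ˢ (univ : Set ℝ)) q)

theorem flowRep_center (x : X) (t : ℝ) :
    flowRep I J 𝓔 x (𝓔 (x, t)) (extChartAt I x x, t)
      = extChartAt J (𝓔 (x, t)) (𝓔 (x, t)) := by
  simp only [flowRep, (extChartAt I x).left_inv (mem_extChartAt_source x)]

theorem flowDeriv_eq_mfderiv (hW : IsOpen W)
    (h𝓔 : ContMDiffOn (I.prod 𝓘(ℝ, ℝ)) J ∞ 𝓔 W) {x : X} {t : ℝ} (hxt : (x, t) ∈ W) (V : E × ℝ) :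
    flowDeriv I J 𝓔 x t V = modelDeriv (I.prod 𝓘(ℝ, ℝ)) J 𝓔 (x, t) V := by
  have hd : MDifferentiableAt (I.prod 𝓘(ℝ, ℝ)) J 𝓔 (x, t) :=
    (h𝓔.contMDiffAt (hW.mem_nhds hxt)).mdifferentiableAt (by simp)
  have h1 : modelDeriv (I.prod 𝓘(ℝ, ℝ)) J 𝓔 (x, t) V = modelDeriv I J (fun x => 𝓔 (x, t)) x V.1
      + modelDeriv 𝓘(ℝ, ℝ) J (fun t => 𝓔 (x, t)) t V.2 := mfderiv_prod_eq_add_apply hd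
  have h2 : modelDeriv 𝓘(ℝ, ℝ) J (fun t => 𝓔 (x, t)) t V.2 = V.2 • modelVelocity J 𝓔 x t := by
    change _ = V.2 • modelDeriv 𝓘(ℝ, ℝ) J (fun t => 𝓔 (x, t)) t 1
    rw [← map_smul, smul_eq_mul, mul_one]
  rw [h1, h2, flowDeriv]

variable [IsManifold I ∞ X] [IsManifold J ∞ Y]

theorem chartDeriv_flowDeriv (hW : IsOpen W)
    (h𝓔 : ContMDiffOn (I.prod 𝓘(ℝ, ℝ)) J ∞ 𝓔 W) {x₀ x : X} {y₀ : Y} {t : ℝ} (hxt : (x, t) ∈ W)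
    (hx : x ∈ (extChartAt I x₀).source) (hy : 𝓔 (x, t) ∈ (extChartAt J y₀).source) (V : E × ℝ) :
    chartDeriv J y₀ (𝓔 (x, t)) (flowDeriv I J 𝓔 x t V)
      = fderivWithin ℝ (flowRep I J 𝓔 x₀ y₀) (range I ×ˢ (univ : Set ℝ)) (extChartAt I x₀ x, t)
        (chartDeriv I x₀ x V.1, V.2) := by
  have h1 := chartDeriv_slice hW h𝓔 hxt hx hy V.1
  have h2 : chartDeriv J y₀ (𝓔 (x, t)) (modelVelocity J 𝓔 x t) = _ :=
    chartDeriv_velocity hW h𝓔 hxt hx hy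
  rw [flowDeriv, map_add, map_smul, h1, h2, ← map_smul, ← map_add]
  simp

theorem flowDeriv_eq_fderivWithin (hW : IsOpen W)
    (h𝓔 : ContMDiffOn (I.prod 𝓘(ℝ, ℝ)) J ∞ 𝓔 W) {x : X} {t : ℝ} (hxt : (x, t) ∈ W) (V : E × ℝ) :
    fderivWithin ℝ (flowRep I J 𝓔 x (𝓔 (x, t))) (range I ×ˢ (univ : Set ℝ)) (extChartAt I x x, t) V
      = flowDeriv I J 𝓔 x t V := by
  have h := chartDeriv_flowDeriv hW h𝓔 hxt (mem_extChartAt_source x)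
    (mem_extChartAt_source (I := J) (𝓔 (x, t))) V
  rw [chartDeriv_self, chartDeriv_self] at h
  exact h.symm

theorem flowCoeff_apply (hW : IsOpen W)
    (h𝓔 : ContMDiffOn (I.prod 𝓘(ℝ, ℝ)) J ∞ 𝓔 W) {x₀ x : X} {y₀ : Y} {t : ℝ} (hxt : (x, t) ∈ W)
    (hx : x ∈ (extChartAt I x₀).source) (hy : 𝓔 (x, t) ∈ (extChartAt J y₀).source)
    (V V' : E × ℝ) :
    flowCoeff I J g 𝓔 x₀ y₀ (extChartAt I x₀ x, t) (chartDeriv I x₀ x V.1, V.2)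
        (chartDeriv I x₀ x V'.1, V'.2)
      = FormField.model J g (𝓔 (x, t)) (flowDeriv I J 𝓔 x t V) (flowDeriv I J 𝓔 x t V') := by
  rw [flowCoeff, pullForm_apply, ← chartDeriv_flowDeriv hW h𝓔 hxt hx hy,
    ← chartDeriv_flowDeriv hW h𝓔 hxt hx hy, flowRep]
  simp only [(extChartAt I x₀).left_inv hx]
  exact coordForm_chartDeriv J g hy _ _

/-- The geodesic equation in charts. -/
theorem geodesic_flowRep (hW : IsOpen W)
    (h𝓔 : ContMDiffOn (I.prod 𝓘(ℝ, ℝ)) J ∞ 𝓔 W) {x : X} {t : ℝ} (hxt : (x, t) ∈ W)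
    (hgeo : covDerivAlong 𝓘(ℝ, ℝ) J g (fun s => 𝓔 (x, s)) (velocity J (fun s => 𝓔 (x, s))) t
      (1 : ℝ) = 0) :
    fderivWithin ℝ (fderivWithin ℝ (flowRep I J 𝓔 x (𝓔 (x, t))) (range I ×ˢ (univ : Set ℝ)))
        (range I ×ˢ (univ : Set ℝ)) (extChartAt I x x, t) (0, 1) (0, 1)
      + christoffel J g (𝓔 (x, t)) (flowDeriv I J 𝓔 x t (0, 1)) (flowDeriv I J 𝓔 x t (0, 1))
      = 0 := by
  have hx := mem_extChartAt_source (I := I) x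
  have hq := mem_sliceDomain hx hxt
  have hy := mem_extChartAt_source (I := J) (𝓔 (x, t))
  have hF := contDiffWithinAt_flowRep hW h𝓔 (y₀ := 𝓔 (x, t)) hq (by
    simp only [(extChartAt I x).left_inv hx]
    exact hy)
  have hs : UniqueDiffOn ℝ (range I ×ˢ (univ : Set ℝ)) := uniqueDiffOn_prod_univ I.uniqueDiffOn
  have hF2 := ((hF.fderivWithin_right hs (m := 1) (by norm_cast)
      (sliceDomain_subset W x hq)).differentiableWithinAt (by simp)).hasFDerivWithinAt
  have hm : MapsTo (fun s : ℝ => (extChartAt I x x, s)) univ (range I ×ˢ (univ : Set ℝ)) :=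
    fun z hz => ⟨mem_range_self _, mem_univ _⟩
  have h1 := ((hF2.comp t (hasFDerivAt_prodMk_right _ t).hasFDerivWithinAt hm).clm_apply
    (hasFDerivWithinAt_const ((0 : E), (1 : ℝ)) t univ)).hasFDerivAt Filter.univ_mem
  -- In a fixed chart of `Y` the velocity is the partial derivative `∂_t` of `flowRep` for all
  -- nearby times, so its derivative is the second partial derivative.
  have hev : (fun s => chartDeriv J (𝓔 (x, t)) (𝓔 (x, s)) (modelVelocity J 𝓔 x s)) =ᶠ[𝓝 t]
      fun s => fderivWithin ℝ (flowRep I J 𝓔 x (𝓔 (x, t))) (range I ×ˢ (univ : Set ℝ))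
        (extChartAt I x x, s) (0, 1) := by
    have hc : ContinuousAt (fun s => 𝓔 (x, s)) t :=
      (mdifferentiableAt_curve hW h𝓔 hxt).continuousAt
    have hWt : ∀ᶠ s in 𝓝 t, (x, s) ∈ W :=
      (by fun_prop : ContinuousAt (fun s : ℝ => (x, s)) t).eventually (hW.mem_nhds hxt)
    filter_upwards [hWt, hc.eventually ((isOpen_extChartAt_source _).mem_nhds hy)] with s h1 h2
    exact chartDeriv_velocity hW h𝓔 h1 hx h2
  have h2 := h1.congr_of_eventuallyEq hev
  have hvel : flowDeriv I J 𝓔 x t (0, 1) = modelVelocity J 𝓔 x t := by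
    simp [flowDeriv]
  have h3 : fderiv ℝ (fun s => chartDeriv J (𝓔 (x, t)) (𝓔 (x, s)) (modelVelocity J 𝓔 x s)) t 1
      + christoffel J g (𝓔 (x, t)) (modelVelocity J 𝓔 x t) (modelVelocity J 𝓔 x t) = 0 := by
    rw [← mfderiv_eq_fderiv]
    exact hgeo
  rw [hvel, ← h3, h2.fderiv]
  simp

variable [J.Boundaryless]

theorem differentiableWithinAt_flowCoeff
    (hg : IsSmoothForm J g)
    (hW : IsOpen W) (h𝓔 : ContMDiffOn (I.prod 𝓘(ℝ, ℝ)) J ∞ 𝓔 W) {x : X} {t : ℝ}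
    (hxt : (x, t) ∈ W) :
    DifferentiableWithinAt ℝ (flowCoeff I J g 𝓔 x (𝓔 (x, t))) (range I ×ˢ (univ : Set ℝ))
      (extChartAt I x x, t) := by
  have hq := mem_sliceDomain (mem_extChartAt_source (I := I) x) hxt
  have hF := contDiffWithinAt_flowRep hW h𝓔 (y₀ := 𝓔 (x, t)) hq (by
    simp only [(extChartAt I x).left_inv (mem_extChartAt_source x)]
    exact mem_extChartAt_source _)
  have hs : UniqueDiffOn ℝ (range I ×ˢ (univ : Set ℝ)) := uniqueDiffOn_prod_univ I.uniqueDiffOn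
  have hG : DifferentiableAt ℝ (coordForm J g (𝓔 (x, t)))
      (flowRep I J 𝓔 x (𝓔 (x, t)) (extChartAt I x x, t)) := by
    rw [flowRep_center]
    exact ((contDiffOn_coordForm J hg _).contDiffAt
      (extChartAt_target_mem_nhds _)).differentiableAt (by simp)
  exact differentiableWithinAt_pullForm
    (hG.comp_differentiableWithinAt _ (hF.differentiableWithinAt (by simp)))
    ((hF.fderivWithin_right hs (m := 1) (by norm_cast)
      (sliceDomain_subset W x hq)).differentiableWithinAt (by simp))

theorem hasDerivAt_flowCoeff
    (hg : IsSmoothForm J g)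
    (hW : IsOpen W) (h𝓔 : ContMDiffOn (I.prod 𝓘(ℝ, ℝ)) J ∞ 𝓔 W) {x : X} {t : ℝ}
    (hxt : (x, t) ∈ W) (V V' : E × ℝ) :
    HasDerivAt (fun s => FormField.model J g (𝓔 (x, s)) (flowDeriv I J 𝓔 x s V)
        (flowDeriv I J 𝓔 x s V'))
      (fderivWithin ℝ (flowCoeff I J g 𝓔 x (𝓔 (x, t))) (range I ×ˢ (univ : Set ℝ))
        (extChartAt I x x, t) (0, 1) V V') t := by
  have hx := mem_extChartAt_source (I := I) x
  have hy := mem_extChartAt_source (I := J) (𝓔 (x, t))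
  have hd := (differentiableWithinAt_flowCoeff hg hW h𝓔 hxt).hasFDerivWithinAt
  have hm : MapsTo (fun s : ℝ => (extChartAt I x x, s)) univ (range I ×ˢ (univ : Set ℝ)) :=
    fun z hz => ⟨mem_range_self _, mem_univ _⟩
  have h1 := (((hd.comp t (hasFDerivAt_prodMk_right _ t).hasFDerivWithinAt hm).clm_apply
    (hasFDerivWithinAt_const V t univ)).clm_apply
    (hasFDerivWithinAt_const V' t univ)).hasFDerivAt Filter.univ_mem
  have hev : (fun s => FormField.model J g (𝓔 (x, s)) (flowDeriv I J 𝓔 x s V)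
        (flowDeriv I J 𝓔 x s V')) =ᶠ[𝓝 t]
      fun s => flowCoeff I J g 𝓔 x (𝓔 (x, t)) (extChartAt I x x, s) V V' := by
    have hc : ContinuousAt (fun s => 𝓔 (x, s)) t :=
      (mdifferentiableAt_curve hW h𝓔 hxt).continuousAt
    have hWt : ∀ᶠ s in 𝓝 t, (x, s) ∈ W :=
      (by fun_prop : ContinuousAt (fun s : ℝ => (x, s)) t).eventually (hW.mem_nhds hxt)
    filter_upwards [hWt, hc.eventually ((isOpen_extChartAt_source _).mem_nhds hy)] with s h1 h2
    have h3 := flowCoeff_apply (g := g) hW h𝓔 h1 hx h2 V V'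
    rw [chartDeriv_self] at h3
    exact h3.symm
  refine (h1.congr_of_eventuallyEq hev).hasDerivAt.congr_deriv ?_
  simp

variable [FiniteDimensional ℝ E']

/-- The Christoffel symbols `Γ(∂_t, ∂_t; ·)` of the metric induced by `𝓔` vanish. -/
theorem koszul_flowCoeff
    (hg : IsSmoothForm J g)
    (hpos : ∀ y, PosDefForm (FormField.model J g y))
    (hW : IsOpen W) (h𝓔 : ContMDiffOn (I.prod 𝓘(ℝ, ℝ)) J ∞ 𝓔 W) {x : X} {t : ℝ}
    (hxt : (x, t) ∈ W)
    (hgeo : covDerivAlong 𝓘(ℝ, ℝ) J g (fun s => 𝓔 (x, s)) (velocity J (fun s => 𝓔 (x, s))) t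
      (1 : ℝ) = 0) (V : E × ℝ) :
    koszul (fderivWithin ℝ (flowCoeff I J g 𝓔 x (𝓔 (x, t))) (range I ×ˢ (univ : Set ℝ))
      (extChartAt I x x, t)) (0, 1) (0, 1) V = 0 := by
  have hx := mem_extChartAt_source (I := I) x
  have hq := mem_sliceDomain hx hxt
  have hy := mem_extChartAt_source (I := J) (𝓔 (x, t))
  have hF := contDiffWithinAt_flowRep hW h𝓔 (y₀ := 𝓔 (x, t)) hq (by
    simp only [(extChartAt I x).left_inv hx]
    exact hy)
  have hG : DifferentiableAt ℝ (coordForm J g (𝓔 (x, t)))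
      (flowRep I J 𝓔 x (𝓔 (x, t)) (extChartAt I x x, t)) := by
    rw [flowRep_center]
    exact ((contDiffOn_coordForm J hg _).contDiffAt
      (extChartAt_target_mem_nhds _)).differentiableAt (by simp)
  have h := koszul_induced (uniqueDiffOn_prod_univ I.uniqueDiffOn)
    (prod_univ_subset_closure_interior I.range_subset_closure_interior)
    (sliceDomain_subset W x hq) hF hG (by
      rw [flowRep_center, coordForm_self]
      exact (hpos _).1) (Γ := christoffel J g (𝓔 (x, t))) (by
      rw [flowRep_center]
      exact coordForm_christoffel (hpos _)) (0, 1) (0, 1) V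
  refine h.trans ?_
  rw [flowDeriv_eq_fderivWithin hW h𝓔 hxt, geodesic_flowRep hW h𝓔 hxt hgeo]
  simp

/-- The Gauss lemma: `𝓔^* g = dt² + g_t`. -/
theorem gauss_lemma
    (hg : IsSmoothForm J g)
    (hpos : ∀ y, PosDefForm (FormField.model J g y)) {φ : X → Y}
    {N : (x : X) → TangentSpace J (φ x)} (hN : IsUnitNormal I J g φ N)
    (h𝓔 : IsNormalExp I J g φ N W 𝓔) {x : X} {t : ℝ} (hxt : (x, t) ∈ W) (V V' : E × ℝ) :
    FormField.model J g (𝓔 (x, t)) (flowDeriv I J 𝓔 x t V) (flowDeriv I J 𝓔 x t V')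
      = FormField.model I (sliceMetric I J g 𝓔 t) x V.1 V'.1 + V.2 * V'.2 := by
  have hφ : (fun x => 𝓔 (x, 0)) = φ :=
    funext fun x => congrArg (fun p : TangentBundle J Y => p.1) (h𝓔.initial x)
  let N' : X → E' := fun x => N x
  have hφx : ∀ x, 𝓔 (x, 0) = φ x := fun x => congrFun hφ x
  have hvel : ∀ x, modelVelocity J 𝓔 x 0 = -N' x := fun x =>
    congrArg (fun p : TangentBundle J Y => (show E' from p.2)) (h𝓔.initial x)
  -- The fibre of `W` over `x` is an open interval containing 0, so a function with zero derivative
  -- on it keeps its initial value.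
  have hconst : ∀ {F : ℝ → ℝ} (x : X), (∀ t, (x, t) ∈ W → HasDerivAt F 0 t) →
      ∀ t, (x, t) ∈ W → F t = F 0 := by
    intro F x hF t ht
    have ho : IsOpen {t : ℝ | (x, t) ∈ W} := h𝓔.isOpen.preimage (by fun_prop)
    exact ho.is_const_of_deriv_eq_zero (h𝓔.ordConnected x).isPreconnected
      (fun s hs => (hF s hs).differentiableAt.differentiableWithinAt)
      (fun s hs => (hF s hs).deriv) ht (h𝓔.zero_mem x)
  -- With all three arguments equal to `∂_t` the Koszul expression is half the derivative of
  -- `|∂_t|²`. The initial value is `|-N|² = 1`.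
  have hvv : ∀ x t, (x, t) ∈ W →
      FormField.model J g (𝓔 (x, t)) (flowDeriv I J 𝓔 x t (0, 1)) (flowDeriv I J 𝓔 x t (0, 1))
        = 1 := by
    intro x t hxt
    rw [hconst (F := fun t => FormField.model J g (𝓔 (x, t)) (flowDeriv I J 𝓔 x t (0, 1))
      (flowDeriv I J 𝓔 x t (0, 1))) x (fun t ht => ?_) t hxt]
    · have h1 : FormField.model J g (φ x) (N' x) (N' x) = 1 := hN.unit x
      simp only [flowDeriv, map_zero, one_smul, zero_add, hvel, hφx, map_neg, neg_apply, neg_neg,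
        h1]
    · have h1 := hasDerivAt_flowCoeff hg h𝓔.isOpen h𝓔.smooth ht (0, 1) (0, 1)
      have h2 := koszul_flowCoeff hg hpos h𝓔.isOpen h𝓔.smooth ht (h𝓔.geodesic x t ht) (0, 1)
      rw [koszul] at h2
      rwa [show fderivWithin ℝ (flowCoeff I J g 𝓔 x (𝓔 (x, t))) (range I ×ˢ (univ : Set ℝ))
        (extChartAt I x x, t) (0, 1) (0, 1) (0, 1) = 0 by linarith] at h1
  -- Here the vanishing Koszul expression is `∂_t⟨∂_t, v⟩ - ½ ∂_v |∂_t|²`. The last term is zero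
  -- because `hvv` holds at all neighbouring points, and the initial value vanishes because `N` is
  -- normal.
  have hvs : ∀ x t, (x, t) ∈ W → ∀ v,
      FormField.model J g (𝓔 (x, t)) (flowDeriv I J 𝓔 x t (0, 1)) (flowDeriv I J 𝓔 x t (v, 0))
        = 0 := by
    intro x t hxt v
    rw [hconst (F := fun t => FormField.model J g (𝓔 (x, t)) (flowDeriv I J 𝓔 x t (0, 1))
      (flowDeriv I J 𝓔 x t (v, 0))) x (fun t ht => ?_) t hxt]
    · have h1 : FormField.model J g (φ x) (N' x) (modelDeriv I J φ x v) = 0 := hN.normal x v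
      simp only [flowDeriv, map_zero, one_smul, zero_add, hvel, zero_smul, add_zero, hφx,
        map_neg, neg_apply, h1, neg_zero]
    · have h1 := hasDerivAt_flowCoeff hg h𝓔.isOpen h𝓔.smooth ht (0, 1) (v, 0)
      have h2 := koszul_flowCoeff hg hpos h𝓔.isOpen h𝓔.smooth ht (h𝓔.geodesic x t ht) (v, 0)
      have hx := mem_extChartAt_source (I := I) x
      have hy := mem_extChartAt_source (I := J) (𝓔 (x, t))
      have hq := mem_sliceDomain hx ht
      have hqs := sliceDomain_subset W x hq
      have h3 : fderivWithin ℝ (flowCoeff I J g 𝓔 x (𝓔 (x, t))) (range I ×ˢ (univ : Set ℝ))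
          (extChartAt I x x, t) (v, 0) (0, 1) (0, 1) = 0 := by
        rw [← fderivWithin_apply₂ (uniqueDiffOn_prod_univ I.uniqueDiffOn _ hqs)
          (differentiableWithinAt_flowCoeff hg h𝓔.isOpen h𝓔.smooth ht)]
        have hev : (fun q => flowCoeff I J g 𝓔 x (𝓔 (x, t)) q (0, 1) (0, 1))
            =ᶠ[𝓝[range I ×ˢ (univ : Set ℝ)] (extChartAt I x x, t)] fun _ => 1 := by
          filter_upwards [eventually_sliceDomain h𝓔.isOpen hq,
            eventually_flow_mem h𝓔.isOpen h𝓔.smooth.continuousOn (J := J) (y₀ := 𝓔 (x, t)) hq (by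
              simp only [(extChartAt I x).left_inv hx]
              exact hy)] with q h4 h5
          have h6 := flowCoeff_apply (g := g) h𝓔.isOpen h𝓔.smooth h4.2
            ((extChartAt I x).map_target h4.1) h5 (0, 1) (0, 1)
          rw [(extChartAt I x).right_inv h4.1, hvv _ _ h4.2, map_zero] at h6
          exact h6
        rw [hev.fderivWithin_eq (hev.self_of_nhdsWithin hqs)]
        simp
      rw [koszul] at h2
      rwa [show fderivWithin ℝ (flowCoeff I J g 𝓔 x (𝓔 (x, t))) (range I ×ˢ (univ : Set ℝ))
        (extChartAt I x x, t) (0, 1) (0, 1) (v, 0) = 0 by linarith] at h1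
  have hsplit : ∀ V : E × ℝ, flowDeriv I J 𝓔 x t V
      = flowDeriv I J 𝓔 x t (V.1, 0) + V.2 • flowDeriv I J 𝓔 x t (0, 1) := fun V => by
    simp [flowDeriv]
  have hslice : FormField.model J g (𝓔 (x, t)) (flowDeriv I J 𝓔 x t (V.1, 0))
      (flowDeriv I J 𝓔 x t (V'.1, 0)) = FormField.model I (sliceMetric I J g 𝓔 t) x V.1 V'.1 := by
    simp only [flowDeriv, zero_smul, add_zero]
    rfl
  rw [hsplit V, hsplit V', ← hslice]
  simp only [map_add, map_smul, add_apply, smul_apply, smul_eq_mul, hvv x t hxt, hvs x t hxt,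
    (hpos _).1 (flowDeriv I J 𝓔 x t (V.1, 0)) (flowDeriv I J 𝓔 x t (0, 1))]
  ring

end Gauss

/-! ### The curvature of graphs -/

section Graph

open Topology

variable {E : Type*} [NormedAddCommGroup E] [NormedSpace ℝ E]
  {H : Type*} [TopologicalSpace H] {I : ModelWithCorners ℝ E H}
  {X : Type*} [TopologicalSpace X] [ChartedSpace H X]
  {E' : Type*} [NormedAddCommGroup E'] [NormedSpace ℝ E']
  {H' : Type*} [TopologicalSpace H'] {J : ModelWithCorners ℝ E' H'}
  {Y : Type*} [TopologicalSpace Y] [ChartedSpace H' Y]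
  {W : Set (X × ℝ)} {𝓔 : X × ℝ → Y} {g : FormField J (X := Y)}

variable (I J) in
/-- The zeroth order term of the second fundamental form of graphs, in the chart centred at `x₀`,
as a function of `(x, t, p)`. -/
def graphTensor (g : FormField J (X := Y)) (𝓔 : X × ℝ → Y) (x₀ : X) (r : E × ℝ × E) :
    E →L[ℝ] E →L[ℝ] ℝ :=
  let Q := sliceCoeff I J g 𝓔 x₀
  let DQ := fderivWithin ℝ Q (range I ×ˢ (univ : Set ℝ))
  graphForm (Q (r.1, 0)) (Q (r.1, r.2.1)) (DQ (r.1, 0) ∘L ContinuousLinearMap.inl ℝ E ℝ)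
    (DQ (r.1, r.2.1) ∘L ContinuousLinearMap.inl ℝ E ℝ) (DQ (r.1, r.2.1) (0, 1)) r.2.2

variable (I J) in
/-- The factor in the Gaussian curvature of graphs, in the chart centred at `x₀`,
as a function of `(x, t, p)`. -/
def graphScale (g : FormField J (X := Y)) (𝓔 : X × ℝ → Y) (x₀ : X) (r : E × ℝ × E) : ℝ :=
  graphFactor (sliceCoeff I J g 𝓔 x₀ (r.1, 0)) (sliceCoeff I J g 𝓔 x₀ (r.1, r.2.1)) r.2.2

theorem modelDeriv_eq_fderivWithin [IsManifold I 1 X] {A : X → E'} {x : X}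
    (hA : MDifferentiableAt I 𝓘(ℝ, E') A x) :
    modelDeriv I 𝓘(ℝ, E') A x
      = fderivWithin ℝ (A ∘ (extChartAt I x).symm) (range I) (extChartAt I x x) := by
  ext v
  have h := (fderivWithin_comp_chart I (mem_extChartAt_source x) hA).2 (chartDeriv I x x v)
  rw [chartDerivSymm_chartDeriv I (mem_extChartAt_source x), chartDeriv_self] at h
  exact h.symm

theorem modelDeriv_eq_fderivWithin_inCharts [IsManifold I 1 X] [IsManifold J 1 Y] {φ : X → Y}
    {x : X} (hφ : MDifferentiableAt I J φ x) :
    modelDeriv I J φ x = fderivWithin ℝ (extChartAt J (φ x) ∘ φ ∘ (extChartAt I x).symm) (range I)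
      (extChartAt I x x) := by
  ext v
  have h := fderivWithin_inCharts_chartDeriv I J (mem_extChartAt_source x)
    (mem_extChartAt_source (I := J) (φ x)) hφ v
  rw [chartDeriv_self, chartDeriv_self] at h
  exact h.symm

/-- The derivative of a graph. -/
theorem modelDeriv_graph (hW : IsOpen W)
    (h𝓔 : ContMDiffOn (I.prod 𝓘(ℝ, ℝ)) J ∞ 𝓔 W) {f : X → ℝ} {x : X}
    (hf : MDifferentiableAt I 𝓘(ℝ, ℝ) f x) (hx : (x, f x) ∈ W) (v : E) :
    modelDeriv I J (graph 𝓔 f) x v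
      = flowDeriv I J 𝓔 x (f x) (v, modelDeriv I 𝓘(ℝ, ℝ) f x v) := by
  have hd : MDifferentiableAt (I.prod 𝓘(ℝ, ℝ)) J 𝓔 (x, f x) :=
    (h𝓔.contMDiffAt (hW.mem_nhds hx)).mdifferentiableAt (by simp)
  have h1 : modelDeriv I J (graph 𝓔 f) x
      = (modelDeriv (I.prod 𝓘(ℝ, ℝ)) J 𝓔 (x, f x)) ∘L
        modelDeriv I (I.prod 𝓘(ℝ, ℝ)) (fun x => (x, f x)) x :=
    mfderiv_comp x hd (mdifferentiableAt_id.prodMk hf)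
  have h2 : modelDeriv I (I.prod 𝓘(ℝ, ℝ)) (fun x => (x, f x)) x
      = (modelDeriv I I id x).prod (modelDeriv I 𝓘(ℝ, ℝ) f x) :=
    mfderiv_prodMk mdifferentiableAt_id hf
  rw [h1, h2, flowDeriv_eq_mfderiv hW h𝓔 hx, modelDeriv_id]
  rfl

theorem contMDiff_graph (hW : IsOpen W)
    (h𝓔 : ContMDiffOn (I.prod 𝓘(ℝ, ℝ)) J ∞ 𝓔 W) {f : X → ℝ}
    (hf : ContMDiff I 𝓘(ℝ, ℝ) ∞ f) (hx : ∀ x, (x, f x) ∈ W) :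
    ContMDiff I J ∞ (graph 𝓔 f) := fun x =>
  (h𝓔.contMDiffAt (hW.mem_nhds (hx x))).comp x (contMDiffAt_id.prodMk (hf x))

theorem flowDeriv_injective (hW : IsOpen W)
    (h𝓔 : ContMDiffOn (I.prod 𝓘(ℝ, ℝ)) J ∞ 𝓔 W)
    (hinj : ∀ q ∈ W, Function.Injective (mfderiv (I.prod 𝓘(ℝ, ℝ)) J 𝓔 q)) {x : X} {t : ℝ}
    (hxt : (x, t) ∈ W) : Function.Injective (flowDeriv I J 𝓔 x t) := by
  rw [funext (flowDeriv_eq_mfderiv hW h𝓔 hxt)]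
  exact hinj _ hxt

/-- By equality of dimensions an injective derivative is onto, so every ambient vector, in
particular the unit normal of a graph, has Fermi coordinates. -/
theorem flowDeriv_surjective [FiniteDimensional ℝ E] [FiniteDimensional ℝ E']
    (hdim : Module.finrank ℝ E' = Module.finrank ℝ E + 1) (hW : IsOpen W)
    (h𝓔 : ContMDiffOn (I.prod 𝓘(ℝ, ℝ)) J ∞ 𝓔 W)
    (hinj : ∀ q ∈ W, Function.Injective (mfderiv (I.prod 𝓘(ℝ, ℝ)) J 𝓔 q)) {x : X} {t : ℝ}
    (hxt : (x, t) ∈ W) : Function.Surjective (flowDeriv I J 𝓔 x t) := by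
  have h := flowDeriv_injective hW h𝓔 hinj hxt
  rw [funext (flowDeriv_eq_mfderiv hW h𝓔 hxt)] at h ⊢
  exact (LinearMap.injective_iff_surjective_of_finrank_eq_finrank
    (f := (modelDeriv (I.prod 𝓘(ℝ, ℝ)) J 𝓔 (x, t) : E × ℝ →ₗ[ℝ] E')) (by simp [hdim])).1 h

theorem posDefForm_sliceMetric (hpos : ∀ y, PosDefForm (FormField.model J g y)) (hW : IsOpen W)
    (h𝓔 : ContMDiffOn (I.prod 𝓘(ℝ, ℝ)) J ∞ 𝓔 W)
    (hinj : ∀ q ∈ W, Function.Injective (mfderiv (I.prod 𝓘(ℝ, ℝ)) J 𝓔 q)) {x : X} {t : ℝ}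
    (hxt : (x, t) ∈ W) : PosDefForm (FormField.model I (sliceMetric I J g 𝓔 t) x) := by
  refine (hpos (𝓔 (x, t))).pullForm (L := modelDeriv I J (fun x => 𝓔 (x, t)) x) fun v w hvw => ?_
  have h : flowDeriv I J 𝓔 x t (v, 0) = flowDeriv I J 𝓔 x t (w, 0) := by
    simp [flowDeriv, hvw]
  exact congrArg Prod.fst (flowDeriv_injective hW h𝓔 hinj hxt h)

theorem posDefForm_sliceCoeff [IsManifold I 1 X] (hpos : ∀ y, PosDefForm (FormField.model J g y))
    (hW : IsOpen W) (h𝓔 : ContMDiffOn (I.prod 𝓘(ℝ, ℝ)) J ∞ 𝓔 W)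
    (hinj : ∀ q ∈ W, Function.Injective (mfderiv (I.prod 𝓘(ℝ, ℝ)) J 𝓔 q)) {x₀ : X} {q : E × ℝ}
    (hq : q ∈ sliceDomain I W x₀) : PosDefForm (sliceCoeff I J g 𝓔 x₀ q) := by
  rw [sliceCoeff, coordForm_eq]
  refine (posDefForm_sliceMetric hpos hW h𝓔 hinj hq.2).pullForm ?_
  exact (show Function.LeftInverse (chartDeriv I x₀ ((extChartAt I x₀).symm q.1)) _ from
    chartDeriv_chartDerivSymm I hq.1).injective

/-- The coordinates of the vector field `ν` along `φ`. -/
theorem mdifferentiableAt_chartDeriv_comp [IsManifold J ∞ Y] {φ : X → Y} {ν : X → E'} {x : X}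
    (hν : ContMDiff I J.tangent ∞ (fun x => (⟨φ x, ν x⟩ : TangentBundle J Y))) :
    MDifferentiableAt I 𝓘(ℝ, E') (fun x' => chartDeriv J (φ x) (φ x') (ν x')) x := by
  obtain ⟨h1, h2⟩ := contMDiffAt_totalSpace.1 (hν x)
  refine (h2.mdifferentiableAt (by simp)).congr_of_eventuallyEq ?_
  have hev : ∀ᶠ x' in 𝓝 x, φ x' ∈ (extChartAt J (φ x)).source :=
    h1.continuousAt.eventually ((isOpen_extChartAt_source (φ x)).mem_nhds
      (mem_extChartAt_source (φ x)))
  filter_upwards [hev] with x' hx'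
  exact (trivializationAt_tangent J hx' (ν x')).symm

theorem secondForm_apply [IsManifold I ∞ X] [IsManifold J ∞ Y] {φ : X → Y} {ν : X → E'} {x : X}
    (hφ : MDifferentiableAt I J φ x)
    (hν : ContMDiff I J.tangent ∞ (fun x => (⟨φ x, ν x⟩ : TangentBundle J Y))) (v w : E) :
    secondForm I J g φ ν x v w
      = FormField.model J g (φ x) (fderivWithin ℝ ((fun x' => chartDeriv J (φ x) (φ x') (ν x'))
          ∘ (extChartAt I x).symm) (range I) (extChartAt I x x) v
        + christoffel J g (φ x) (fderivWithin ℝ (extChartAt J (φ x) ∘ φ ∘ (extChartAt I x).symm)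
          (range I) (extChartAt I x x) v) (ν x))
        (fderivWithin ℝ (extChartAt J (φ x) ∘ φ ∘ (extChartAt I x).symm)
          (range I) (extChartAt I x x) w) := by
  rw [← modelDeriv_eq_fderivWithin (mdifferentiableAt_chartDeriv_comp hν),
    ← modelDeriv_eq_fderivWithin_inCharts hφ]
  rfl

end Graph

/-! ### The unit normal and second fundamental form of a graph -/

section GraphCurvature

open Topology

/-- The coordinates of the downward unit normal of a graph in Fermi coordinates. -/
theorem normal_coordinates {E : Type*} [NormedAddCommGroup E] [NormedSpace ℝ E]
    [FiniteDimensional ℝ E] {B : E →L[ℝ] E →L[ℝ] ℝ} (hB : PosDefForm B) {ℓ : E →L[ℝ] ℝ} {u : E}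
    {β : ℝ} (hnormal : ∀ w, B u w + β * ℓ w = 0) (hunit : B u u + β * β = 1) (hβ : β < 0) :
    (u, β) = (√(1 + ℓ (B.inverse ℓ)))⁻¹ • (B.inverse ℓ, (-1 : ℝ)) := by
  have hu : u = (-β) • B.inverse ℓ := by
    rw [← map_smul]
    refine hB.eq_inverse fun w => ?_
    have := hnormal w
    rw [smul_apply, smul_eq_mul]
    linarith
  have hq : 0 ≤ ℓ (B.inverse ℓ) := by
    have := hB.nonneg (B.inverse ℓ)
    rwa [hB.apply_inverse] at this
  -- Orthogonality tested on `u` itself gives `B(u, u) = -β ℓ(u) = β² ℓ(B⁻¹ℓ)`, which is inserted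
  -- into the unit length. The sign of `β` then selects the root.
  have h1 : β * β * (1 + ℓ (B.inverse ℓ)) = 1 := by
    have h2 := hnormal u
    have h3 : ℓ u = -β * ℓ (B.inverse ℓ) := by
      conv_lhs => rw [hu]
      rw [map_smul, smul_eq_mul]
    rw [h3] at h2
    linarith
  have h2 : (√(1 + ℓ (B.inverse ℓ)))⁻¹ = -β := by
    have h3 : 1 + ℓ (B.inverse ℓ) = ((-β)⁻¹) ^ 2 := by
      rw [inv_pow, neg_sq, sq]
      exact eq_inv_of_mul_eq_one_left (by linarith)
    rw [h3, Real.sqrt_sq (by rw [inv_nonneg]; linarith), inv_inv]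
  rw [h2, Prod.smul_mk, ← hu]
  simp

variable {E : Type*} [NormedAddCommGroup E] [NormedSpace ℝ E]
  {H : Type*} [TopologicalSpace H] {I : ModelWithCorners ℝ E H}
  {X : Type*} [TopologicalSpace X] [ChartedSpace H X]
  {E' : Type*} [NormedAddCommGroup E'] [NormedSpace ℝ E']
  {H' : Type*} [TopologicalSpace H'] {J : ModelWithCorners ℝ E' H'}
  {Y : Type*} [TopologicalSpace Y] [ChartedSpace H' Y]
  {W : Set (X × ℝ)} {𝓔 : X × ℝ → Y} {g : FormField J (X := Y)}

theorem apply_gradient [FiniteDimensional ℝ E] {h : FormField I (X := X)} {x : X}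
    (hh : PosDefForm (FormField.model I h x)) (f : X → ℝ) :
    FormField.model I h x (gradient I h f x) = modelDeriv I 𝓘(ℝ, ℝ) f x :=
  hh.apply_inverse (modelDeriv I 𝓘(ℝ, ℝ) f x)

/-- Raising an index is self-adjoint, so `df(Γ(v, w))` equals the symbol of the first kind `Γ(v, w;
∇f)`. Only first-kind symbols then occur in the comparison of `g_0` and `g_t`. -/
theorem hessian_apply [FiniteDimensional ℝ E] {h : FormField I (X := X)} {x : X}
    (hh : PosDefForm (FormField.model I h x)) (f : X → ℝ) (v w : E) :
    hessian I h f x v w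
      = fderivWithin ℝ (fderivWithin ℝ (f ∘ (extChartAt I x).symm) (range I)) (range I)
          (extChartAt I x x) v w - koszul (dCoord I h x) v w (gradient I h f x) := by
  have h1 : hessian I h f x v w
      = fderivWithin ℝ (fderivWithin ℝ (f ∘ (extChartAt I x).symm) (range I)) (range I)
          (extChartAt I x x) v w
        - modelDeriv I 𝓘(ℝ, ℝ) f x
          ((FormField.model I h x).inverse (christoffelFirst I h x v w)) := rfl
  rw [h1, hh.inverse_symm]
  have h2 : christoffelFirst I h x v w
      ((FormField.model I h x).inverse (modelDeriv I 𝓘(ℝ, ℝ) f x))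
      = koszul (dCoord I h x) v w (gradient I h f x) := christoffelFirst_apply I h x v w _
  rw [h2]

variable [IsManifold I ∞ X] [IsManifold J ∞ Y] [J.Boundaryless]

theorem dCoord_sliceMetric
    (hg : IsSmoothForm J g)
    (hW : IsOpen W) (h𝓔 : ContMDiffOn (I.prod 𝓘(ℝ, ℝ)) J ∞ 𝓔 W) {x : X} {t : ℝ}
    (hxt : (x, t) ∈ W) :
    dCoord I (sliceMetric I J g 𝓔 t) x
      = fderivWithin ℝ (sliceCoeff I J g 𝓔 x) (range I ×ˢ (univ : Set ℝ)) (extChartAt I x x, t)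
        ∘L ContinuousLinearMap.inl ℝ E ℝ := by
  have hq := mem_sliceDomain (mem_extChartAt_source (I := I) x) hxt
  have hQ := ((contDiffWithinAt_sliceCoeff hg hW h𝓔 hq).differentiableWithinAt
    (by simp)).hasFDerivWithinAt
  have hm : MapsTo (fun z : E => (z, t)) (range I) (range I ×ˢ (univ : Set ℝ)) :=
    fun z hz => ⟨hz, mem_univ _⟩
  exact (hQ.comp (extChartAt I x x) (hasFDerivAt_prodMk_left _ t).hasFDerivWithinAt
    hm).fderivWithin (I.uniqueDiffOn _ (mem_range_self _))

variable [FiniteDimensional ℝ E] [FiniteDimensional ℝ E']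

/-- The downward unit normal of a graph. -/
theorem normal_eq_flowDeriv (hdim : Module.finrank ℝ E' = Module.finrank ℝ E + 1)
    (hg : IsSmoothForm J g)
    (hpos : ∀ y, PosDefForm (FormField.model J g y)) {φ : X → Y}
    {N : (x : X) → TangentSpace J (φ x)} (hN : IsUnitNormal I J g φ N)
    (h𝓔 : IsNormalExp I J g φ N W 𝓔) {f : X → ℝ} {x : X}
    (hf : MDifferentiableAt I 𝓘(ℝ, ℝ) f x) (hx : (x, f x) ∈ W) {ν : E'}
    (hunit : FormField.model J g (𝓔 (x, f x)) ν ν = 1)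
    (hnormal : ∀ v, FormField.model J g (𝓔 (x, f x)) ν (modelDeriv I J (graph 𝓔 f) x v) = 0)
    (hdown : FormField.model J g (𝓔 (x, f x)) ν (modelVelocity J 𝓔 x (f x)) < 0) :
    ν = flowDeriv I J 𝓔 x (f x)
      ((√(1 + modelDeriv I 𝓘(ℝ, ℝ) f x ((FormField.model I (sliceMetric I J g 𝓔 (f x)) x).inverse
          (modelDeriv I 𝓘(ℝ, ℝ) f x))))⁻¹ •
        ((FormField.model I (sliceMetric I J g 𝓔 (f x)) x).inverse (modelDeriv I 𝓘(ℝ, ℝ) f x),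
          (-1 : ℝ))) := by
  obtain ⟨⟨u, β⟩, rfl⟩ :=
    flowDeriv_surjective hdim h𝓔.isOpen h𝓔.smooth h𝓔.immersive hx ν
  have hvel : modelVelocity J 𝓔 x (f x) = flowDeriv I J 𝓔 x (f x) (0, 1) := by simp [flowDeriv]
  simp only [modelDeriv_graph h𝓔.isOpen h𝓔.smooth hf hx, hvel,
    gauss_lemma hg hpos hN h𝓔 hx] at hunit hnormal hdown
  congr 1
  refine normal_coordinates
    (posDefForm_sliceMetric hpos h𝓔.isOpen h𝓔.smooth h𝓔.immersive hx) hnormal hunit ?_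
  simpa using hdown

/-- The second fundamental form of a graph. -/
theorem secondForm_graph (hdim : Module.finrank ℝ E' = Module.finrank ℝ E + 1)
    (hg : IsSmoothForm J g)
    (hpos : ∀ y, PosDefForm (FormField.model J g y)) {φ : X → Y}
    {N : (x : X) → TangentSpace J (φ x)} (hN : IsUnitNormal I J g φ N)
    (h𝓔 : IsNormalExp I J g φ N W 𝓔) {f : X → ℝ}
    (hf : ContMDiff I 𝓘(ℝ, ℝ) ∞ f) (hx : ∀ x, (x, f x) ∈ W) {ν : X → E'}
    (hν : IsDownwardNormal I J g 𝓔 f ν) (x : X) (v w : E) :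
    secondForm I J g (graph 𝓔 f) ν x v w
      = (√(1 + modelDeriv I 𝓘(ℝ, ℝ) f x
          ((FormField.model I (sliceMetric I J g 𝓔 (f x)) x).inverse
            (modelDeriv I 𝓘(ℝ, ℝ) f x))))⁻¹ *
        (hessian I (sliceMetric I J g 𝓔 0) f x v w
          + graphTensor I J g 𝓔 x (extChartAt I x x, f x,
              gradient I (sliceMetric I J g 𝓔 0) f x) v w) := by
  have hW := h𝓔.isOpen
  have hs := h𝓔.smooth
  have hsrc := mem_extChartAt_source (I := I) x
  have hinv := (extChartAt I x).left_inv hsrc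
  have hfd : ∀ x, MDifferentiableAt I 𝓘(ℝ, ℝ) f x := fun x => (hf x).mdifferentiableAt (by simp)
  have hφd : ∀ x, MDifferentiableAt I J (graph 𝓔 f) x := fun x =>
    (contMDiff_graph hW hs hf hx x).mdifferentiableAt (by simp)
  have hxt := hx x
  have hq := mem_sliceDomain hsrc hxt
  have hq0 := mem_sliceDomain hsrc (h𝓔.zero_mem x)
  have hy : 𝓔 ((extChartAt I x).symm (extChartAt I x x, f x).1, f x)
      ∈ (extChartAt J (𝓔 (x, f x))).source := by
    simp only [hinv]
    exact mem_extChartAt_source _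
  set a := extChartAt I x x with ha
  set fh : E → ℝ := f ∘ (extChartAt I x).symm with hfh
  have hfa : fh a = f x := by simp only [hfh, Function.comp_apply, hinv]
  have hfh_smooth : ContDiffWithinAt ℝ ∞ fh (range I) a := by
    have h1 : ContMDiffWithinAt 𝓘(ℝ, E) 𝓘(ℝ, ℝ) ∞ fh (range I) a :=
      (hf _).comp_contMDiffWithinAt a (contMDiffWithinAt_extChartAt_symm_range x
        ((extChartAt I x).map_source hsrc))
    exact h1.contDiffWithinAt
  have hdf : modelDeriv I 𝓘(ℝ, ℝ) f x = fderivWithin ℝ fh (range I) a :=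
    modelDeriv_eq_fderivWithin (hfd x)
  have hF := contDiffWithinAt_flowRep hW hs hq hy
  have hcenter := flowRep_center (I := I) (J := J) (𝓔 := 𝓔) x (f x)
  have hG : ContDiffAt ℝ ∞ (coordForm J g (𝓔 (x, f x)))
      (extChartAt J (𝓔 (x, f x)) (𝓔 (x, f x))) :=
    (contDiffOn_coordForm J hg _).contDiffAt (extChartAt_target_mem_nhds _)
  have hGs : ∀ᶠ y in 𝓝 (extChartAt J (𝓔 (x, f x)) (𝓔 (x, f x))), ∀ v w,
      coordForm J g (𝓔 (x, f x)) y v w = coordForm J g (𝓔 (x, f x)) y w v :=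
    Filter.Eventually.of_forall fun y v w => (hpos _).1 _ _
  have hQ := (contDiffWithinAt_sliceCoeff hg hW hs hq).differentiableWithinAt (n := ∞) (by simp)
  have hfermi : ∀ᶠ q in 𝓝[range I ×ˢ (univ : Set ℝ)] (a, f x), ∀ V V' : E × ℝ,
      coordForm J g (𝓔 (x, f x)) (flowRep I J 𝓔 x (𝓔 (x, f x)) q)
        (fderivWithin ℝ (flowRep I J 𝓔 x (𝓔 (x, f x))) (range I ×ˢ (univ : Set ℝ)) q V)
        (fderivWithin ℝ (flowRep I J 𝓔 x (𝓔 (x, f x))) (range I ×ˢ (univ : Set ℝ)) q V')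
      = sliceCoeff I J g 𝓔 x q V.1 V'.1 + V.2 * V'.2 := by
    filter_upwards [eventually_sliceDomain hW hq,
      eventually_flow_mem hW hs.continuousOn hq hy] with q h4 h5 V V'
    have h4' := (extChartAt I x).map_target h4.1
    have h6 := flowCoeff_apply (g := g) hW hs h4.2 h4' h5
      (chartDerivSymm I x q.1 V.1, V.2) (chartDerivSymm I x q.1 V'.1, V'.2)
    rw [gauss_lemma hg hpos hN h𝓔 h4.2] at h6
    simp only [chartDeriv_chartDerivSymm I h4.1, (extChartAt I x).right_inv h4.1] at h6
    exact h6
  have hNd : DifferentiableWithinAt ℝ ((fun x' => chartDeriv J (graph 𝓔 f x) (graph 𝓔 f x') (ν x'))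
      ∘ (extChartAt I x).symm) (range I) a :=
    (fderivWithin_comp_chart I hsrc (mdifferentiableAt_chartDeriv_comp hν.smooth)).1
  have hNormal : ∀ᶠ z in 𝓝[range I] a, ∀ w,
      coordForm J g (𝓔 (x, f x)) (flowRep I J 𝓔 x (𝓔 (x, f x)) (z, fh z))
        (((fun x' => chartDeriv J (graph 𝓔 f x) (graph 𝓔 f x') (ν x'))
          ∘ (extChartAt I x).symm) z)
        (fderivWithin ℝ (fun z => flowRep I J 𝓔 x (𝓔 (x, f x)) (z, fh z)) (range I) z w) = 0 := by
    have hc : ContinuousWithinAt (fun z => graph 𝓔 f ((extChartAt I x).symm z)) (range I) a := by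
      refine ContinuousAt.comp_continuousWithinAt (g := graph 𝓔 f) ?_
        (continuousAt_extChartAt_symm x).continuousWithinAt
      exact (contMDiff_graph hW hs hf hx).continuous.continuousAt
    have hmem : graph 𝓔 f ((extChartAt I x).symm a) ∈ (extChartAt J (graph 𝓔 f x)).source := by
      rw [hinv]
      exact mem_extChartAt_source _
    filter_upwards [extChartAt_target_mem_nhdsWithin x, hc.eventually
      ((isOpen_extChartAt_source _).mem_nhds hmem)] with z h1 h2 w
    have h3 := fderivWithin_inCharts I J (φ := graph 𝓔 f) ((extChartAt I x).map_target h1) h2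
      (hφd _) w
    rw [(extChartAt I x).right_inv h1] at h3
    have h4 := coordForm_chartDeriv J g h2 (ν ((extChartAt I x).symm z))
      (modelDeriv I J (graph 𝓔 f) ((extChartAt I x).symm z) (chartDerivSymm I x z w))
    rw [← h3] at h4
    exact h4.trans (hν.normal _ _)
  have hNa : ((fun x' => chartDeriv J (graph 𝓔 f x) (graph 𝓔 f x') (ν x'))
      ∘ (extChartAt I x).symm) a = ν x := by
    simp only [Function.comp_apply, hinv, chartDeriv_self]
    rfl
  have hνx := normal_eq_flowDeriv hdim hg hpos hN h𝓔 (hfd x) hxt (hν.unit x) (hν.normal x)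
    (hν.downward x)
  rw [← flowDeriv_eq_fderivWithin hW hs hxt, ← hNa] at hνx
  have hB := posDefForm_sliceMetric hpos hW hs h𝓔.immersive hxt
  have hB₀ := posDefForm_sliceMetric hpos hW hs h𝓔.immersive (h𝓔.zero_mem x)
  -- The computation takes place in the charts centred at `x` and at `𝓔(x, f x)`. In it `p` is the
  -- `g_t`-gradient of `f` and `α` is the reciprocal square root that normalises the normal.
  have key := secondForm_fermi I.uniqueDiffOn I.range_subset_closure_interior (a := a)
    (ha := mem_range_self _)
    (F := flowRep I J 𝓔 x (𝓔 (x, f x))) (f := fh) (G := coordForm J g (𝓔 (x, f x)))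
    (Q := sliceCoeff I J g 𝓔 x) hfh_smooth (by rwa [hfa]) (by rwa [hfa, hcenter])
    (by rwa [hfa, hcenter]) (Γ := christoffel J g (𝓔 (x, f x)))
    (by rw [hfa, hcenter]; exact coordForm_christoffel (hpos _)) (by rwa [hfa])
    (by rwa [hfa]) hNd hNormal (by rw [hfa]; exact hνx) v w
  rw [hfa, hcenter, coordForm_self, hNa] at key
  have hA := secondForm_apply (g := g) (hφd x) hν.smooth v w
  refine hA.trans (key.trans ?_)
  congr 1
  -- The symbols of `g_0` are subtracted in the Hessian and added back in `graphTensor`. The shifted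
  -- `g_0`-gradient is the `g_t`-gradient (`e2`), because both are obtained by raising `df` with
  -- `g_t`.
  rw [hessian_apply hB₀, graphTensor, graphForm_apply, dCoord_sliceMetric hg hW hs (h𝓔.zero_mem x)]
  have e0 : sliceCoeff I J g 𝓔 x (a, 0) = FormField.model I (sliceMetric I J g 𝓔 0) x :=
    coordForm_self I _ x
  have e1 : sliceCoeff I J g 𝓔 x (a, f x) = FormField.model I (sliceMetric I J g 𝓔 (f x)) x :=
    coordForm_self I _ x
  have e2 : shift (sliceCoeff I J g 𝓔 x (a, 0)) (sliceCoeff I J g 𝓔 x (a, f x))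
      (gradient I (sliceMetric I J g 𝓔 0) f x)
      = (FormField.model I (sliceMetric I J g 𝓔 (f x)) x).inverse
        (modelDeriv I 𝓘(ℝ, ℝ) f x) := by
    rw [← apply_gradient hB₀, e0, e1]
    rfl
  dsimp only
  rw [e2, e0, apply_gradient hB₀, ← hdf]
  ring

end GraphCurvature

/-! ### The change of charts for the graph tensor -/

section ChartChange

open Topology

variable {E : Type*} [NormedAddCommGroup E] [NormedSpace ℝ E]
  {H : Type*} [TopologicalSpace H] {I : ModelWithCorners ℝ E H}
  {X : Type*} [TopologicalSpace X] [ChartedSpace H X] [IsManifold I ∞ X]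
  {E' : Type*} [NormedAddCommGroup E'] [NormedSpace ℝ E']
  {H' : Type*} [TopologicalSpace H'] {J : ModelWithCorners ℝ E' H'}
  {Y : Type*} [TopologicalSpace Y] [ChartedSpace H' Y] 
  {W : Set (X × ℝ)} {𝓔 : X × ℝ → Y} {g : FormField J (X := Y)}

theorem sliceCoeff_change (g : FormField J (X := Y)) (𝓔 : X × ℝ → Y) {x₀ x : X}
    (hx : x ∈ (extChartAt I x₀).source) (t : ℝ) :
    sliceCoeff I J g 𝓔 x (extChartAt I x x, t)
      = pullForm (sliceCoeff I J g 𝓔 x₀ (extChartAt I x₀ x, t)) (chartDeriv I x₀ x) := by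
  have h := coordForm_change I (sliceMetric I J g 𝓔 t) (x₀ := x₀) (x₁ := x)
    ((extChartAt I x).map_source (mem_extChartAt_source x))
    (by rwa [(extChartAt I x).left_inv (mem_extChartAt_source x)])
  rw [fderivWithin_chart_change I hx, (extChartAt I x).left_inv (mem_extChartAt_source x)] at h
  exact h

theorem graphScale_change [FiniteDimensional ℝ E]
    (hpos : ∀ y, PosDefForm (FormField.model J g y)) (hW : IsOpen W)
    (h𝓔 : ContMDiffOn (I.prod 𝓘(ℝ, ℝ)) J ∞ 𝓔 W)
    (hinj : ∀ q ∈ W, Function.Injective (mfderiv (I.prod 𝓘(ℝ, ℝ)) J 𝓔 q)) {x₀ x : X} {t : ℝ}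
    (hx : x ∈ (extChartAt I x₀).source) (h0 : (x, 0) ∈ W) (hxt : (x, t) ∈ W) (p : E) :
    graphScale I J g 𝓔 x (extChartAt I x x, t, p)
      = graphScale I J g 𝓔 x₀ (extChartAt I x₀ x, t, chartDeriv I x₀ x p) := by
  unfold graphScale
  dsimp only
  rw [sliceCoeff_change g 𝓔 hx, sliceCoeff_change g 𝓔 hx]
  exact graphFactor_pull (posDefForm_sliceCoeff hpos hW h𝓔 hinj (mem_sliceDomain hx h0))
    (posDefForm_sliceCoeff hpos hW h𝓔 hinj (mem_sliceDomain hx hxt)) (chartDeriv_bijective I hx) p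

variable [IsManifold J ∞ Y] [J.Boundaryless]

/-- The derivatives of the coefficients of the induced metrics in two charts. -/
theorem fderivWithin_sliceCoeff_change
    (hg : IsSmoothForm J g)
    (hW : IsOpen W) (h𝓔 : ContMDiffOn (I.prod 𝓘(ℝ, ℝ)) J ∞ 𝓔 W) {x₀ x : X}
    (hx : x ∈ (extChartAt I x₀).source) :
    ∃ S : E →L[ℝ] E →L[ℝ] E, (∀ v w, S v w = S w v) ∧ ∀ t, (x, t) ∈ W → ∀ u v w γ,
      fderivWithin ℝ (sliceCoeff I J g 𝓔 x) (range I ×ˢ (univ : Set ℝ)) (extChartAt I x x, t)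
          (u, γ) v w
        = fderivWithin ℝ (sliceCoeff I J g 𝓔 x₀) (range I ×ˢ (univ : Set ℝ))
            (extChartAt I x₀ x, t) (chartDeriv I x₀ x u, γ) (chartDeriv I x₀ x v)
            (chartDeriv I x₀ x w)
          + sliceCoeff I J g 𝓔 x₀ (extChartAt I x₀ x, t) (S u v) (chartDeriv I x₀ x w)
          + sliceCoeff I J g 𝓔 x₀ (extChartAt I x₀ x, t) (chartDeriv I x₀ x v) (S u w) := by
  have hsrc := mem_extChartAt_source (I := I) x
  have htgt := (extChartAt I x).map_source hsrc
  have hinv := (extChartAt I x).left_inv hsrc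
  set τ : E → E := extChartAt I x₀ ∘ (extChartAt I x).symm with hτ
  have ha : extChartAt I x x ∈ range I := mem_range_self _
  have hτs : ContDiffWithinAt ℝ ∞ τ (range I) (extChartAt I x x) := by
    have h1 : ContMDiffAt I 𝓘(ℝ, E) ∞ (extChartAt I x₀)
        ((extChartAt I x).symm (extChartAt I x x)) := by
      rw [hinv]
      exact contMDiffAt_extChartAt' (by rwa [← extChartAt_source (I := I)])
    exact (h1.comp_contMDiffWithinAt _
      (contMDiffWithinAt_extChartAt_symm_range x htgt)).contDiffWithinAt
  have hτ1 := hτs.fderivWithin_right I.uniqueDiffOn (m := ∞) (by simp) ha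
  have hτd := (hτs.differentiableWithinAt (by simp)).hasFDerivWithinAt
  have hτd2 := (hτ1.differentiableWithinAt (by simp)).hasFDerivWithinAt
  have hτa : τ (extChartAt I x x) = extChartAt I x₀ x := by
    simp only [hτ, Function.comp_apply, hinv]
  -- The correction `S` is the second derivative of the transition map `τ`. It does not depend on
  -- `t`, so one and the same `S` serves for `g_0` and `g_t`, as `graphForm_pull` requires.
  refine ⟨fderivWithin ℝ (fderivWithin ℝ τ (range I)) (range I) (extChartAt I x x), ?_, ?_⟩
  · exact hτs.isSymmSndFDerivWithinAt (by simp; norm_cast) I.uniqueDiffOn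
      (I.range_subset_closure_interior ha) ha
  intro t hxt u v w γ
  have hq := mem_sliceDomain hsrc hxt
  have hq₀ := mem_sliceDomain hx hxt
  have hs : UniqueDiffOn ℝ (range I ×ˢ (univ : Set ℝ)) := uniqueDiffOn_prod_univ I.uniqueDiffOn
  have hqs := sliceDomain_subset W x hq
  have hev : sliceCoeff I J g 𝓔 x =ᶠ[𝓝[range I ×ˢ (univ : Set ℝ)] (extChartAt I x x, t)]
      fun q => pullForm (sliceCoeff I J g 𝓔 x₀ (τ q.1, q.2)) (fderivWithin ℝ τ (range I) q.1) := by
    have hmem : (extChartAt I x).symm (extChartAt I x x, t).1 ∈ (extChartAt I x₀).source := by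
      rwa [hinv]
    have hc := (continuousAt_extChartAt_symm'' (I := I) htgt).comp_continuousWithinAt
      (f := Prod.fst) (s := range I ×ˢ (univ : Set ℝ)) (x := (extChartAt I x x, t))
      continuousWithinAt_fst
    filter_upwards [eventually_target hq.1,
      hc.eventually ((isOpen_extChartAt_source x₀).mem_nhds hmem)] with q h1 h2
    exact coordForm_change I (sliceMetric I J g 𝓔 q.2) h1 h2
  have hQ := ((contDiffWithinAt_sliceCoeff hg hW h𝓔 hq₀).differentiableWithinAt
    (by simp)).hasFDerivWithinAt
  have hm1 : MapsTo (Prod.fst : E × ℝ → E) (range I ×ˢ (univ : Set ℝ)) (range I) :=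
    fun q hq => hq.1
  have hfst : HasFDerivWithinAt (Prod.fst : E × ℝ → E) (ContinuousLinearMap.fst ℝ E ℝ)
      (range I ×ˢ (univ : Set ℝ)) (extChartAt I x x, t) := hasFDerivAt_fst.hasFDerivWithinAt
  have hsnd : HasFDerivWithinAt (Prod.snd : E × ℝ → ℝ) (ContinuousLinearMap.snd ℝ E ℝ)
      (range I ×ˢ (univ : Set ℝ)) (extChartAt I x x, t) := hasFDerivAt_snd.hasFDerivWithinAt
  have hmap := (HasFDerivWithinAt.comp (f := (Prod.fst : E × ℝ → E)) (g := τ)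
    (extChartAt I x x, t) hτd hfst hm1).prodMk hsnd
  have hL := HasFDerivWithinAt.comp (f := (Prod.fst : E × ℝ → E))
    (g := fderivWithin ℝ τ (range I)) (extChartAt I x x, t) hτd2 hfst hm1
  have hQ' : HasFDerivWithinAt (sliceCoeff I J g 𝓔 x₀)
      (fderivWithin ℝ (sliceCoeff I J g 𝓔 x₀) (range I ×ˢ (univ : Set ℝ)) (extChartAt I x₀ x, t))
      (range I ×ˢ (univ : Set ℝ)) ((τ ∘ Prod.fst) (extChartAt I x x, t),
        (extChartAt I x x, t).2) := by
    simp only [Function.comp_apply, hτa]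
    exact hQ
  have hm2 : MapsTo (fun q : E × ℝ => ((τ ∘ Prod.fst) q, q.2)) (range I ×ˢ (univ : Set ℝ))
      (range I ×ˢ (univ : Set ℝ)) := fun q _ => ⟨mem_range_self _, mem_univ _⟩
  have hB := HasFDerivWithinAt.comp (f := fun q : E × ℝ => ((τ ∘ Prod.fst) q, q.2))
    (g := sliceCoeff I J g 𝓔 x₀) (extChartAt I x x, t) hQ' hmap hm2
  have key := fderivWithin_pullForm (hs _ hqs) hB hL (u, γ) v w
  rw [hev.fderivWithin_eq (hev.self_of_nhdsWithin hqs)]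
  refine key.trans ?_
  simp only [Function.comp_apply, hinv, hτ, fderivWithin_chart_change I hx,
    ContinuousLinearMap.comp_apply, ContinuousLinearMap.prod_apply, ContinuousLinearMap.coe_fst',
    ContinuousLinearMap.coe_snd']

variable [FiniteDimensional ℝ E]

theorem graphTensor_change (hpos : ∀ y, PosDefForm (FormField.model J g y))
    (hg : IsSmoothForm J g)
    (hW : IsOpen W)
    (h𝓔 : ContMDiffOn (I.prod 𝓘(ℝ, ℝ)) J ∞ 𝓔 W)
    (hinj : ∀ q ∈ W, Function.Injective (mfderiv (I.prod 𝓘(ℝ, ℝ)) J 𝓔 q)) {x₀ x : X} {t : ℝ}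
    (hx : x ∈ (extChartAt I x₀).source) (h0 : (x, 0) ∈ W) (hxt : (x, t) ∈ W) (p : E) :
    graphTensor I J g 𝓔 x (extChartAt I x x, t, p)
      = pullForm (graphTensor I J g 𝓔 x₀ (extChartAt I x₀ x, t, chartDeriv I x₀ x p))
        (chartDeriv I x₀ x) := by
  obtain ⟨S, hS, h⟩ := fderivWithin_sliceCoeff_change hg hW h𝓔 hx
  -- In the direction `(0, 1)` the terms with `S` are absent: the transition map does not involve
  -- `t`, so `∂_t g_t` is itself a tensor.
  have hB' : fderivWithin ℝ (sliceCoeff I J g 𝓔 x) (range I ×ˢ (univ : Set ℝ))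
      (extChartAt I x x, t) (0, 1)
      = pullForm (fderivWithin ℝ (sliceCoeff I J g 𝓔 x₀) (range I ×ˢ (univ : Set ℝ))
        (extChartAt I x₀ x, t) (0, 1)) (chartDeriv I x₀ x) := by
    ext v w
    rw [h t hxt, pullForm_apply]
    simp
  unfold graphTensor
  dsimp only
  rw [hB', sliceCoeff_change g 𝓔 hx, sliceCoeff_change g 𝓔 hx]
  exact graphForm_pull (posDefForm_sliceCoeff hpos hW h𝓔 hinj (mem_sliceDomain hx h0))
    (posDefForm_sliceCoeff hpos hW h𝓔 hinj (mem_sliceDomain hx hxt)) (chartDeriv_bijective I hx)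
    hS (fun u v w => h 0 h0 u v w 0) (fun u v w => h t hxt u v w 0) p

end ChartChange

/-! ### Smooth dependence of the graph tensor -/

section SmoothAlgebra

variable {Z E : Type*} [NormedAddCommGroup Z] [NormedSpace ℝ Z] [NormedAddCommGroup E]
  [NormedSpace ℝ E] {n : WithTop ℕ∞} {s : Set Z}

theorem contDiffOn_koszul {D : Z → E →L[ℝ] E →L[ℝ] E →L[ℝ] ℝ} {p : Z → E}
    (hD : ContDiffOn ℝ n D s) (hp : ContDiffOn ℝ n p s) (v w : E) :
    ContDiffOn ℝ n (fun z => koszul (D z) v w (p z)) s :=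
  ((((hD.clm_apply contDiffOn_const).clm_apply contDiffOn_const).clm_apply hp).add
    (((hD.clm_apply contDiffOn_const).clm_apply contDiffOn_const).clm_apply hp) |>.sub
    (((hD.clm_apply hp).clm_apply contDiffOn_const).clm_apply contDiffOn_const)).div_const 2

variable [FiniteDimensional ℝ E]

/-- The Leibniz expansion in a basis exhibits the determinant as a polynomial in continuous linear
functionals of `T`. -/
theorem _root_.ContDiffOn.clm_det {T : Z → E →L[ℝ] E} (hT : ContDiffOn ℝ n T s) :
    ContDiffOn ℝ n (fun z => (T z).det) s := by
  let b := Module.finBasis ℝ E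
  have h : ∀ z, (T z).det = ∑ σ : Equiv.Perm (Fin (Module.finrank ℝ E)),
      ((Equiv.Perm.sign σ : ℤ) : ℝ) * ∏ i, LinearMap.toContinuousLinearMap (b.coord (σ i))
        (T z (b i)) := fun z => by
    rw [ContinuousLinearMap.det, ← LinearMap.det_toMatrix b, Matrix.det_apply']
    simp [LinearMap.toMatrix_apply]
  simp only [h]
  refine ContDiffOn.sum fun σ _ => contDiffOn_const.mul (contDiffOn_prod fun i _ => ?_)
  exact contDiffOn_const.clm_apply (hT.clm_apply contDiffOn_const)

theorem contDiffOn_inverse {B : Z → E →L[ℝ] E →L[ℝ] ℝ} (hB : ContDiffOn ℝ n B s)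
    (hpos : ∀ z ∈ s, PosDefForm (B z)) : ContDiffOn ℝ n (fun z => (B z).inverse) s := by
  intro z hz
  have := FiniteDimensional.complete ℝ E
  obtain ⟨e, he⟩ := (hpos z hz).isInvertible
  have h : ContDiffAt ℝ n ContinuousLinearMap.inverse (B z) := by
    rw [← he]
    exact contDiffAt_map_inverse e
  exact h.comp_contDiffWithinAt z (hB z hz)

theorem contDiffOn_shift {B₀ B : Z → E →L[ℝ] E →L[ℝ] ℝ} {p : Z → E} (hB₀ : ContDiffOn ℝ n B₀ s)
    (hB : ContDiffOn ℝ n B s) (hpos : ∀ z ∈ s, PosDefForm (B z)) (hp : ContDiffOn ℝ n p s) :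
    ContDiffOn ℝ n (fun z => shift (B₀ z) (B z) (p z)) s :=
  (contDiffOn_inverse hB hpos).clm_apply (hB₀.clm_apply hp)

theorem contDiffOn_graphForm {B₀ B B' : Z → E →L[ℝ] E →L[ℝ] ℝ}
    {D₀ D : Z → E →L[ℝ] E →L[ℝ] E →L[ℝ] ℝ} {p : Z → E} (hB₀ : ContDiffOn ℝ n B₀ s)
    (hB : ContDiffOn ℝ n B s) (hD₀ : ContDiffOn ℝ n D₀ s) (hD : ContDiffOn ℝ n D s)
    (hB' : ContDiffOn ℝ n B' s) (hpos : ∀ z ∈ s, PosDefForm (B z)) (hp : ContDiffOn ℝ n p s) :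
    ContDiffOn ℝ n (fun z => graphForm (B₀ z) (B z) (D₀ z) (D z) (B' z) (p z)) s := by
  refine contDiffOn_clm_apply.2 fun v => contDiffOn_clm_apply.2 fun w => ?_
  simp only [graphForm_apply]
  have hs := contDiffOn_shift hB₀ hB hpos hp
  have h0 := fun u => (hB₀.clm_apply hp).clm_apply (contDiffOn_const (c := u))
  have h1 := fun u => (hB'.clm_apply (contDiffOn_const (c := u))).clm_apply hs
  exact ((contDiffOn_koszul hD₀ hp v w).sub (contDiffOn_koszul hD hs v w)).sub
    (((((hB'.clm_apply contDiffOn_const).clm_apply contDiffOn_const).add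
      ((h1 v).mul (h0 w))).add ((h0 v).mul (h1 w))).div_const 2)

theorem contDiffOn_graphFactor {B₀ B : Z → E →L[ℝ] E →L[ℝ] ℝ} {p : Z → E}
    (hB₀ : ContDiffOn ℝ n B₀ s) (hB : ContDiffOn ℝ n B s) (hpos₀ : ∀ z ∈ s, PosDefForm (B₀ z))
    (hpos : ∀ z ∈ s, PosDefForm (B z)) (hp : ContDiffOn ℝ n p s) :
    ContDiffOn ℝ n (fun z => graphFactor (B₀ z) (B z) (p z)) s := by
  have hs := contDiffOn_shift hB₀ hB hpos hp
  refine ContDiffOn.mul ?_ ?_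
  · exact ((contDiffOn_inverse hB₀ hpos₀).clm_comp hB).clm_det.rpow_const_of_ne fun z hz =>
      (det_inverse_comp_pos (hpos₀ z hz) (hpos z hz)).ne'
  · refine (contDiffOn_const.add ((hB₀.clm_apply hp).clm_apply hs)).rpow_const_of_ne fun z hz => ?_
    have := apply_shift_nonneg (B₀ := B₀ z) (hpos z hz) (p z)
    exact (show 0 < 1 + B₀ z (p z) (shift (B₀ z) (B z) (p z)) by linarith).ne'

end SmoothAlgebra

/-! ### Smoothness of `Ψ` and `ψ` on the tangent bundle -/

section SmoothGraph

open Topology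

variable {E : Type*} [NormedAddCommGroup E] [NormedSpace ℝ E]
  {H : Type*} [TopologicalSpace H] {I : ModelWithCorners ℝ E H}
  {X : Type*} [TopologicalSpace X] [ChartedSpace H X] [IsManifold I ∞ X]
  {E' : Type*} [NormedAddCommGroup E'] [NormedSpace ℝ E']
  {H' : Type*} [TopologicalSpace H'] {J : ModelWithCorners ℝ E' H'}
  {Y : Type*} [TopologicalSpace Y] [ChartedSpace H' Y] [IsManifold J ∞ Y] [J.Boundaryless]
  {W : Set (X × ℝ)} {𝓔 : X × ℝ → Y} {g : FormField J (X := Y)}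

variable (I J) in
/-- The zeroth order term of the second fundamental form of graphs, as a function of `x`, `t` and
`p ∈ T_x X`. -/
def graphTensorAt (g : FormField J (X := Y)) (𝓔 : X × ℝ → Y) (x : X) (t : ℝ) (p : E) :
    E →L[ℝ] E →L[ℝ] ℝ :=
  graphTensor I J g 𝓔 x (extChartAt I x x, t, p)

variable (I J) in
/-- The factor in the Gaussian curvature of graphs, as a function of `x`, `t` and `p ∈ T_x X`. -/
def graphScaleAt (g : FormField J (X := Y)) (𝓔 : X × ℝ → Y) (x : X) (t : ℝ) (p : E) : ℝ :=
  graphScale I J g 𝓔 x (extChartAt I x x, t, p)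

theorem contDiffOn_sliceCoeff_comp
    (hg : IsSmoothForm J g)
    (hW : IsOpen W) (h𝓔 : ContMDiffOn (I.prod 𝓘(ℝ, ℝ)) J ∞ 𝓔 W) {x₀ : X}
    {Z : Type*} [NormedAddCommGroup Z] [NormedSpace ℝ Z] {s : Set Z} {φ : Z → E × ℝ}
    (hφ : ContDiffOn ℝ ∞ φ s) (hs : MapsTo φ s (sliceDomain I W x₀)) :
    ContDiffOn ℝ ∞ (fun z => sliceCoeff I J g 𝓔 x₀ (φ z)) s ∧
    ContDiffOn ℝ ∞ (fun z => fderivWithin ℝ (sliceCoeff I J g 𝓔 x₀)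
      (range I ×ˢ (univ : Set ℝ)) (φ z)) s := by
  have hm : MapsTo φ s (range I ×ˢ (univ : Set ℝ)) := fun z hz => sliceDomain_subset W x₀ (hs hz)
  have h1 : ∀ z ∈ s, ContDiffWithinAt ℝ ∞ (sliceCoeff I J g 𝓔 x₀) (range I ×ˢ (univ : Set ℝ))
    (φ z) := fun z hz => contDiffWithinAt_sliceCoeff hg hW h𝓔 (hs hz)
  refine ⟨fun z hz => (h1 z hz).comp z (hφ z hz) hm, fun z hz => ?_⟩
  exact ((h1 z hz).fderivWithin_right (uniqueDiffOn_prod_univ I.uniqueDiffOn) (m := ∞) (by simp)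
    (hm hz)).comp z (hφ z hz) hm

variable [FiniteDimensional ℝ E]

theorem contDiffOn_graphTensor
    (h0 : ∀ x, (x, (0 : ℝ)) ∈ W) (hpos : ∀ y, PosDefForm (FormField.model J g y))
    (hg : IsSmoothForm J g)
    (hW : IsOpen W) (h𝓔 : ContMDiffOn (I.prod 𝓘(ℝ, ℝ)) J ∞ 𝓔 W)
    (hinj : ∀ q ∈ W, Function.Injective (mfderiv (I.prod 𝓘(ℝ, ℝ)) J 𝓔 q))
    (x₀ : X) :
    ContDiffOn ℝ ∞ (graphTensor I J g 𝓔 x₀) (familyDomain I W x₀) := by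
  have hm0 : MapsTo (fun r : E × ℝ × E => (r.1, (0 : ℝ))) (familyDomain I W x₀)
    (sliceDomain I W x₀) := fun r hr => ⟨hr.1, h0 _⟩
  have hm : MapsTo (fun r : E × ℝ × E => (r.1, r.2.1)) (familyDomain I W x₀)
    (sliceDomain I W x₀) := fun r hr => hr
  obtain ⟨ha, ha'⟩ := contDiffOn_sliceCoeff_comp hg hW h𝓔 (by fun_prop) hm0
  obtain ⟨hb, hb'⟩ := contDiffOn_sliceCoeff_comp hg hW h𝓔 (by fun_prop) hm
  exact contDiffOn_graphForm ha hb (ha'.clm_comp contDiffOn_const) (hb'.clm_comp contDiffOn_const)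
    (hb'.clm_apply contDiffOn_const)
    (fun r hr => posDefForm_sliceCoeff hpos hW h𝓔 hinj (hm hr)) (by fun_prop)

theorem contDiffOn_graphScale
    (h0 : ∀ x, (x, (0 : ℝ)) ∈ W) (hpos : ∀ y, PosDefForm (FormField.model J g y))
    (hg : IsSmoothForm J g)
    (hW : IsOpen W) (h𝓔 : ContMDiffOn (I.prod 𝓘(ℝ, ℝ)) J ∞ 𝓔 W)
    (hinj : ∀ q ∈ W, Function.Injective (mfderiv (I.prod 𝓘(ℝ, ℝ)) J 𝓔 q))
    (x₀ : X) :
    ContDiffOn ℝ ∞ (graphScale I J g 𝓔 x₀) (familyDomain I W x₀) := by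
  have hm0 : MapsTo (fun r : E × ℝ × E => (r.1, (0 : ℝ))) (familyDomain I W x₀)
    (sliceDomain I W x₀) := fun r hr => ⟨hr.1, h0 _⟩
  have hm : MapsTo (fun r : E × ℝ × E => (r.1, r.2.1)) (familyDomain I W x₀)
    (sliceDomain I W x₀) := fun r hr => hr
  obtain ⟨ha, ha'⟩ := contDiffOn_sliceCoeff_comp hg hW h𝓔 (by fun_prop) hm0
  obtain ⟨hb, hb'⟩ := contDiffOn_sliceCoeff_comp hg hW h𝓔 (by fun_prop) hm
  exact contDiffOn_graphFactor ha hb (fun r hr => posDefForm_sliceCoeff hpos hW h𝓔 hinj (hm0 hr))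
    (fun r hr => posDefForm_sliceCoeff hpos hW h𝓔 hinj (hm hr)) (by fun_prop)

theorem smoothFormFamily_graphTensorAt
    (h0 : ∀ x, (x, (0 : ℝ)) ∈ W) (hpos : ∀ y, PosDefForm (FormField.model J g y))
    (hg : IsSmoothForm J g)
    (hW : IsOpen W) (h𝓔 : ContMDiffOn (I.prod 𝓘(ℝ, ℝ)) J ∞ 𝓔 W)
    (hinj : ∀ q ∈ W, Function.Injective (mfderiv (I.prod 𝓘(ℝ, ℝ)) J 𝓔 q)) :
    SmoothFormFamily I W (graphTensorAt I J g 𝓔) :=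
  smoothFormFamily_of_local I (fun _ x _ p hxt hx =>
    graphTensor_change hpos hg hW h𝓔 hinj hx (h0 x) hxt p)
    (contDiffOn_graphTensor h0 hpos hg hW h𝓔 hinj)

theorem smoothFunFamily_graphScaleAt
    (h0 : ∀ x, (x, (0 : ℝ)) ∈ W) (hpos : ∀ y, PosDefForm (FormField.model J g y))
    (hg : IsSmoothForm J g)
    (hW : IsOpen W) (h𝓔 : ContMDiffOn (I.prod 𝓘(ℝ, ℝ)) J ∞ 𝓔 W)
    (hinj : ∀ q ∈ W, Function.Injective (mfderiv (I.prod 𝓘(ℝ, ℝ)) J 𝓔 q)) :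
    SmoothFunFamily I W (graphScaleAt I J g 𝓔) :=
  smoothFunFamily_of_local I (fun _ x _ p hxt hx =>
    graphScale_change hpos hW h𝓔 hinj hx (h0 x) hxt p)
    (contDiffOn_graphScale h0 hpos hg hW h𝓔 hinj)

end SmoothGraph

/-! ### The remainder of the graph tensor -/

section Remainder

open Topology

/-- The pull-back of bilinear forms by a linear map, as a linear map. -/
theorem exists_pullForm_clm {V W : Type*} [NormedAddCommGroup V] [NormedSpace ℝ V]
    [NormedAddCommGroup W] [NormedSpace ℝ W] (L : V →L[ℝ] W) :
    ∃ T : (W →L[ℝ] W →L[ℝ] ℝ) →L[ℝ] (V →L[ℝ] V →L[ℝ] ℝ), ∀ B, T B = pullForm B L :=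
  ⟨(ContinuousLinearMap.compL ℝ V (W →L[ℝ] ℝ) (V →L[ℝ] ℝ) (L.precomp ℝ)) ∘L
    ((ContinuousLinearMap.compL ℝ V W (W →L[ℝ] ℝ)).flip L), fun _ => rfl⟩

variable {E : Type} [NormedAddCommGroup E] [NormedSpace ℝ E]
  {H : Type*} [TopologicalSpace H] {I : ModelWithCorners ℝ E H}
  {X : Type*} [TopologicalSpace X] [ChartedSpace H X]
  {E' : Type*} [NormedAddCommGroup E'] [NormedSpace ℝ E']
  {H' : Type*} [TopologicalSpace H'] {J : ModelWithCorners ℝ E' H'}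
  {Y : Type*} [TopologicalSpace Y] [ChartedSpace H' Y]
  {W : Set (X × ℝ)} {𝓔 : X × ℝ → Y} {g : FormField J (X := Y)}

variable (I J) in
/-- The difference quotient in `t` of `graphTensor`. -/
def graphRemainder (g : FormField J (X := Y)) (𝓔 : X × ℝ → Y) (x₀ : X) (r : E × ℝ × E) :
    E →L[ℝ] E →L[ℝ] ℝ :=
  coordQuotient (fun s : (E × E) × ℝ => graphTensor I J g 𝓔 x₀ (s.1.1, s.2, s.1.2))
    ((r.1, r.2.2), r.2.1)

variable (I J) in
/-- The difference quotient in `t` of `graphTensorAt`. -/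
def graphRemainderAt (g : FormField J (X := Y)) (𝓔 : X × ℝ → Y) (x : X) (t : ℝ) (p : E) :
    E →L[ℝ] E →L[ℝ] ℝ :=
  graphRemainder I J g 𝓔 x (extChartAt I x x, t, p)

/-- Purely algebraic: for `t ≠ 0` it is the definition of the quotient, and at `t = 0` the value of
the remainder is multiplied by zero. -/
theorem graphTensorAt_eq (g : FormField J (X := Y)) (𝓔 : X × ℝ → Y) (x : X) (t : ℝ) (p v w : E) :
    graphTensorAt I J g 𝓔 x t p v w
      = graphTensorAt I J g 𝓔 x 0 p v w + t * graphRemainderAt I J g 𝓔 x t p v w := by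
  by_cases ht : t = 0
  · simp [ht]
  · simp only [graphRemainderAt, graphRemainder, coordQuotient, ht, if_false, graphTensorAt,
      smul_apply, sub_apply, smul_eq_mul]
    field_simp
    ring

variable [IsManifold I ∞ X] [IsManifold J ∞ Y] [J.Boundaryless]
  [FiniteDimensional ℝ E]

/-- Away from `t = 0` the quotient is visibly smooth. Near `t = 0` the domain contains a box over
the convex set `range I ∩ ball`, with `p` unrestricted, on which Hadamard's formula applies up to
the boundary. -/
theorem contDiffOn_graphRemainder (h0 : ∀ x, (x, (0 : ℝ)) ∈ W)
    (hpos : ∀ y, PosDefForm (FormField.model J g y))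
    (hg : IsSmoothForm J g)
    (hW : IsOpen W) (h𝓔 : ContMDiffOn (I.prod 𝓘(ℝ, ℝ)) J ∞ 𝓔 W)
    (hinj : ∀ q ∈ W, Function.Injective (mfderiv (I.prod 𝓘(ℝ, ℝ)) J 𝓔 q))
    (x₀ : X) :
    ContDiffOn ℝ ∞ (graphRemainder I J g 𝓔 x₀) (familyDomain I W x₀) := by
  have hT := contDiffOn_graphTensor h0 hpos hg hW h𝓔 hinj x₀
  rintro ⟨z, t, p⟩ hr
  by_cases ht : t = 0
  · subst ht
    have hev := eventually_sliceDomain hW (q := (z, 0)) (x₀ := x₀) hr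
    obtain ⟨ε, hε, hball⟩ := Metric.mem_nhdsWithin_iff.1 hev
    have hsub : ∀ z' ∈ range I ∩ Metric.ball z ε, ∀ t' ∈ Ioo (-ε) ε,
        (z', t') ∈ sliceDomain I W x₀ := fun z' hz' t' ht' => by
      refine hball ⟨?_, hz'.1, mem_univ _⟩
      rw [Metric.mem_ball, Prod.dist_eq, max_lt_iff]
      refine ⟨hz'.2, ?_⟩
      rw [Real.dist_eq, sub_zero]
      exact abs_lt.2 ht'
    have hm : MapsTo (fun s : (E × E) × ℝ => (s.1.1, s.2, s.1.2))
        (((range I ∩ Metric.ball z ε) ×ˢ univ) ×ˢ Ioo (-ε) ε) (familyDomain I W x₀) :=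
      fun s hs => hsub s.1.1 hs.1.1 s.2 hs.2
    have hF : ContDiffOn ℝ ∞ (fun s : (E × E) × ℝ => graphTensor I J g 𝓔 x₀ (s.1.1, s.2, s.1.2))
        (((range I ∩ Metric.ball z ε) ×ˢ univ) ×ˢ Ioo (-ε) ε) :=
      hT.comp (f := fun s : (E × E) × ℝ => (s.1.1, s.2, s.1.2)) (by fun_prop) hm
    have hq := contDiffOn_coordQuotient
      ((I.convex_range.inter (convex_ball z ε)).prod convex_univ)
      ((I.uniqueDiffOn.inter Metric.isOpen_ball).prod uniqueDiffOn_univ) hF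
    have hm' : MapsTo (fun r : E × ℝ × E => ((r.1, r.2.2), r.2.1))
        (familyDomain I W x₀ ∩ (Metric.ball z ε ×ˢ Ioo (-ε) ε ×ˢ univ))
        (((range I ∩ Metric.ball z ε) ×ˢ univ) ×ˢ Ioo (-ε) ε) := fun r hr =>
      ⟨⟨⟨extChartAt_target_subset_range x₀ hr.1.1, hr.2.1⟩, mem_univ _⟩, hr.2.2.1⟩
    have hz0 : (z, (0 : ℝ), p) ∈ Metric.ball z ε ×ˢ Ioo (-ε) ε ×ˢ (univ : Set E) :=
      ⟨Metric.mem_ball_self hε, ⟨by simpa using hε, hε⟩, mem_univ _⟩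
    have hopen : IsOpen (Metric.ball z ε ×ˢ Ioo (-ε) ε ×ˢ (univ : Set E)) :=
      Metric.isOpen_ball.prod (isOpen_Ioo.prod isOpen_univ)
    exact (contDiffWithinAt_inter (hopen.mem_nhds hz0)).1
      (hq.comp (f := fun r : E × ℝ × E => ((r.1, r.2.2), r.2.1)) (by fun_prop) hm' _ ⟨hr, hz0⟩)
  · have hm : MapsTo (fun r : E × ℝ × E => (r.1, (0 : ℝ), r.2.2)) (familyDomain I W x₀)
      (familyDomain I W x₀) := fun r hr => ⟨hr.1, h0 _⟩
    have hT0 : ContDiffOn ℝ ∞ (fun r : E × ℝ × E => graphTensor I J g 𝓔 x₀ (r.1, 0, r.2.2))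
        (familyDomain I W x₀) :=
      hT.comp (f := fun r : E × ℝ × E => (r.1, (0 : ℝ), r.2.2)) (by fun_prop) hm
    have hi : ContDiffWithinAt ℝ ∞ (fun r : E × ℝ × E => r.2.1⁻¹) (familyDomain I W x₀)
        (z, t, p) := by
      refine ContDiffWithinAt.inv ?_ ht
      fun_prop
    have hev : ∀ᶠ r : E × ℝ × E in 𝓝[familyDomain I W x₀] (z, t, p), r.2.1 ≠ 0 := by
      have hc : ContinuousAt (fun r : E × ℝ × E => r.2.1) (z, t, p) := by fun_prop
      exact mem_nhdsWithin_of_mem_nhds (hc.eventually_ne ht)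
    refine (hi.smul ((hT _ hr).sub (hT0 _ hr))).congr_of_eventuallyEq ?_ ?_
    · filter_upwards [hev] with r hr'
      simp [graphRemainder, coordQuotient, hr']
    · simp [graphRemainder, coordQuotient, ht]

/-- For fixed `x` and `p` the change of chart is a continuous linear map `T` of forms that does not
depend on `t`. It therefore commutes with difference quotients and with the derivative at `t = 0`.
-/
theorem graphRemainder_change (h0 : ∀ x, (x, (0 : ℝ)) ∈ W)
    (hpos : ∀ y, PosDefForm (FormField.model J g y))
    (hg : IsSmoothForm J g)
    (hW : IsOpen W) (h𝓔 : ContMDiffOn (I.prod 𝓘(ℝ, ℝ)) J ∞ 𝓔 W)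
    (hinj : ∀ q ∈ W, Function.Injective (mfderiv (I.prod 𝓘(ℝ, ℝ)) J 𝓔 q))
    {x₀ x : X} {t : ℝ} (hx : x ∈ (extChartAt I x₀).source)
    (hxt : (x, t) ∈ W) (p : E) :
    graphRemainderAt I J g 𝓔 x t p
      = pullForm (graphRemainder I J g 𝓔 x₀ (extChartAt I x₀ x, t, chartDeriv I x₀ x p))
        (chartDeriv I x₀ x) := by
  have hchange := fun s hs =>
    graphTensor_change hpos hg hW h𝓔 hinj (t := s) hx (h0 x) hs p
  obtain ⟨T, hT⟩ := exists_pullForm_clm (chartDeriv I x₀ x)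
  by_cases ht : t = 0
  · subst ht
    have hopen : IsOpen {s : ℝ | (x, s) ∈ W} := hW.preimage (by fun_prop)
    have hd : DifferentiableAt ℝ (fun s => graphTensor I J g 𝓔 x₀
        (extChartAt I x₀ x, s, chartDeriv I x₀ x p)) 0 := by
      have hm : MapsTo (fun s : ℝ => (extChartAt I x₀ x, s, chartDeriv I x₀ x p))
          {s : ℝ | (x, s) ∈ W} (familyDomain I W x₀) := fun s hs => mem_sliceDomain hx hs
      have h1 := (contDiffOn_graphTensor h0 hpos hg hW h𝓔 hinj x₀).comp
        (f := fun s : ℝ => (extChartAt I x₀ x, s, chartDeriv I x₀ x p)) (by fun_prop) hm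
      exact (h1.contDiffAt (hopen.mem_nhds hxt)).differentiableAt (by simp)
    have hev : (fun s => graphTensor I J g 𝓔 x (extChartAt I x x, s, p)) =ᶠ[𝓝 0]
        fun s => T (graphTensor I J g 𝓔 x₀ (extChartAt I x₀ x, s, chartDeriv I x₀ x p)) := by
      filter_upwards [hopen.mem_nhds hxt] with s hs
      rw [hT]
      exact hchange s hs
    simp only [graphRemainderAt, graphRemainder, coordQuotient, if_true]
    rw [hev.deriv_eq, ← hT]
    exact (T.hasFDerivAt.comp_hasDerivAt (0 : ℝ) hd.hasDerivAt).deriv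
  · simp only [graphRemainderAt, graphRemainder, coordQuotient, ht, if_false]
    rw [hchange t hxt, hchange 0 (h0 x), ← hT, ← hT, ← hT, map_smul, map_sub]

theorem smoothFormFamily_graphRemainderAt (h0 : ∀ x, (x, (0 : ℝ)) ∈ W)
    (hpos : ∀ y, PosDefForm (FormField.model J g y))
    (hg : IsSmoothForm J g)
    (hW : IsOpen W) (h𝓔 : ContMDiffOn (I.prod 𝓘(ℝ, ℝ)) J ∞ 𝓔 W)
    (hinj : ∀ q ∈ W, Function.Injective (mfderiv (I.prod 𝓘(ℝ, ℝ)) J 𝓔 q)) :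
    SmoothFormFamily I W (graphRemainderAt I J g 𝓔) :=
  smoothFormFamily_of_local I (fun _ _ _ p hxt hx =>
    graphRemainder_change h0 hpos hg hW h𝓔 hinj hx hxt p)
    (contDiffOn_graphRemainder h0 hpos hg hW h𝓔 hinj)

end Remainder

/-! ### The unit normal of graphs -/

section Normal

open Topology

variable {E : Type*} [NormedAddCommGroup E] [NormedSpace ℝ E]
  {H : Type*} [TopologicalSpace H] {I : ModelWithCorners ℝ E H}
  {X : Type*} [TopologicalSpace X] [ChartedSpace H X]
  {E' : Type*} [NormedAddCommGroup E'] [NormedSpace ℝ E']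
  {H' : Type*} [TopologicalSpace H'] {J : ModelWithCorners ℝ E' H'}
  {Y : Type*} [TopologicalSpace Y] [ChartedSpace H' Y]
  {W : Set (X × ℝ)} {𝓔 : X × ℝ → Y} {g : FormField J (X := Y)}

variable (I J) in
/-- The gradient of `f` at `x` with respect to the metric of the slice `t = f x`. -/
def sliceGradient (g : FormField J (X := Y)) (𝓔 : X × ℝ → Y) (f : X → ℝ) (x : X) : E :=
  (FormField.model I (sliceMetric I J g 𝓔 (f x)) x).inverse (modelDeriv I 𝓘(ℝ, ℝ) f x)

variable (I J) in
/-- The downward unit normal of the graph of `f`. -/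
def graphNormal (g : FormField J (X := Y)) (𝓔 : X × ℝ → Y) (f : X → ℝ) (x : X) : E' :=
  flowDeriv I J 𝓔 x (f x)
    ((√(1 + modelDeriv I 𝓘(ℝ, ℝ) f x (sliceGradient I J g 𝓔 f x)))⁻¹ •
      (sliceGradient I J g 𝓔 f x, (-1 : ℝ)))

theorem isSmoothImmersion_graph (hW : IsOpen W)
    (h𝓔 : ContMDiffOn (I.prod 𝓘(ℝ, ℝ)) J ∞ 𝓔 W)
    (hinj : ∀ q ∈ W, Function.Injective (mfderiv (I.prod 𝓘(ℝ, ℝ)) J 𝓔 q)) {f : X → ℝ}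
    (hf : ContMDiff I 𝓘(ℝ, ℝ) ∞ f) (hx : ∀ x, (x, f x) ∈ W) :
    IsSmoothImmersion I J (graph 𝓔 f) := by
  refine ⟨contMDiff_graph hW h𝓔 hf hx, fun x => ?_⟩
  suffices h : Function.Injective (modelDeriv I J (graph 𝓔 f) x) from h
  intro v w h
  have hfd : MDifferentiableAt I 𝓘(ℝ, ℝ) f x := (hf x).mdifferentiableAt (by simp)
  rw [modelDeriv_graph hW h𝓔 hfd (hx x), modelDeriv_graph hW h𝓔 hfd (hx x)] at h
  exact congrArg Prod.fst (flowDeriv_injective hW h𝓔 hinj (hx x) h)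

variable [IsManifold I ∞ X] [IsManifold J ∞ Y] [J.Boundaryless]

theorem firstForm_graph [FiniteDimensional ℝ E']
    (hg : IsSmoothForm J g)
    (hpos : ∀ y, PosDefForm (FormField.model J g y)) {φ : X → Y}
    {N : (x : X) → TangentSpace J (φ x)} (hN : IsUnitNormal I J g φ N)
    (h𝓔 : IsNormalExp I J g φ N W 𝓔) {f : X → ℝ} {x : X}
    (hf : MDifferentiableAt I 𝓘(ℝ, ℝ) f x) (hx : (x, f x) ∈ W) :
    FormField.model I (firstForm I J g (graph 𝓔 f)) x
      = FormField.model I (sliceMetric I J g 𝓔 (f x)) x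
        + (modelDeriv I 𝓘(ℝ, ℝ) f x).smulRight (modelDeriv I 𝓘(ℝ, ℝ) f x) := by
  ext v w
  have h1 := gauss_lemma hg hpos hN h𝓔 hx (v, modelDeriv I 𝓘(ℝ, ℝ) f x v)
    (w, modelDeriv I 𝓘(ℝ, ℝ) f x w)
  rw [← modelDeriv_graph h𝓔.isOpen h𝓔.smooth hf hx,
    ← modelDeriv_graph h𝓔.isOpen h𝓔.smooth hf hx] at h1
  exact h1

variable [FiniteDimensional ℝ E]

/-- In charts the field is the derivative of `flowRep` applied to an explicit vector, built from
`df`, the inverse of the slice coefficients and the square root of a positive function. All of these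
are smooth up to the boundary. -/
theorem contMDiff_graphNormal (hpos : ∀ y, PosDefForm (FormField.model J g y))
    (hg : IsSmoothForm J g)
    (hW : IsOpen W) (h𝓔 : ContMDiffOn (I.prod 𝓘(ℝ, ℝ)) J ∞ 𝓔 W)
    (hinj : ∀ q ∈ W, Function.Injective (mfderiv (I.prod 𝓘(ℝ, ℝ)) J 𝓔 q)) {f : X → ℝ}
    (hf : ContMDiff I 𝓘(ℝ, ℝ) ∞ f) (hx : ∀ x, (x, f x) ∈ W) :
    ContMDiff I J.tangent ∞
      (fun x => (⟨graph 𝓔 f x, graphNormal (E' := E') I J g 𝓔 f x⟩ : TangentBundle J Y)) := by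
  intro x₀
  have hφ := contMDiff_graph hW h𝓔 hf hx
  refine contMDiffAt_totalSpace.2 ⟨hφ x₀, ?_⟩
  set y₀ := graph 𝓔 f x₀ with hy₀
  have hsrc := mem_extChartAt_source (I := I) x₀
  have htgt := (extChartAt I x₀).map_source hsrc
  have hinv := (extChartAt I x₀).left_inv hsrc
  have ha : extChartAt I x₀ x₀ ∈ range I := mem_range_self _
  have hq := mem_sliceDomain hsrc (hx x₀)
  have hy : 𝓔 ((extChartAt I x₀).symm (extChartAt I x₀ x₀, f x₀).1, f x₀)
      ∈ (extChartAt J y₀).source := by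
    simp only [hinv]
    exact mem_extChartAt_source y₀
  let fh : E → ℝ := f ∘ (extChartAt I x₀).symm
  have hfa : fh (extChartAt I x₀ x₀) = f x₀ := by simp only [fh, Function.comp_apply, hinv]
  have hfh : ContDiffWithinAt ℝ ∞ fh (range I) (extChartAt I x₀ x₀) := by
    have h1 : ContMDiffWithinAt 𝓘(ℝ, E) 𝓘(ℝ, ℝ) ∞ fh (range I) (extChartAt I x₀ x₀) :=
      (hf _).comp_contMDiffWithinAt _ (contMDiffWithinAt_extChartAt_symm_range x₀ htgt)
    exact h1.contDiffWithinAt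
  have hDf := hfh.fderivWithin_right I.uniqueDiffOn (m := ∞) (by simp) ha
  have hpt : ContDiffWithinAt ℝ ∞ (fun z : E => (z, fh z)) (range I) (extChartAt I x₀ x₀) :=
    contDiffWithinAt_id.prodMk hfh
  have hm : MapsTo (fun z : E => (z, fh z)) (range I) (range I ×ˢ (univ : Set ℝ)) :=
    fun z hz => ⟨hz, mem_univ _⟩
  have hQ := contDiffWithinAt_sliceCoeff hg hW h𝓔 hq
  have hF := (contDiffWithinAt_flowRep hW h𝓔 hq hy).fderivWithin_right
    (uniqueDiffOn_prod_univ I.uniqueDiffOn) (m := ∞) (by simp) (sliceDomain_subset W x₀ hq)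
  rw [← hfa] at hQ hF
  have hQ' := hQ.comp (f := fun z : E => (z, fh z)) _ hpt hm
  have hF' := hF.comp (f := fun z : E => (z, fh z)) _ hpt hm
  have hposQ : PosDefForm
      (sliceCoeff I J g 𝓔 x₀ (extChartAt I x₀ x₀, fh (extChartAt I x₀ x₀))) := by
    rw [hfa]
    exact posDefForm_sliceCoeff hpos hW h𝓔 hinj hq
  let P : E → E := fun z =>
    (sliceCoeff I J g 𝓔 x₀ (z, fh z)).inverse (fderivWithin ℝ fh (range I) z)
  have hP : ContDiffWithinAt ℝ ∞ P (range I) (extChartAt I x₀ x₀) := by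
    have := FiniteDimensional.complete ℝ E
    obtain ⟨e, he⟩ := hposQ.isInvertible
    have h : ContDiffAt ℝ ∞ ContinuousLinearMap.inverse
        (sliceCoeff I J g 𝓔 x₀ (extChartAt I x₀ x₀, fh (extChartAt I x₀ x₀))) := by
      rw [← he]
      exact contDiffAt_map_inverse e
    exact (h.comp_contDiffWithinAt (f := fun z => sliceCoeff I J g 𝓔 x₀ (z, fh z)) _ hQ').clm_apply
      hDf
  have hsq : ContDiffWithinAt ℝ ∞ (fun z => (√(1 + fderivWithin ℝ fh (range I) z (P z)))⁻¹)
      (range I) (extChartAt I x₀ x₀) := by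
    have h1 : 0 < 1 + fderivWithin ℝ fh (range I) (extChartAt I x₀ x₀)
        (P (extChartAt I x₀ x₀)) := by
      have h2 := hposQ.nonneg (P (extChartAt I x₀ x₀))
      rw [hposQ.apply_inverse] at h2
      linarith
    exact ((contDiffWithinAt_const.add (hDf.clm_apply hP)).sqrt h1.ne').inv (Real.sqrt_pos.2 h1).ne'
  have hΦ := hF'.clm_apply (hsq.smul (hP.prodMk (contDiffWithinAt_const (c := (-1 : ℝ)))))
  have hcomp := hΦ.contMDiffWithinAt.comp (I := I) x₀ (f := extChartAt I x₀) (s := univ)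
    (contMDiffAt_extChartAt.contMDiffWithinAt) (fun z _ => mem_range_self _)
  rw [contMDiffWithinAt_univ] at hcomp
  refine hcomp.congr_of_eventuallyEq ?_
  have hev1 := (isOpen_extChartAt_source (I := I) x₀).mem_nhds hsrc
  have hev2 : ∀ᶠ x in 𝓝 x₀, graph 𝓔 f x ∈ (extChartAt J y₀).source :=
    hφ.continuous.continuousAt.eventually
      ((isOpen_extChartAt_source y₀).mem_nhds (mem_extChartAt_source y₀))
  filter_upwards [hev1, hev2] with x h1 h2
  have hfd : MDifferentiableAt I 𝓘(ℝ, ℝ) f x := (hf x).mdifferentiableAt (by simp)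
  have hfx : fh (extChartAt I x₀ x) = f x := by
    simp only [fh, Function.comp_apply, (extChartAt I x₀).left_inv h1]
  have hD : ∀ v, fderivWithin ℝ fh (range I) (extChartAt I x₀ x) (chartDeriv I x₀ x v)
      = modelDeriv I 𝓘(ℝ, ℝ) f x v := fun v => by
    rw [(fderivWithin_comp_chart I h1 hfd).2, chartDerivSymm_chartDeriv I h1]
  have hPx : P (extChartAt I x₀ x) = chartDeriv I x₀ x (sliceGradient I J g 𝓔 f x) := by
    have hp := posDefForm_sliceCoeff hpos hW h𝓔 hinj (mem_sliceDomain h1 (hx x))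
    simp only [P, hfx]
    refine (hp.eq_inverse fun w => ?_).symm
    obtain ⟨w, rfl⟩ := (chartDeriv_bijective I h1).2 w
    rw [hD]
    refine (coordForm_chartDeriv I (sliceMetric I J g 𝓔 (f x)) h1 _ _).trans ?_
    rw [sliceGradient, (posDefForm_sliceMetric hpos hW h𝓔 hinj (hx x)).apply_inverse]
  refine (trivializationAt_tangent J h2 _).trans ?_
  refine (chartDeriv_flowDeriv hW h𝓔 (hx x) h1 h2 _).trans ?_
  simp only [Function.comp_apply, Pi.smul_apply', hPx, hD, hfx, Prod.smul_mk, map_smul]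

variable [FiniteDimensional ℝ E']

theorem isDownwardNormal_graphNormal
    (hg : IsSmoothForm J g)
    (hpos : ∀ y, PosDefForm (FormField.model J g y)) {φ : X → Y}
    {N : (x : X) → TangentSpace J (φ x)} (hN : IsUnitNormal I J g φ N)
    (h𝓔 : IsNormalExp I J g φ N W 𝓔) {f : X → ℝ}
    (hf : ContMDiff I 𝓘(ℝ, ℝ) ∞ f) (hx : ∀ x, (x, f x) ∈ W) :
    IsDownwardNormal I J g 𝓔 f (graphNormal I J g 𝓔 f) := by
  have hB := fun x => posDefForm_sliceMetric hpos h𝓔.isOpen h𝓔.smooth h𝓔.immersive (hx x)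
  have hfd : ∀ x, MDifferentiableAt I 𝓘(ℝ, ℝ) f x := fun x => (hf x).mdifferentiableAt (by simp)
  have hP : ∀ x v, FormField.model I (sliceMetric I J g 𝓔 (f x)) x (sliceGradient I J g 𝓔 f x) v
      = modelDeriv I 𝓘(ℝ, ℝ) f x v := fun x v => by rw [sliceGradient, (hB x).apply_inverse]
  have hq : ∀ x, 0 < 1 + modelDeriv I 𝓘(ℝ, ℝ) f x (sliceGradient I J g 𝓔 f x) := fun x => by
    have := (hB x).nonneg (sliceGradient I J g 𝓔 f x)
    rw [hP] at this
    linarith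
  have hgauss := fun x => gauss_lemma hg hpos hN h𝓔 (hx x)
  have hnormal : ∀ x v, FormField.model J g (𝓔 (x, f x)) (graphNormal I J g 𝓔 f x)
      (modelDeriv I J (graph 𝓔 f) x v) = 0 := fun x v => by
    rw [modelDeriv_graph h𝓔.isOpen h𝓔.smooth (hfd x) (hx x), graphNormal, hgauss]
    simp only [Prod.smul_mk, map_smul, smul_apply, hP, smul_eq_mul]
    ring
  refine ⟨⟨contMDiff_graphNormal hpos hg h𝓔.isOpen h𝓔.smooth h𝓔.immersive hf hx, fun x => ?_,
    fun x v => ?_⟩, fun x => ?_⟩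
  · refine (hgauss x _ _).trans ?_
    simp only [Prod.smul_mk, map_smul, smul_apply, hP, smul_eq_mul]
    have h1 := Real.mul_self_sqrt (hq x).le
    have h2 := (Real.sqrt_pos.2 (hq x)).ne'
    generalize hs : √(1 + modelDeriv I 𝓘(ℝ, ℝ) f x (sliceGradient I J g 𝓔 f x)) = s at *
    field_simp
    linarith
  · exact hnormal x v
  · have hvel : modelVelocity J 𝓔 x (f x) = flowDeriv I J 𝓔 x (f x) (0, 1) := by simp [flowDeriv]
    have h1 := hgauss x ((√(1 + modelDeriv I 𝓘(ℝ, ℝ) f x (sliceGradient I J g 𝓔 f x)))⁻¹ •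
      (sliceGradient I J g 𝓔 f x, (-1 : ℝ))) (0, 1)
    rw [← hvel] at h1
    refine lt_of_eq_of_lt h1 ?_
    simp only [Prod.smul_mk, map_zero, smul_eq_mul]
    have := inv_pos.2 (Real.sqrt_pos.2 (hq x))
    linarith

end Normal

/-! ### The Gaussian curvature of graphs -/

section Determinant

variable {E : Type*} [NormedAddCommGroup E] [NormedSpace ℝ E]

theorem koszul_comm {D : E →L[ℝ] E →L[ℝ] E →L[ℝ] ℝ} (hD : ∀ u v w, D u v w = D u w v)
    (v w p : E) : koszul D v w p = koszul D w v p := by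
  simp only [koszul]
  rw [hD p v w]
  ring

theorem graphForm_symm {B₀ B B' : E →L[ℝ] E →L[ℝ] ℝ} {D₀ D : E →L[ℝ] E →L[ℝ] E →L[ℝ] ℝ}
    (hD₀ : ∀ u v w, D₀ u v w = D₀ u w v) (hD : ∀ u v w, D u v w = D u w v)
    (hB' : ∀ v w, B' v w = B' w v) (p v w : E) :
    graphForm B₀ B D₀ D B' p v w = graphForm B₀ B D₀ D B' p w v := by
  rw [graphForm_apply, graphForm_apply, koszul_comm hD₀ v w, koszul_comm hD v w, hB' v w]
  ring

/-- The ball is a sublevel set of `1 + B(p, p)`, the case `α = 1` of `convexOn_one_add_rpow`. -/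
theorem convex_sqrt_le {B : E →L[ℝ] E →L[ℝ] ℝ} (hB : PosDefForm B) {R : ℝ} (hR : 0 < R) :
    Convex ℝ {p | √(B p p) ≤ R} := by
  have h := (convexOn_one_add_rpow hB.1 hB.nonneg (α := 1) (by norm_num)).convex_le (1 + R ^ 2)
  convert h using 1
  ext p
  simp [Real.sqrt_le_left hR.le]

variable [FiniteDimensional ℝ E]

/-- The exponent is explained by `n · (n+2)/(2n) = 1 + n/2`: one factor comes from the determinant
of `g_t + df ⊗ df`, and `n` square roots come from normalising the normal in an `n × n` determinant.
-/
theorem graphFactor_pow [Nontrivial E] {B₀ B : E →L[ℝ] E →L[ℝ] ℝ} (hB₀ : PosDefForm B₀)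
    (hB : PosDefForm B) (p : E) :
    graphFactor B₀ B p ^ Module.finrank ℝ E
      = (B₀.inverse ∘L B).det * (1 + B₀ p (shift B₀ B p)) *
        √(1 + B₀ p (shift B₀ B p)) ^ Module.finrank ℝ E := by
  have hd := det_inverse_comp_pos hB₀ hB
  have hq : 0 < 1 + B₀ p (shift B₀ B p) := by
    have := apply_shift_nonneg (B₀ := B₀) hB p
    linarith
  have hn : (Module.finrank ℝ E : ℝ) ≠ 0 := by exact_mod_cast Module.finrank_pos.ne'
  rw [graphFactor, mul_pow, ← Real.rpow_natCast, ← Real.rpow_mul hd.le, one_div,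
    inv_mul_cancel₀ hn, Real.rpow_one, ← Real.rpow_natCast, ← Real.rpow_mul hq.le, mul_assoc]
  congr 1
  rw [Real.sqrt_eq_rpow, ← Real.rpow_natCast, ← Real.rpow_mul hq.le]
  nth_rewrite 2 [← Real.rpow_one (1 + B₀ p (shift B₀ B p))]
  rw [← Real.rpow_add hq]
  congr 1
  field_simp
  ring

/-- The determinant of the shape operator of a graph. -/
theorem det_shape [Nontrivial E] {B₀ B : E →L[ℝ] E →L[ℝ] ℝ} (hB₀ : PosDefForm B₀)
    (hB : PosDefForm B) (p : E) (C : E →L[ℝ] E →L[ℝ] ℝ) :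
    ((B + (B₀ p).smulRight (B₀ p)).inverse ∘L
        ((√(1 + B₀ p (shift B₀ B p)))⁻¹ • C)).det
      = (graphFactor B₀ B p ^ Module.finrank ℝ E)⁻¹ * (B₀.inverse ∘L C).det := by
  have hd := det_inverse_comp_pos hB₀ hB
  have hq : 0 < 1 + B₀ p (shift B₀ B p) := by
    have := apply_shift_nonneg (B₀ := B₀) hB p
    linarith
  have h := det_inverse_add_smulRight_comp (A := B₀) hB (B₀ p) C
  have h' : ((B + (B₀ p).smulRight (B₀ p)).inverse ∘L C).det *
      ((B₀.inverse ∘L B).det * (1 + B₀ p (shift B₀ B p))) = (B₀.inverse ∘L C).det := h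
  rw [det_inverse_comp_smul, graphFactor_pow hB₀ hB, ← h', inv_pow]
  have h1 := (pow_pos (Real.sqrt_pos.2 hq) (Module.finrank ℝ E)).ne'
  field_simp

end Determinant

/-! ### Symmetry, value at `t = 0`, positivity and determinant -/

section Summary

open Topology

variable {E : Type*} [NormedAddCommGroup E] [NormedSpace ℝ E]
  {H : Type*} [TopologicalSpace H] {I : ModelWithCorners ℝ E H}
  {X : Type*} [TopologicalSpace X] [ChartedSpace H X] [IsManifold I ∞ X]
  {E' : Type*} [NormedAddCommGroup E'] [NormedSpace ℝ E']
  {H' : Type*} [TopologicalSpace H'] {J : ModelWithCorners ℝ E' H'}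
  {Y : Type*} [TopologicalSpace Y] [ChartedSpace H' Y]
  {W : Set (X × ℝ)} {𝓔 : X × ℝ → Y} {g : FormField J (X := Y)}

theorem graphScaleAt_eq (g : FormField J (X := Y)) (𝓔 : X × ℝ → Y) (x : X) (t : ℝ) (p : E) :
    graphScaleAt I J g 𝓔 x t p
      = graphFactor (FormField.model I (sliceMetric I J g 𝓔 0) x)
        (FormField.model I (sliceMetric I J g 𝓔 t) x) p := by
  rw [graphScaleAt, graphScale, sliceCoeff, sliceCoeff, coordForm_self, coordForm_self]

variable [IsManifold J ∞ Y] [J.Boundaryless]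

theorem fderivWithin_sliceCoeff_symm (hpos : ∀ y, PosDefForm (FormField.model J g y))
    (hg : IsSmoothForm J g)
    (hW : IsOpen W) (h𝓔 : ContMDiffOn (I.prod 𝓘(ℝ, ℝ)) J ∞ 𝓔 W) {x₀ : X} {q : E × ℝ}
    (hq : q ∈ sliceDomain I W x₀) (u : E × ℝ) (v w : E) :
    fderivWithin ℝ (sliceCoeff I J g 𝓔 x₀) (range I ×ˢ (univ : Set ℝ)) q u v w
      = fderivWithin ℝ (sliceCoeff I J g 𝓔 x₀) (range I ×ˢ (univ : Set ℝ)) q u w v := by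
  have hu := uniqueDiffOn_prod_univ I.uniqueDiffOn q (sliceDomain_subset W x₀ hq)
  have hQ := (contDiffWithinAt_sliceCoeff hg hW h𝓔 hq).differentiableWithinAt (n := ∞) (by simp)
  rw [← fderivWithin_apply₂ hu hQ, ← fderivWithin_apply₂ hu hQ]
  congr 2
  funext q
  exact (hpos _).1 _ _

theorem graphTensorAt_symm (hpos : ∀ y, PosDefForm (FormField.model J g y))
    (hg : IsSmoothForm J g)
    {φ : X → Y} {N : (x : X) → TangentSpace J (φ x)}
    (h𝓔 : IsNormalExp I J g φ N W 𝓔)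
    {x : X} {t : ℝ} (hxt : (x, t) ∈ W) (p v w : E) :
    graphTensorAt I J g 𝓔 x t p v w = graphTensorAt I J g 𝓔 x t p w v := by
  have h := fun s (hs : (x, s) ∈ W) => fderivWithin_sliceCoeff_symm hpos hg h𝓔.isOpen h𝓔.smooth
    (mem_sliceDomain (mem_extChartAt_source (I := I) x) hs)
  exact graphForm_symm (fun u => h 0 (h𝓔.zero_mem x) (u, 0)) (fun u => h t hxt (u, 0))
    (h t hxt (0, 1)) p v w

variable [FiniteDimensional ℝ E] [FiniteDimensional ℝ E']

/-- The graph tensor at `t = 0`, in terms of the second fundamental form of the slice `t = 0`. -/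
theorem graphTensorAt_zero (hpos : ∀ y, PosDefForm (FormField.model J g y))
    (hg : IsSmoothForm J g)
    {φ : X → Y} {N : (x : X) → TangentSpace J (φ x)}
    (h𝓔 : IsNormalExp I J g φ N W 𝓔)
    (hdim : Module.finrank ℝ E' = Module.finrank ℝ E + 1)
    (hN : IsUnitNormal I J g φ N) (x : X) (p v w : E) :
    graphTensorAt I J g 𝓔 x 0 p v w
      = FormField.model I (secondForm I J g φ N) x v w
        + FormField.model I (firstForm I J g φ) x p v
          * FormField.model I (secondForm I J g φ N) x p w
        + FormField.model I (firstForm I J g φ) x p w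
          * FormField.model I (secondForm I J g φ N) x p v := by
  have hφ : (fun x => 𝓔 (x, 0)) = φ :=
    funext fun x => congrArg (fun p : TangentBundle J Y => p.1) (h𝓔.initial x)
  have hB := posDefForm_sliceMetric hpos h𝓔.isOpen h𝓔.smooth h𝓔.immersive (h𝓔.zero_mem x)
  subst hφ
  have hvel : ∀ x, modelVelocity J 𝓔 x 0 = -(show E' from N x) := fun x =>
    congrArg (fun p : TangentBundle J Y => (show E' from p.2)) (h𝓔.initial x)
  -- The graph of the zero function is the initial hypersurface. Its normal `N` points downwards
  -- because the geodesics leave with velocity `-N`.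
  have hdown : IsDownwardNormal I J g 𝓔 (fun _ => 0) N := by
    refine ⟨hN, fun x => ?_⟩
    have h1 : FormField.model J g (𝓔 (x, 0)) (show E' from N x) (modelVelocity J 𝓔 x 0)
        = -FormField.model J g (𝓔 (x, 0)) (show E' from N x) (show E' from N x) := by
      rw [hvel, map_neg]
    refine lt_of_eq_of_lt h1 ?_
    have h2 : FormField.model J g (𝓔 (x, 0)) (show E' from N x) (show E' from N x) = 1 :=
      hN.unit x
    rw [h2]
    norm_num
  have hdf : modelDeriv I 𝓘(ℝ, ℝ) (fun _ : X => (0 : ℝ)) x = 0 := mfderiv_const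
  have hgrad : gradient I (sliceMetric I J g 𝓔 0) (fun _ => 0) x = (0 : E) := by
    change (FormField.model I (sliceMetric I J g 𝓔 0) x).inverse
      (modelDeriv I 𝓘(ℝ, ℝ) (fun _ : X => (0 : ℝ)) x) = 0
    rw [hdf, map_zero]
  -- For the zero function the Hessian and the gradient vanish and the square root is 1, so the
  -- graph formula reads `A_0 = Ψ(x, 0, 0)`. By `graphForm_zero` this is `-½ ∂_t g_t` at `t = 0`.
  have hA : ∀ v w, FormField.model I (secondForm I J g (fun x => 𝓔 (x, 0)) N) x v w
      = graphTensorAt I J g 𝓔 x 0 0 v w := fun v w => by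
    refine (secondForm_graph hdim hg hpos hN h𝓔 (f := fun _ => 0) contMDiff_const h𝓔.zero_mem
      hdown x v w).trans ?_
    rw [hessian_apply hB, hgrad, hdf]
    simp [koszul, graphTensorAt, Function.comp_def]
  have hB' : PosDefForm (sliceCoeff I J g 𝓔 x (extChartAt I x x, 0)) :=
    posDefForm_sliceCoeff hpos h𝓔.isOpen h𝓔.smooth h𝓔.immersive
      (mem_sliceDomain (mem_extChartAt_source x) (h𝓔.zero_mem x))
  have hsymm := fderivWithin_sliceCoeff_symm hpos hg h𝓔.isOpen h𝓔.smooth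
    (mem_sliceDomain (mem_extChartAt_source (I := I) x) (h𝓔.zero_mem x)) (0, 1)
  have e0 : sliceCoeff I J g 𝓔 x (extChartAt I x x, 0)
      = FormField.model I (firstForm I J g fun x => 𝓔 (x, 0)) x := coordForm_self I _ x
  have h1 : ∀ p v w, graphTensorAt I J g 𝓔 x 0 p v w = _ := fun p v w =>
    graphForm_zero hB' _ _ p v w
  -- Substituting this value of `∂_t g_t` into `graphForm_zero` at a general `p` gives the two mixed
  -- terms; symmetry of `∂_t g_t` puts their arguments in the stated order.
  simp only [hA, h1, map_zero, zero_apply, mul_zero, add_zero, e0]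
  rw [hsymm v p, hsymm w p]
  ring

theorem posDefForm_secondForm_graph_iff (hpos : ∀ y, PosDefForm (FormField.model J g y))
    (hg : IsSmoothForm J g)
    {φ : X → Y} {N : (x : X) → TangentSpace J (φ x)}
    (h𝓔 : IsNormalExp I J g φ N W 𝓔)
    (hdim : Module.finrank ℝ E' = Module.finrank ℝ E + 1)
    (hN : IsUnitNormal I J g φ N) {f : X → ℝ}
    (hf : ContMDiff I 𝓘(ℝ, ℝ) ∞ f) (hx : ∀ x, (x, f x) ∈ W) {ν : X → E'}
    (hν : IsDownwardNormal I J g 𝓔 f ν) (x : X) {B : E →L[ℝ] E →L[ℝ] ℝ}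
    (hBeq : ∀ v w, B v w = hessian I (sliceMetric I J g 𝓔 0) f x v w
      + graphTensorAt I J g 𝓔 x (f x) (gradient I (sliceMetric I J g 𝓔 0) f x) v w) :
    PosDefForm (FormField.model I (secondForm I J g (graph 𝓔 f) ν) x) ↔ PosDefForm B := by
  have hB := posDefForm_sliceMetric hpos h𝓔.isOpen h𝓔.smooth h𝓔.immersive (hx x)
  have hq := hB.nonneg ((FormField.model I (sliceMetric I J g 𝓔 (f x)) x).inverse
    (modelDeriv I 𝓘(ℝ, ℝ) f x))
  rw [hB.apply_inverse] at hq
  refine posDefForm_smul_iff (inv_pos.2 (Real.sqrt_pos.2 (add_pos_of_pos_of_nonneg one_pos hq)))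
    fun v w => ?_
  rw [hBeq]
  exact secondForm_graph hdim hg hpos hN h𝓔 hf hx hν x v w

/-- The Gauss lemma gives the first form as a rank one perturbation of `g_t` and `secondForm_graph`
gives the second form as a multiple of `B`, so `det_shape` compares the determinant with that taken
relative to `g_0`. -/
theorem det_shapeOperator_graph (hpos : ∀ y, PosDefForm (FormField.model J g y))
    (hg : IsSmoothForm J g)
    {φ : X → Y} {N : (x : X) → TangentSpace J (φ x)}
    (h𝓔 : IsNormalExp I J g φ N W 𝓔)
    [Nontrivial E]
    (hdim : Module.finrank ℝ E' = Module.finrank ℝ E + 1)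
    (hN : IsUnitNormal I J g φ N) {f : X → ℝ}
    (hf : ContMDiff I 𝓘(ℝ, ℝ) ∞ f) (hx : ∀ x, (x, f x) ∈ W) {ν : X → E'}
    (hν : IsDownwardNormal I J g 𝓔 f ν) (x : X) {B : E →L[ℝ] E →L[ℝ] ℝ}
    (hBeq : ∀ v w, B v w = hessian I (sliceMetric I J g 𝓔 0) f x v w
      + graphTensorAt I J g 𝓔 x (f x) (gradient I (sliceMetric I J g 𝓔 0) f x) v w) :
    (shapeOperator I J g (graph 𝓔 f) ν x).det
      = (graphScaleAt I J g 𝓔 x (f x) (gradient I (sliceMetric I J g 𝓔 0) f x)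
          ^ Module.finrank ℝ E)⁻¹
        * (toEndo I (sliceMetric I J g 𝓔 0) x B).det := by
  have hB := posDefForm_sliceMetric hpos h𝓔.isOpen h𝓔.smooth h𝓔.immersive (hx x)
  have hB₀ := posDefForm_sliceMetric hpos h𝓔.isOpen h𝓔.smooth h𝓔.immersive (h𝓔.zero_mem x)
  have hfd : MDifferentiableAt I 𝓘(ℝ, ℝ) f x := (hf x).mdifferentiableAt (by simp)
  have hp : FormField.model I (sliceMetric I J g 𝓔 0) x
      (gradient I (sliceMetric I J g 𝓔 0) f x) = modelDeriv I 𝓘(ℝ, ℝ) f x :=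
    apply_gradient hB₀ f
  have h := det_shape hB₀ hB (gradient I (sliceMetric I J g 𝓔 0) f x) B
  have hscale := graphScaleAt_eq (I := I) g 𝓔 x (f x) (gradient I (sliceMetric I J g 𝓔 0) f x)
  rw [hscale]
  refine Eq.trans ?_ h
  have hshape : (shapeOperator I J g (graph 𝓔 f) ν x).det
      = ((FormField.model I (firstForm I J g (graph 𝓔 f)) x).inverse ∘L
        FormField.model I (secondForm I J g (graph 𝓔 f) ν) x).det := rfl
  rw [hshape, firstForm_graph hg hpos hN h𝓔 hfd (hx x), hp]
  congr 2
  ext v w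
  have hshift : modelDeriv I 𝓘(ℝ, ℝ) f x (shift (FormField.model I (sliceMetric I J g 𝓔 0) x)
      (FormField.model I (sliceMetric I J g 𝓔 (f x)) x) (gradient I (sliceMetric I J g 𝓔 0) f x))
      = modelDeriv I 𝓘(ℝ, ℝ) f x ((FormField.model I (sliceMetric I J g 𝓔 (f x)) x).inverse
        (modelDeriv I 𝓘(ℝ, ℝ) f x)) := by
    rw [← hp]
    rfl
  rw [smul_apply, smul_apply, smul_eq_mul, hBeq, hshift]
  exact secondForm_graph hdim hg hpos hN h𝓔 hf hx hν x v w

end Summary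

end GaussGraph

end

/-! ### The main theorem -/

theorem proposition3p1
    {n : ℕ} [NeZero n]
    {M : Type*} [TopologicalSpace M] [T2Space M]
    [ChartedSpace (EuclideanSpace ℝ (Fin (n + 1))) M] [IsManifold (𝓡 (n + 1)) ∞ M]
    (g : ContMDiffRiemannianMetric (𝓡 (n + 1)) ∞ (EuclideanSpace ℝ (Fin (n + 1)))
      (fun y : M => TangentSpace (𝓡 (n + 1)) y))
    {S : Type*} [TopologicalSpace S] [T2Space S] [CompactSpace S]
    [ChartedSpace (EuclideanHalfSpace n) S] [IsManifold (𝓡∂ n) ∞ S]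
    (i : S → M) (hi : GaussGraph.IsSmoothImmersion (𝓡∂ n) (𝓡 (n + 1)) i)
    (N₀ : (x : S) → TangentSpace (𝓡 (n + 1)) (i x))
    (hN₀ : GaussGraph.IsUnitNormal (𝓡∂ n) (𝓡 (n + 1)) g.inner i N₀)
    (W : Set (S × ℝ)) (𝓔 : S × ℝ → M)
    (h𝓔 : GaussGraph.IsNormalExp (𝓡∂ n) (𝓡 (n + 1)) g.inner i N₀ W 𝓔)
    (g₀ A₀ : GaussGraph.FormField (𝓡∂ n) (X := S))
    (hg₀ : g₀ = GaussGraph.firstForm (𝓡∂ n) (𝓡 (n + 1)) g.inner i)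
    (hA₀ : A₀ = GaussGraph.secondForm (𝓡∂ n) (𝓡 (n + 1)) g.inner i N₀) :
    ∃ (ψ : (x : S) → ℝ → TangentSpace (𝓡∂ n) x → ℝ)
      (Ψ Ψ₀ : (x : S) → ℝ → TangentSpace (𝓡∂ n) x →
        (TangentSpace (𝓡∂ n) x →L[ℝ] TangentSpace (𝓡∂ n) x →L[ℝ] ℝ)),
      GaussGraph.SmoothFunFamily (𝓡∂ n) W ψ ∧
      GaussGraph.SmoothFormFamily (𝓡∂ n) W Ψ ∧
      GaussGraph.SmoothFormFamily (𝓡∂ n) W Ψ₀ ∧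
      -- `ψ` is positive, and convex in `p` for `‖p‖ ≤ R` and `t` close to `0`
      (∀ x t, (x, t) ∈ W → ∀ p, 0 < ψ x t p) ∧
      (∀ R : ℝ, 0 < R → ∃ ε : ℝ, 0 < ε ∧ ∀ x t, (x, t) ∈ W → |t| < ε →
        ConvexOn ℝ {p | √(g₀ x p p) ≤ R} (ψ x t)) ∧
      -- `Ψ` is symmetric and has the stated expansion in `t`
      (∀ x t, (x, t) ∈ W → ∀ p v w, Ψ x t p v w = Ψ x t p w v) ∧
      (∀ x t, (x, t) ∈ W → ∀ p v w,
        Ψ x t p v w = A₀ x v w + g₀ x p v * A₀ x p w + g₀ x p w * A₀ x p v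
          + t * Ψ₀ x t p v w) ∧
      -- the curvature of graphs
      ∀ f : S → ℝ, ContMDiff (𝓡∂ n) 𝓘(ℝ, ℝ) ∞ f → (∀ x, (x, f x) ∈ W) →
        GaussGraph.IsSmoothImmersion (𝓡∂ n) (𝓡 (n + 1)) (GaussGraph.graph 𝓔 f) ∧
        (∃ ν, GaussGraph.IsDownwardNormal (𝓡∂ n) (𝓡 (n + 1)) g.inner 𝓔 f ν) ∧
        ∀ ν, GaussGraph.IsDownwardNormal (𝓡∂ n) (𝓡 (n + 1)) g.inner 𝓔 f ν →
          (∀ x, ∀ B, B = GaussGraph.hessian (𝓡∂ n) g₀ f x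
              + Ψ x (f x) (GaussGraph.gradient (𝓡∂ n) g₀ f x) →
            (GaussGraph.shapeOperator (𝓡∂ n) (𝓡 (n + 1)) g.inner
                (GaussGraph.graph 𝓔 f) ν x).det
              = (ψ x (f x) (GaussGraph.gradient (𝓡∂ n) g₀ f x) ^ n)⁻¹
                * (GaussGraph.toEndo (𝓡∂ n) g₀ x B).det ∧
            GaussGraph.gaussCurvature (𝓡∂ n) (𝓡 (n + 1)) g.inner
                (GaussGraph.graph 𝓔 f) ν x
              = (ψ x (f x) (GaussGraph.gradient (𝓡∂ n) g₀ f x))⁻¹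
                * (GaussGraph.toEndo (𝓡∂ n) g₀ x B).det ^ ((1 : ℝ) / n) ∧
            (GaussGraph.PosDefForm (GaussGraph.secondForm (𝓡∂ n) (𝓡 (n + 1)) g.inner
                (GaussGraph.graph 𝓔 f) ν x) ↔ GaussGraph.PosDefForm B)) ∧
          (GaussGraph.IsConvexHypersurface (𝓡∂ n) (𝓡 (n + 1)) g.inner
              (GaussGraph.graph 𝓔 f) ν ↔
            ∀ x, GaussGraph.PosDefForm (GaussGraph.hessian (𝓡∂ n) g₀ f x
              + Ψ x (f x) (GaussGraph.gradient (𝓡∂ n) g₀ f x))) := by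
  have hpos : ∀ y, GaussGraph.PosDefForm (GaussGraph.FormField.model (𝓡 (n + 1)) g.inner y) :=
    fun y => ⟨fun v w => g.symm y v w, fun v hv => g.pos y v hv⟩
  have hg := g.contMDiff
  have hW := h𝓔.isOpen
  have hs := h𝓔.smooth
  have hinj := h𝓔.immersive
  have h0 := h𝓔.zero_mem
  have hdim : Module.finrank ℝ (EuclideanSpace ℝ (Fin (n + 1)))
      = Module.finrank ℝ (EuclideanSpace ℝ (Fin n)) + 1 := by simp
  have hfin : Module.finrank ℝ (EuclideanSpace ℝ (Fin n)) = n := by simp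
  have hi0 : (fun x => 𝓔 (x, 0)) = i :=
    funext fun x => congrArg (fun p : TangentBundle (𝓡 (n + 1)) M => p.1) (h𝓔.initial x)
  have hg₀' : g₀ = GaussGraph.sliceMetric (𝓡∂ n) (𝓡 (n + 1)) g.inner 𝓔 0 := by
    rw [hg₀, GaussGraph.sliceMetric, hi0]
  have hB := fun x t (hxt : (x, t) ∈ W) =>
    GaussGraph.posDefForm_sliceMetric hpos hW hs hinj hxt
  have hscale := GaussGraph.graphScaleAt_eq (I := 𝓡∂ n) (J := 𝓡 (n + 1)) g.inner 𝓔
  have hψpos : ∀ x t, (x, t) ∈ W → ∀ p,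
      0 < GaussGraph.graphScaleAt (𝓡∂ n) (𝓡 (n + 1)) g.inner 𝓔 x t p := fun x t hxt p => by
    rw [hscale]
    exact GaussGraph.graphFactor_pos (hB x 0 (h0 x)) (hB x t hxt) p
  have hΨ : ∀ x t (p v w : EuclideanSpace ℝ (Fin n)),
      GaussGraph.graphTensorAt (𝓡∂ n) (𝓡 (n + 1)) g.inner 𝓔 x t p v w
        = GaussGraph.FormField.model (𝓡∂ n) A₀ x v w
          + GaussGraph.FormField.model (𝓡∂ n) g₀ x p v * GaussGraph.FormField.model (𝓡∂ n) A₀ x p w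
          + GaussGraph.FormField.model (𝓡∂ n) g₀ x p w * GaussGraph.FormField.model (𝓡∂ n) A₀ x p v
          + t * GaussGraph.graphRemainderAt (𝓡∂ n) (𝓡 (n + 1)) g.inner 𝓔 x t p v w :=
    fun x t p v w => by
      rw [GaussGraph.graphTensorAt_eq, GaussGraph.graphTensorAt_zero hpos hg h𝓔 hdim hN₀, hA₀, hg₀]
  refine ⟨GaussGraph.graphScaleAt (𝓡∂ n) (𝓡 (n + 1)) g.inner 𝓔,
    GaussGraph.graphTensorAt (𝓡∂ n) (𝓡 (n + 1)) g.inner 𝓔,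
    GaussGraph.graphRemainderAt (𝓡∂ n) (𝓡 (n + 1)) g.inner 𝓔,
    GaussGraph.smoothFunFamily_graphScaleAt h0 hpos hg hW hs hinj,
    GaussGraph.smoothFormFamily_graphTensorAt h0 hpos hg hW hs hinj,
    GaussGraph.smoothFormFamily_graphRemainderAt h0 hpos hg hW hs hinj, hψpos,
    -- The choice 1 is arbitrary: `ψ(x, t, ·)` is convex on the whole tangent space for every `(x,
    -- t)` in `W`, and the restriction to the ball only uses that the ball is convex.
    fun R hR => ⟨1, one_pos, fun x t hxt _ => ?_⟩,
    fun x t hxt => GaussGraph.graphTensorAt_symm hpos hg h𝓔 hxt, fun x t hxt p v w => ?_,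
    fun f hf hfW => ⟨GaussGraph.isSmoothImmersion_graph hW hs hinj hf hfW,
      ⟨_, GaussGraph.isDownwardNormal_graphNormal hg hpos hN₀ h𝓔 hf hfW⟩, fun ν hν => ?_⟩⟩
  · rw [hg₀', show GaussGraph.graphScaleAt (𝓡∂ n) (𝓡 (n + 1)) g.inner 𝓔 x t = _ from
      funext (hscale x t)]
    exact (GaussGraph.convexOn_graphFactor (hB x 0 (h0 x)) (hB x t hxt)).subset
      (subset_univ _) (GaussGraph.convex_sqrt_le (hB x 0 (h0 x)) hR)
  · exact hΨ x t p v w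
  · subst hg₀'
    have hiff := fun x B => GaussGraph.posDefForm_secondForm_graph_iff hpos hg h𝓔 hdim hN₀ hf hfW
      hν x (B := B)
    refine ⟨fun x B hBeq => ?_, forall_congr' fun x => hiff x _ fun v w => rfl⟩
    have hdet := GaussGraph.det_shapeOperator_graph hpos hg h𝓔 hdim hN₀ hf hfW hν x
      (B := B) fun v w => by rw [hBeq]; rfl
    rw [hfin] at hdet
    refine ⟨hdet, ?_, hiff x B fun v w => by rw [hBeq]; rfl⟩
    have hp := hψpos x (f x) (hfW x) (GaussGraph.gradient (𝓡∂ n)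
      (GaussGraph.sliceMetric (𝓡∂ n) (𝓡 (n + 1)) g.inner 𝓔 0) f x)
    -- Only the factor `ψ^{-n}` is known to be positive, the determinant of `B` having arbitrary
    -- sign, so the real power is distributed by `mul_rpow_of_pos`. The `n`-th root of `ψ^n` is `ψ`
    -- since `n ≠ 0`.
    rw [GaussGraph.gaussCurvature, hdet, GaussGraph.mul_rpow_of_pos (inv_pos.2 (pow_pos hp n)),
      Real.inv_rpow (pow_pos hp n).le, one_div, Real.pow_rpow_inv_natCast hp.le (NeZero.ne n)]
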